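/- Let $N\in\{1,2,3\}$, let $\Omega\subset\mathbb R^N$ be a bounded domain (open, connected, non-empty), let $d\ge 2$ and $m\le d$, and let $\mathbf a=(a_0,\dots,a_m)\in\mathbb N^{m+1}$ be an $m$-decomposition of $d$, i.e. $0=a_0<a_1<\dots<a_m=d$. Put $I_h=\{i: a_{h-1}<i\le a_h\}$ for $h=1,\dots,m$, let $\mathcal K_1$ be the set of pairs $(i,j)$ with $i\ne j$ and $i,j$ in the same $I_h$, and let $\mathcal K_2$ be the set of pairs $(i,j)\in I_h\times I_k$ with $h\ne k$. Write $|\cdot|_p$ for the norm of $L^p(\Omega)$, $t^{+}=\max(t,0)$, $t^-=\max(-t,0)$, and $$\lambda_1(\Omega)=\inf\Big\{\int_\Omega|\nabla u|^2\Big/\int_\Omega u^2 : u\in H^1_0(\Omega),\ u\neq0\Big\}$$ for the first Dirichlet eigenvalue of $-\Delta$ in $\Omega$. Assumptions. For all $i,j\in\{1,\dots,d\}$: $V_i,\beta_{ij}\in L^\infty(\Omega)$; $\beta_{ij}=\beta_{ji}$ a.e. in $\Omega$; there is a constant $\lambda_i>-\lambda_1(\Omega)$ with $V_i\ge\lambda_i$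 a.e. in $\Omega$; there is a constant $\mu_i>0$ with $\beta_{ii}\ge\mu_i$ a.e. in $\Omega$. Moreover $\beta_{ij}\ge0$ a.e. in $\Omega$ for every $(i,j)\in\mathcal K_1$. Notation. For $\mathbf u=(u_1,\dots,u_d)\in\mathbb H=(H^1_0(\Omega))^d$ let $\|u_i\|_i^2=\int_\Omega(|\nabla u_i|^2+V_iu_i^2)$, $$J_{\mathbf B}(\mathbf u)=\frac12\sum_{i=1}^d\|u_i\|_i^2-\frac14\sum_{i,j=1}^d\int_\Omega\beta_{ij}u_i^2u_j^2,\qquad \mathbf M(\mathbf B,\mathbf u)_{hk}=\sum_{(i,j)\in I_h\times I_k}\int_\Omega\beta_{ij}u_i^2u_j^2\quad(h,k=1,\dots,m),$$ $$\mathcal N_{\mathbf B}=\Big\{\mathbf u\in\mathbb H:\ \sum_{i\in I_h}\|u_i\|_i^2\ne0\ \text{ and }\ \sum_{i\in I_h}\partial_iJ_{\mathbf B}(\mathbf u)u_i=0\ \text{ for } h=1,\dots,m\Big\},$$ where $\partial_iJ_{\mathbf B}$ is the partial derivative of $J_{\mathbf B}$ with respect to $u_i$, and $$\mathcal E_{\mathbf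 B}=\Big\{\mathbf u\in\mathbb H:\ |\mathbf M(\mathbf B,\mathbf u)_{hh}|>\sum_{k\ne h}|\mathbf M(\mathbf B,\mathbf u)_{hk}|\ \text{ for } h=1,\dots,m\Big\}.$$ Statement. There exist $\bar K,\overline\gamma,\underline\gamma,\bar M>0$, which besides $N,\Omega,d,\mathbf a$ depend only on the functions $V_i$ and $\beta_{ii}$ ($i=1,\dots,d$) and on an upper bound $\Lambda$ for $\max_{(i,j)\in\mathcal K_1}|\beta_{ij}|_\infty$, such that the following holds. If $$|\beta_{ij}^+|_\infty\le\bar K\qquad\text{for every }(i,j)\in\mathcal K_2,$$ then there exists $\mathbf u\in\mathcal N_{\mathbf B}\cap\mathcal E_{\mathbf B}$ with $u_i\ge0$ a.e. in $\Omega$ for every $i$ and $J_{\mathbf B}(\mathbf u)=\min_{\mathcal N_{\mathbf B}\cap\mathcal E_{\mathbf B}}J_{\mathbf B}$; this $\mathbf u$ is a weak solution in $\mathbb H$ of $$-\Delta u_i+V_iu_i=\sum_{j=1}^d\beta_{ij}u_j^2u_i\ \text{ in }\Omega,\qquad u_i=0\ \text{ on }\partial\Omega,\qquad i=1,\dots,d,$$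 it has at least $m$ non-zero components, and $$\sum_{i=1}^d\|u_i\|_i^2\le\overline\gamma,\qquad \sum_{i\in I_h}|u_i|_4^2\ge\underline\gamma\ \text{ for } h=1,\dots,m,\qquad \sum_{i,j=1}^d\int_\Omega\beta_{ij}^-\,(u_iu_j)^2\le\bar M.$$ -/

import Mathlib

open MeasureTheory Set
open scoped ContDiff ENNReal

noncomputable section

namespace NLSSystem

/-- `φ ∈ C_c^∞(Ω)`. -/
def IsTestFunction {N : ℕ} (Ω : Set (EuclideanSpace ℝ (Fin N)))
    (φ : EuclideanSpace ℝ (Fin N) → ℝ) : Prop :=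
  ContDiff ℝ ∞ φ ∧ HasCompactSupport φ ∧ tsupport φ ⊆ Ω

/-- The Hilbert space `L²(Ω) × L²(Ω; ℝ^N)` in which the pairs `(u, ∇u)` live, with the scalar
product `∫_Ω (u v + ξ · η)`. -/
abbrev L2Pair {N : ℕ} (Ω : Set (EuclideanSpace ℝ (Fin N))) : Type :=
  WithLp 2 (Lp ℝ 2 (volume.restrict Ω) ×
    Lp (EuclideanSpace ℝ (Fin N)) 2 (volume.restrict Ω))

/-- The pairs `(φ, ∇φ)` with `φ ∈ C_c^∞(Ω)`. -/
def testPairs {N : ℕ} (Ω : Set (EuclideanSpace ℝ (Fin N))) : Submodule ℝ (L2Pair Ω) where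
  carrier := {w | ∃ φ : EuclideanSpace ℝ (Fin N) → ℝ, IsTestFunction Ω φ ∧
    w.fst =ᵐ[volume.restrict Ω] φ ∧ w.snd =ᵐ[volume.restrict Ω] gradient φ}
  add_mem' := by
    rintro v w ⟨φ, ⟨hφ, hφc, hφs⟩, h1, h2⟩ ⟨ψ, ⟨hψ, hψc, hψs⟩, h3, h4⟩
    refine ⟨φ + ψ, ⟨hφ.add hψ, hφc.add hψc, (tsupport_add φ ψ).trans (union_subset hφs hψs)⟩,
      ?_, ?_⟩
    · filter_upwards [Lp.coeFn_add v.fst w.fst, h1, h3] with x hx hx1 hx3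
      exact hx.trans (by rw [Pi.add_apply, Pi.add_apply, hx1, hx3])
    · filter_upwards [Lp.coeFn_add v.snd w.snd, h2, h4] with x hx hx2 hx4
      have e : gradient (φ + ψ) x = gradient φ x + gradient ψ x := by
        simp only [gradient]
        rw [fderiv_add (hφ.differentiable (by simp) x) (hψ.differentiable (by simp) x), map_add]
      exact hx.trans (by rw [Pi.add_apply, hx2, hx4, e])
  zero_mem' := by
    refine ⟨0, ⟨contDiff_const, HasCompactSupport.zero, by simp⟩, ?_, ?_⟩
    · exact Lp.coeFn_zero ℝ 2 (volume.restrict Ω)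
    · filter_upwards [Lp.coeFn_zero (EuclideanSpace ℝ (Fin N)) 2 (volume.restrict Ω)] with x hx
      simpa [gradient] using hx
  smul_mem' := by
    rintro c w ⟨φ, ⟨hφ, hφc, hφs⟩, h1, h2⟩
    refine ⟨c • φ, ⟨contDiff_const.smul hφ, hφc.smul_left (f := fun _ => c),
      (closure_mono (Function.support_const_smul_subset c φ)).trans hφs⟩, ?_, ?_⟩
    · filter_upwards [Lp.coeFn_smul c w.fst, h1] with x hx hx1
      simp [hx, hx1]
    · filter_upwards [Lp.coeFn_smul c w.snd, h2] with x hx hx2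
      have e : gradient (c • φ) x = c • gradient φ x := by
        simp only [gradient]
        rw [fderiv_const_smul (hφ.differentiable (by simp) x)]
        simp
      simp [hx, hx2, e]

/-- The Sobolev space `H₀¹(Ω)`: the closure of `C_c^∞(Ω)` in the norm
`(∫_Ω u² + |∇u|²)^{1/2}`. An element is stored as the pair `(u, ∇u)`, where `∇u` is the weak
gradient of `u` (hence determined by `u`). -/
abbrev H01 {N : ℕ} (Ω : Set (EuclideanSpace ℝ (Fin N))) : Submodule ℝ (L2Pair Ω) :=
  (testPairs Ω).topologicalClosure

/-- The function (class) `u` underlying an element of `H₀¹(Ω)`. -/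
def fn {N : ℕ} {Ω : Set (EuclideanSpace ℝ (Fin N))} (u : H01 Ω) :
    Lp ℝ 2 (volume.restrict Ω) := (u : L2Pair Ω).fst

/-- The weak gradient `∇u` of an element of `H₀¹(Ω)`. -/
def grad {N : ℕ} {Ω : Set (EuclideanSpace ℝ (Fin N))} (u : H01 Ω) :
    Lp (EuclideanSpace ℝ (Fin N)) 2 (volume.restrict Ω) := (u : L2Pair Ω).snd

/-- The first eigenvalue `λ₁(Ω)` of the Dirichlet Laplacian:
`inf { ∫_Ω |∇u|² / ∫_Ω u² : u ∈ H₀¹(Ω), u ≠ 0 }`. -/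
def firstEigenvalue {N : ℕ} (Ω : Set (EuclideanSpace ℝ (Fin N))) : ℝ :=
  sInf {r : ℝ | ∃ u : H01 Ω, fn u ≠ 0 ∧
    r = (∫ x in Ω, ‖grad u x‖ ^ 2) / (∫ x in Ω, fn u x ^ 2)}

/-- `⟨u, v⟩_V = ∫_Ω (∇u · ∇v + V u v)`. -/
def innerV {N : ℕ} {Ω : Set (EuclideanSpace ℝ (Fin N))}
    (V : EuclideanSpace ℝ (Fin N) → ℝ) (u v : H01 Ω) : ℝ :=
  ∫ x in Ω, (inner ℝ (grad u x) (grad v x) + V x * fn u x * fn v x)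

/-- `‖u‖_V² = ⟨u, u⟩_V`. -/
def normSqV {N : ℕ} {Ω : Set (EuclideanSpace ℝ (Fin N))}
    (V : EuclideanSpace ℝ (Fin N) → ℝ) (u : H01 Ω) : ℝ := innerV V u u

/-- `∫_Ω β u² v²`. -/
def quartic {N : ℕ} {Ω : Set (EuclideanSpace ℝ (Fin N))}
    (β : EuclideanSpace ℝ (Fin N) → ℝ) (u v : H01 Ω) : ℝ :=
  ∫ x in Ω, β x * fn u x ^ 2 * fn v x ^ 2

/-- The `L^p(Ω)` norm of a function, with values in `[0, ∞]`. -/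
def normLp {N : ℕ} (Ω : Set (EuclideanSpace ℝ (Fin N))) (p : ℝ≥0∞)
    (f : EuclideanSpace ℝ (Fin N) → ℝ) : ℝ≥0∞ := eLpNorm f p (volume.restrict Ω)

/-- The energy functional
`J(u) = 1/2 ∑ᵢ ∫_Ω (|∇uᵢ|² + Vᵢ uᵢ²) - 1/4 ∑ᵢⱼ ∫_Ω βᵢⱼ uᵢ² uⱼ²` on `(H₀¹(Ω))^d`. -/
def energy {N d : ℕ} {Ω : Set (EuclideanSpace ℝ (Fin N))}
    (V : Fin d → EuclideanSpace ℝ (Fin N) → ℝ)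
    (β : Fin d → Fin d → EuclideanSpace ℝ (Fin N) → ℝ) (u : Fin d → H01 Ω) : ℝ :=
  1 / 2 * ∑ i, normSqV (V i) (u i) - 1 / 4 * ∑ i, ∑ j, quartic (β i j) (u i) (u j)

/-- The partial derivative `∂ᵢJ(u)`, evaluated at `φ ∈ H₀¹(Ω)`. -/
def partialEnergy {N d : ℕ} {Ω : Set (EuclideanSpace ℝ (Fin N))}
    (V : Fin d → EuclideanSpace ℝ (Fin N) → ℝ)
    (β : Fin d → Fin d → EuclideanSpace ℝ (Fin N) → ℝ) (u : Fin d → H01 Ω) (i : Fin d)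
    (φ : H01 Ω) : ℝ :=
  fderiv ℝ (fun w : H01 Ω => energy V β (Function.update u i w)) (u i) φ

/-- `a = (a₀, …, a_m)` is an `m`-decomposition of `d`: `0 = a₀ < a₁ < ⋯ < a_m = d`. -/
def IsDecomposition (d : ℕ) {m : ℕ} (a : Fin (m + 1) → ℕ) : Prop :=
  StrictMono a ∧ a 0 = 0 ∧ a (Fin.last m) = d

/-- The `h`-th group of indices. Both the components and the groups are numbered from `0`, so the
condition `a_{h-1} < i ≤ a_h` for indices starting at `1` reads `a_h ≤ i < a_{h+1}`. -/
def group (d : ℕ) {m : ℕ} (a : Fin (m + 1) → ℕ) (h : Fin m) : Finset (Fin d) :=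
  {i | a h.castSucc ≤ (i : ℕ) ∧ (i : ℕ) < a h.succ}

/-- `𝒦₁`: pairs of distinct indices in the same group. -/
def K1 (d : ℕ) {m : ℕ} (a : Fin (m + 1) → ℕ) : Set (Fin d × Fin d) :=
  {p | p.1 ≠ p.2 ∧ ∃ h : Fin m, p.1 ∈ group d a h ∧ p.2 ∈ group d a h}

/-- `𝒦₂`: pairs of indices in different groups. -/
def K2 (d : ℕ) {m : ℕ} (a : Fin (m + 1) → ℕ) : Set (Fin d × Fin d) :=
  {p | ∃ h k : Fin m, h ≠ k ∧ p.1 ∈ group d a h ∧ p.2 ∈ group d a k}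

/-- The `m × m` matrix `M(B, u)` with entries `∑_{(i,j) ∈ I_h × I_k} ∫_Ω βᵢⱼ uᵢ² uⱼ²`. -/
def matM {N d m : ℕ} {Ω : Set (EuclideanSpace ℝ (Fin N))} (a : Fin (m + 1) → ℕ)
    (β : Fin d → Fin d → EuclideanSpace ℝ (Fin N) → ℝ) (u : Fin d → H01 Ω) :
    Matrix (Fin m) (Fin m) ℝ :=
  Matrix.of fun h k => ∑ i ∈ group d a h, ∑ j ∈ group d a k, quartic (β i j) (u i) (u j)

/-- A square matrix is strictly diagonally dominant if `|A_hh| > ∑_{k ≠ h} |A_hk|` for all `h`. -/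
def StrictlyDiagDominant {m : ℕ} (A : Matrix (Fin m) (Fin m) ℝ) : Prop :=
  ∀ h, ∑ k ∈ Finset.univ.erase h, |A h k| < |A h h|

/-- The Nehari-type set `𝒩_B`. -/
def nehari {N d m : ℕ} (Ω : Set (EuclideanSpace ℝ (Fin N))) (a : Fin (m + 1) → ℕ)
    (V : Fin d → EuclideanSpace ℝ (Fin N) → ℝ)
    (β : Fin d → Fin d → EuclideanSpace ℝ (Fin N) → ℝ) : Set (Fin d → H01 Ω) :=
  {u | ∀ h : Fin m, ∑ i ∈ group d a h, normSqV (V i) (u i) ≠ 0 ∧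
    ∑ i ∈ group d a h, partialEnergy V β u i (u i) = 0}

/-- The set `ℰ_B`. -/
def coneE {N d m : ℕ} (Ω : Set (EuclideanSpace ℝ (Fin N))) (a : Fin (m + 1) → ℕ)
    (β : Fin d → Fin d → EuclideanSpace ℝ (Fin N) → ℝ) : Set (Fin d → H01 Ω) :=
  {u | StrictlyDiagDominant (matM a β u)}

/-- The standing assumptions on the potentials `Vᵢ` and the couplings `βᵢⱼ`. -/
structure StandingAssumptions {N d : ℕ} (Ω : Set (EuclideanSpace ℝ (Fin N)))
    (V : Fin d → EuclideanSpace ℝ (Fin N) → ℝ)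
    (β : Fin d → Fin d → EuclideanSpace ℝ (Fin N) → ℝ) : Prop where
  memLp_V : ∀ i, MemLp (V i) ∞ (volume.restrict Ω)
  memLp_β : ∀ i j, MemLp (β i j) ∞ (volume.restrict Ω)
  symm : ∀ i j, β i j =ᵐ[volume.restrict Ω] β j i
  V_lower : ∀ i, ∃ l : ℝ, -firstEigenvalue Ω < l ∧ ∀ᵐ x ∂volume.restrict Ω, l ≤ V i x
  β_diag : ∀ i, ∃ μ : ℝ, 0 < μ ∧ ∀ᵐ x ∂volume.restrict Ω, μ ≤ β i i x

/-- `u ∈ (H₀¹(Ω))^d` is a (weak) solution of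
`-Δuᵢ + Vᵢ uᵢ = ∑ⱼ βᵢⱼ uⱼ² uᵢ` in `Ω`, `uᵢ = 0` on `∂Ω`, `i = 1, …, d`. -/
def IsSolution {N d : ℕ} {Ω : Set (EuclideanSpace ℝ (Fin N))}
    (V : Fin d → EuclideanSpace ℝ (Fin N) → ℝ)
    (β : Fin d → Fin d → EuclideanSpace ℝ (Fin N) → ℝ) (u : Fin d → H01 Ω) : Prop :=
  ∀ (i : Fin d) (φ : H01 Ω),
    IntegrableOn (fun x => (∑ j, β i j x * fn (u j) x ^ 2 * fn (u i) x) * fn φ x) Ω ∧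
    innerV (V i) (u i) φ = ∫ x in Ω, (∑ j, β i j x * fn (u j) x ^ 2 * fn (u i) x) * fn φ x

end NLSSystem

end

/-! For a vector u let y_h be the squared norm of its h-th group (`groupNorm`) and M = M(B, u)
(`matM`). Multiplying group h by √t_h turns y_h into t_h y_h and M_hk into t_h t_k M_hk. So, if y >
0 and t > 0, the scaled vector is on the Nehari set exactly when M t = y, a linear system. On the
Nehari set y = M 1 and 4J = ∑ y_h, hence minimizing J there means minimizing ∑ y_h.

Disjointly supported bumps remove all couplings between groups and give a level Γ, depending only on
the V_i and β_ii, with a point of every Nehari set below it (`exists_level`). With S the coercivity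
constant and K = S²/(8Γ), the positive off-diagonal entries of M are small compared with y whenever
∑ y_h ≤ Γ. Together with y ≤ M 1 this makes M strictly diagonally dominant with excess above y_h/2.
Nehari points of level at most Γ are therefore in ℰ automatically, and M t = y has a positive
solution (`exists_pos_mulVec_eq`). The minimum is in fact taken over the whole Nehari set.

Along a minimizing sequence the compact embedding in L⁴ passes M to the limit, whereas y is only
weakly lower semicontinuous. The limit, replaced by its absolute value, satisfies y ≤ M 1. Symmetry
of M gives y·t = ∑ y_h - ∑ t_h ((M 1)_h - y_h), so projecting onto the Nehari set would go below the
infimum unless y = M 1 (`mem_nehari_of_admissible`).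

No Lagrange multipliers occur. Along a line z + εψ the value after projection is y·t = 4J + (t -
1)·(y - M 1), and both factors of the last term are O(ε). Thus J is minimal at ε = 0 up to O(ε²),
and its derivative vanishes (`deriv_eq_zero_of_minimal`). -/

noncomputable section

namespace NLSSystem

/-! ### Diagonally dominant linear systems -/

section LinearAlgebra

variable {ι : Type*} [Fintype ι]

theorem sum_mul_mulVec_comm {M : Matrix ι ι ℝ} (hs : ∀ h k, M h k = M k h) (s t : ι → ℝ) :
    ∑ h, s h * M.mulVec t h = ∑ h, t h * M.mulVec s h := by
  simp only [Matrix.mulVec, dotProduct, Finset.mul_sum]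
  rw [Finset.sum_comm]
  refine Finset.sum_congr rfl fun h _ => Finset.sum_congr rfl fun k _ => ?_
  rw [hs k h]; ring

theorem mulVec_one_apply (M : Matrix ι ι ℝ) (h : ι) : M.mulVec 1 h = ∑ k, M h k := by
  simp [Matrix.mulVec, dotProduct]

/-- By symmetry ∑ y_h = 1·(M t) = t·(M 1). When y ≤ M 1 and t ≥ 0, passing to the solution t can
only lower the total, strictly so if t > 0 and y ≠ M 1. -/
theorem sum_mul_solution {M : Matrix ι ι ℝ} (hs : ∀ h k, M h k = M k h) {t y : ι → ℝ}
    (hsol : M.mulVec t = y) :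
    ∑ h, y h * t h = ∑ h, y h - ∑ h, t h * (∑ k, M h k - y h) := by
  have h1 := sum_mul_mulVec_comm hs 1 t
  simp only [hsol, mulVec_one_apply, Pi.one_apply, one_mul] at h1
  rw [h1, ← Finset.sum_sub_distrib]
  exact Finset.sum_congr rfl fun h _ => by ring

variable [DecidableEq ι]

/-- The row-wise excess of the diagonal over the off-diagonal entries. -/
def diagExcess (M : Matrix ι ι ℝ) (h : ι) : ℝ := M h h - ∑ k ∈ Finset.univ.erase h, |M h k|

theorem mulVec_eq_diag_add (M : Matrix ι ι ℝ) (t : ι → ℝ) (h : ι) :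
    M.mulVec t h = M h h * t h + ∑ k ∈ Finset.univ.erase h, M h k * t k := by
  rw [Matrix.mulVec, dotProduct, ← Finset.add_sum_erase _ _ (Finset.mem_univ h)]

/-- Read the row where |r| is largest: there the off-diagonal terms absorb all but the fraction
`diagExcess` of the diagonal one. This bounds the inverse in the sup norm. -/
theorem abs_le_of_mulVec_eq {M : Matrix ι ι ℝ} {r z : ι → ℝ} {C : ℝ} (hr : M.mulVec r = z)
    (hpos : ∀ h, 0 < diagExcess M h) (hz : ∀ h, |z h| ≤ C * diagExcess M h) (k : ι) :
    |r k| ≤ C := by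
  obtain ⟨h, -, hmax⟩ := Finset.exists_max_image Finset.univ (fun k => |r k|) ⟨k, Finset.mem_univ k⟩
  refine (hmax k (Finset.mem_univ k)).trans ?_
  have e := mulVec_eq_diag_add M r h
  rw [hr] at e
  have hs : |∑ k ∈ Finset.univ.erase h, M h k * r k|
      ≤ (∑ k ∈ Finset.univ.erase h, |M h k|) * |r h| := by
    rw [Finset.sum_mul]
    refine (Finset.abs_sum_le_sum_abs _ _).trans (Finset.sum_le_sum fun k _ => ?_)
    rw [abs_mul]
    exact mul_le_mul_of_nonneg_left (hmax k (Finset.mem_univ k)) (abs_nonneg _)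
  have hd : diagExcess M h * |r h| ≤ |z h| := by
    have h1 : M h h * r h = z h - ∑ k ∈ Finset.univ.erase h, M h k * r k := by linarith
    have h2 : M h h * |r h| ≤ |z h| + |∑ k ∈ Finset.univ.erase h, M h k * r k| := by
      calc M h h * |r h| ≤ |M h h| * |r h| :=
            mul_le_mul_of_nonneg_right (le_abs_self _) (abs_nonneg _)
        _ = |M h h * r h| := (abs_mul _ _).symm
        _ ≤ _ := by rw [h1]; exact abs_sub _ _
    rw [diagExcess, sub_mul]
    linarith
  have h3 : diagExcess M h * |r h| ≤ diagExcess M h * C := by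
    rw [mul_comm _ C]; exact hd.trans (hz h)
  exact le_of_mul_le_mul_left h3 (hpos h)

/-- A system whose matrix is diagonally dominant, with small positive off-diagonal part relative
to the right-hand side, has a positive solution. -/
theorem exists_pos_mulVec_eq {M : Matrix ι ι ℝ} {y : ι → ℝ} (hy : ∀ h, 0 < y h)
    (hM : ∀ h, y h / 2 ≤ diagExcess M h)
    (hp : ∀ h, 2 * ∑ k ∈ Finset.univ.erase h, max (M h k) 0 < y h) :
    ∃ t : ι → ℝ, (∀ h, 0 < t h) ∧ M.mulVec t = y := by
  have hpos : ∀ h, 0 < diagExcess M h := fun h => by have := hM h; have := hy h; linarith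
  have hdet : M.det ≠ 0 := by
    refine det_ne_zero_of_sum_row_lt_diag fun h => ?_
    have h1 := hpos h
    rw [diagExcess] at h1
    simp only [Real.norm_eq_abs]
    exact (sub_pos.1 h1).trans_le (le_abs_self _)
  have hu : IsUnit M.det := isUnit_iff_ne_zero.2 hdet
  refine ⟨M⁻¹.mulVec y, ?_, ?_⟩
  swap
  · rw [Matrix.mulVec_mulVec, Matrix.mul_nonsing_inv _ hu, Matrix.one_mulVec]
  have hsol : M.mulVec (M⁻¹.mulVec y) = y := by
    rw [Matrix.mulVec_mulVec, Matrix.mul_nonsing_inv _ hu, Matrix.one_mulVec]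
  set t := M⁻¹.mulVec y
  -- The bound 2 comes from y_h ≤ 2 `diagExcess M h`.
  have hbd : ∀ k, |t k| ≤ 2 := abs_le_of_mulVec_eq hsol hpos fun h => by
    rw [abs_of_pos (hy h)]; have := hM h; linarith
  intro k
  obtain ⟨h, -, hmin⟩ := Finset.exists_min_image Finset.univ t ⟨k, Finset.mem_univ k⟩
  refine lt_of_lt_of_le ?_ (hmin k (Finset.mem_univ k))
  -- In the row h of the smallest entry, t_h ≤ 0 would give y_h ≤ `diagExcess M h` · t_h + 2 ∑
  -- max(M_hk, 0), contradicting `hp`.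
  by_contra! hneg
  have e := mulVec_eq_diag_add M t h
  rw [hsol] at e
  have hterm : ∀ k ∈ Finset.univ.erase h, M h k * t k ≤ 2 * max (M h k) 0 - |M h k| * t h := by
    intro k _
    have h1 := hmin k (Finset.mem_univ k)
    have h2 := le_of_abs_le (hbd k)
    rcases le_total 0 (M h k) with h0 | h0
    · rw [max_eq_left h0, abs_of_nonneg h0]; nlinarith
    · rw [max_eq_right h0, abs_of_nonpos h0]; nlinarith
  have hsum := Finset.sum_le_sum hterm
  rw [Finset.sum_sub_distrib, ← Finset.mul_sum, ← Finset.sum_mul] at hsum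
  have h4 : diagExcess M h * t h ≤ 0 := mul_nonpos_of_nonneg_of_nonpos (hpos h).le hneg
  rw [diagExcess, sub_mul] at h4
  have := hp h
  linarith

end LinearAlgebra

/-! ### Vanishing derivative at a constrained minimum -/

section Calculus

open Filter Topology

variable {ι : Type*} [Fintype ι] [DecidableEq ι]

/-- If the value `y · t` at the solution `t` of `M t = y` is minimal at the parameter `0`, where
`t = 1`, then the derivative of `2 y · 1 - 1 · M 1` vanishes there. -/
theorem deriv_eq_zero_of_minimal {Y : ℝ → ι → ℝ} {M : ℝ → Matrix ι ι ℝ} {Y' : ι → ℝ}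
    {M' : ι → ι → ℝ} (hY : ∀ h, HasDerivAt (fun ε => Y ε h) (Y' h) 0)
    (hM : ∀ h k, HasDerivAt (fun ε => M ε h k) (M' h k) 0)
    (hs : ∀ ε h k, M ε h k = M ε k h) (h0 : ∀ h, Y 0 h = ∑ k, M 0 h k)
    (hy : ∀ h, 0 < Y 0 h) (hd : ∀ h, Y 0 h / 2 < diagExcess (M 0) h)
    (hp : ∀ h, 2 * ∑ k ∈ Finset.univ.erase h, max (M 0 h k) 0 < Y 0 h)
    (hmin : ∀ ε t, (∀ h, 0 < t h) → (∀ h, 0 < Y ε h) → (M ε).mulVec t = Y ε →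
      ∑ h, Y 0 h ≤ ∑ h, Y ε h * t h) :
    2 * ∑ h, Y' h - ∑ h, ∑ k, M' h k = 0 := by
  have cY : ∀ h, ContinuousAt (fun ε => Y ε h) 0 := fun h => (hY h).continuousAt
  have cM : ∀ h k, ContinuousAt (fun ε => M ε h k) 0 := fun h k => (hM h k).continuousAt
  have cD : ∀ h, ContinuousAt (fun ε => diagExcess (M ε) h) 0 := fun h => by
    unfold diagExcess
    exact (cM h h).sub (tendsto_finsetSum _ fun k _ => (cM h k).abs)
  have cP : ∀ h, ContinuousAt (fun ε => 2 * ∑ k ∈ Finset.univ.erase h, max (M ε h k) 0) 0 :=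
    fun h => continuousAt_const.mul (tendsto_finsetSum _ fun k _ =>
      (cM h k).max continuousAt_const)
  have eY : ∀ᶠ ε in 𝓝 (0 : ℝ), ∀ h, Y 0 h / 2 < Y ε h := eventually_all.2 fun h =>
    (cY h).eventually_const_lt (by have := hy h; linarith)
  have eD : ∀ᶠ ε in 𝓝 (0 : ℝ), ∀ h, Y ε h / 2 < diagExcess (M ε) h := eventually_all.2 fun h =>
    ((cY h).div_const 2).eventually_lt (cD h) (hd h)
  have eP : ∀ᶠ ε in 𝓝 (0 : ℝ), ∀ h, 2 * ∑ k ∈ Finset.univ.erase h, max (M ε h k) 0 < Y ε h :=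
    eventually_all.2 fun h => (cP h).eventually_lt (cY h) (hp h)
  -- The defect from the Nehari condition: zero at ε = 0 and differentiable there, hence O(ε).
  set R : ℝ → ι → ℝ := fun ε h => Y ε h - ∑ k, M ε h k with hR
  have hR' : ∀ h, HasDerivAt (fun ε => R ε h) (Y' h - ∑ k, M' h k) 0 := fun h =>
    (hY h).sub (HasDerivAt.fun_sum fun k _ => hM h k)
  have hb : ∀ h, ∃ C, 0 ≤ C ∧ ∀ᶠ ε in 𝓝 (0 : ℝ), |R ε h| ≤ C * |ε| := fun h => by
    obtain ⟨C, hC0, hC⟩ := (hR' h).isBigO_sub.exists_nonneg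
    refine ⟨C, hC0, ?_⟩
    filter_upwards [hC.bound] with ε hε
    have : R 0 h = 0 := by simp [hR, h0 h]
    simpa [this] using hε
  choose C hC0 hC using hb
  have eC : ∀ᶠ ε in 𝓝 (0 : ℝ), ∀ h, |R ε h| ≤ C h * |ε| := eventually_all.2 hC
  set C2 := ∑ h, 4 * C h / Y 0 h with hC2
  have hnn : ∀ h, 0 ≤ 4 * C h / Y 0 h := fun h =>
    div_nonneg (mul_nonneg (by norm_num) (hC0 h)) (hy h).le
  have hC2h : ∀ h, 4 * C h / Y 0 h ≤ C2 := fun h =>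
    Finset.single_le_sum (f := fun h => 4 * C h / Y 0 h) (fun k _ => hnn k) (Finset.mem_univ h)
  set g : ℝ → ℝ := fun ε => 2 * ∑ h, Y ε h - ∑ h, ∑ k, M ε h k with hg
  have key : ∀ᶠ ε in 𝓝 (0 : ℝ), g 0 ≤ g ε + (∑ h, C2 * C h) * ε ^ 2 := by
    filter_upwards [eY, eD, eP, eC] with ε h1 h2 h3 h4
    have hyε : ∀ h, 0 < Y ε h := fun h => by have := h1 h; have := hy h; linarith
    obtain ⟨t, htpos, ht⟩ := exists_pos_mulVec_eq hyε (fun h => (h2 h).le) h3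
    have hle := hmin ε t htpos hyε ht
    have hr : (M ε).mulVec (t - 1) = R ε := by
      rw [Matrix.mulVec_sub, ht]
      funext h
      simp [hR, Matrix.mulVec, dotProduct]
    -- t - 1 solves the system with right-hand side R, and the diagonal excess stays above Y 0 h / 4
    -- near 0, so t - 1 is O(ε) too.
    have hsmall : ∀ k, |(t - 1) k| ≤ C2 * |ε| := abs_le_of_mulVec_eq hr
      (fun h => by have := h2 h; have := hyε h; linarith) (fun h => by
        refine (h4 h).trans ?_
        have hq : Y 0 h / 4 ≤ diagExcess (M ε) h := by have := h1 h; have := h2 h; linarith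
        calc C h * |ε| = 4 * C h / Y 0 h * |ε| * (Y 0 h / 4) := by
              have := (hy h).ne'; field_simp
          _ ≤ C2 * |ε| * diagExcess (M ε) h := by
              have h5 := hC2h h
              have h6 := hnn h
              have h7 := hy h
              exact mul_le_mul (mul_le_mul_of_nonneg_right h5 (abs_nonneg _)) hq (by positivity)
                (mul_nonneg (h6.trans h5) (abs_nonneg _)))
    -- The projected value differs from g by a product of two O(ε) vectors.
    have hgid : ∑ h, Y ε h * t h = g ε + ∑ h, (t - 1) h * R ε h := by
      have e1 := sum_mul_mulVec_comm (hs ε) 1 t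
      simp only [ht, mulVec_one_apply, Pi.one_apply, one_mul] at e1
      have e2 : ∑ h, (t - 1) h * R ε h = ∑ h, Y ε h * t h - ∑ h, t h * ∑ k, M ε h k
          - ∑ h, Y ε h + ∑ h, ∑ k, M ε h k := by
        rw [← Finset.sum_sub_distrib, ← Finset.sum_sub_distrib, ← Finset.sum_add_distrib]
        exact Finset.sum_congr rfl fun h _ => by simp only [hR, Pi.sub_apply, Pi.one_apply]; ring
      rw [e2, ← e1]
      simp only [hg]
      ring
    have hrem : ∑ h, (t - 1) h * R ε h ≤ (∑ h, C2 * C h) * ε ^ 2 := by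
      rw [Finset.sum_mul]
      refine Finset.sum_le_sum fun h _ => ?_
      calc (t - 1) h * R ε h ≤ |(t - 1) h| * |R ε h| := by
            rw [← abs_mul]; exact le_abs_self _
        _ ≤ (C2 * |ε|) * (C h * |ε|) :=
            mul_le_mul (hsmall h) (h4 h) (abs_nonneg _) ((abs_nonneg _).trans (hsmall h))
        _ = C2 * C h * ε ^ 2 := by rw [← sq_abs ε]; ring
    have hg0 : g 0 = ∑ h, Y 0 h := by
      simp only [hg, ← h0]; ring
    rw [hg0]
    linarith
  have hgd : HasDerivAt g (2 * ∑ h, Y' h - ∑ h, ∑ k, M' h k) 0 :=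
    ((HasDerivAt.fun_sum fun h _ => hY h).const_mul 2).sub
      (HasDerivAt.fun_sum fun h _ => HasDerivAt.fun_sum fun k _ => hM h k)
  have hgd' : HasDerivAt (fun ε => g ε + (∑ h, C2 * C h) * ε ^ 2)
      (2 * ∑ h, Y' h - ∑ h, ∑ k, M' h k + (∑ h, C2 * C h) * ((2 : ℕ) * (0 : ℝ) ^ (2 - 1) * 1)) 0 :=
    hgd.add (((hasDerivAt_id (0 : ℝ)).pow 2).const_mul _)
  -- The quadratic correction has zero derivative at 0, so Fermat's theorem applies to g itself.
  have hloc : IsLocalMin (fun ε => g ε + (∑ h, C2 * C h) * ε ^ 2) 0 := by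
    filter_upwards [key] with ε hε
    simpa using hε
  simpa using hloc.hasDerivAt_eq_zero hgd'

end Calculus

/-! ### Weak sequential compactness in H₀¹ -/

section WeakCompactness

open Filter Topology

/-- Bounded sequences in a separable Hilbert space have weakly convergent subsequences. -/
theorem exists_subseq_tendsto_inner {H : Type*} [NormedAddCommGroup H] [InnerProductSpace ℝ H]
    [CompleteSpace H] [TopologicalSpace.SeparableSpace H] {u : ℕ → H} {R : ℝ}
    (hu : ∀ n, ‖u n‖ ≤ R) :
    ∃ (w : H) (φ : ℕ → ℕ), StrictMono φ ∧
      ∀ v, Tendsto (fun n => inner ℝ (u (φ n)) v) atTop (𝓝 (inner ℝ w v)) := by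
  obtain ⟨f, -, φ, hφ, hlim⟩ := WeakDual.isSeqCompact_closedBall ℝ H 0 R
    (x := fun n => StrongDual.toWeakDual (InnerProductSpace.toDual ℝ H (u n))) (fun n => by
      simpa using hu n)
  refine ⟨(InnerProductSpace.toDual ℝ H).symm (WeakDual.toStrongDual f), φ, hφ, fun v => ?_⟩
  have h := ((WeakDual.eval_continuous v).tendsto f).comp hlim
  rw [InnerProductSpace.toDual_symm_apply]
  exact h

instance separableSpace_H01 {N : ℕ} (Ω : Set (EuclideanSpace ℝ (Fin N))) :
    TopologicalSpace.SeparableSpace (H01 Ω) := by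
  have : Fact ((2 : ℝ≥0∞) ≠ ⊤) := ⟨by simp⟩
  have : SecondCountableTopology (Lp ℝ 2 (volume.restrict Ω)) := Lp.SecondCountableTopology
  have : SecondCountableTopology (Lp (EuclideanSpace ℝ (Fin N)) 2 (volume.restrict Ω)) :=
    Lp.SecondCountableTopology
  have : SecondCountableTopology (L2Pair Ω) := WithLp.secondCountableTopology _ _ _
  exact TopologicalSpace.SecondCountableTopology.to_separableSpace

instance completeSpace_H01 {N : ℕ} (Ω : Set (EuclideanSpace ℝ (Fin N))) :
    CompleteSpace (H01 Ω) :=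
  (Submodule.isClosed_topologicalClosure _).completeSpace_coe

end WeakCompactness

/-! ### Test functions as elements of H₀¹ -/

section TestElements

open Filter Topology

variable {N : ℕ} {Ω : Set (EuclideanSpace ℝ (Fin N))}

theorem continuous_gradient {φ : EuclideanSpace ℝ (Fin N) → ℝ} (h : ContDiff ℝ ∞ φ) :
    Continuous (gradient φ) :=
  (InnerProductSpace.toDual ℝ (EuclideanSpace ℝ (Fin N))).symm.continuous.comp
    (h.continuous_fderiv (by simp))

theorem norm_gradient (φ : EuclideanSpace ℝ (Fin N) → ℝ) (x : EuclideanSpace ℝ (Fin N)) :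
    ‖gradient φ x‖ = ‖fderiv ℝ φ x‖ := by simp [gradient]

theorem hasCompactSupport_gradient {φ : EuclideanSpace ℝ (Fin N) → ℝ} (h : HasCompactSupport φ) :
    HasCompactSupport (gradient φ) :=
  (h.fderiv ℝ).comp_left (map_zero (InnerProductSpace.toDual ℝ (EuclideanSpace ℝ (Fin N))).symm)

theorem IsTestFunction.memLp {φ : EuclideanSpace ℝ (Fin N) → ℝ} (h : IsTestFunction Ω φ)
    (p : ℝ≥0∞) : MemLp φ p (volume.restrict Ω) :=
  (h.1.continuous.memLp_of_hasCompactSupport h.2.1).restrict Ω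

theorem IsTestFunction.memLp_gradient {φ : EuclideanSpace ℝ (Fin N) → ℝ}
    (h : IsTestFunction Ω φ) (p : ℝ≥0∞) : MemLp (gradient φ) p (volume.restrict Ω) :=
  ((continuous_gradient h.1).memLp_of_hasCompactSupport (hasCompactSupport_gradient h.2.1)).restrict
    Ω

theorem IsTestFunction.support_subset {φ : EuclideanSpace ℝ (Fin N) → ℝ}
    (h : IsTestFunction Ω φ) : Function.support φ ⊆ Ω := (subset_tsupport φ).trans h.2.2

theorem IsTestFunction.support_fderiv_subset {φ : EuclideanSpace ℝ (Fin N) → ℝ}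
    (h : IsTestFunction Ω φ) : Function.support (fderiv ℝ φ) ⊆ Ω :=
  ((subset_tsupport _).trans (tsupport_fderiv_subset ℝ)).trans h.2.2

theorem eLpNorm_restrict_of_support_subset {α F : Type*} [MeasurableSpace α] {μ : Measure α}
    [NormedAddCommGroup F] {s : Set α} {f : α → F} (h : Function.support f ⊆ s) (p : ℝ≥0∞) :
    eLpNorm f p (μ.restrict s) = eLpNorm f p μ :=
  eLpNorm_restrict_eq_of_support_subset h

theorem IsTestFunction.eLpNorm_fderiv_restrict {φ : EuclideanSpace ℝ (Fin N) → ℝ}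
    (h : IsTestFunction Ω φ) (p : ℝ≥0∞) :
    eLpNorm (fderiv ℝ φ) p (volume.restrict Ω) = eLpNorm (fderiv ℝ φ) p volume :=
  eLpNorm_restrict_of_support_subset h.support_fderiv_subset p

/-- A test function as an element of `H₀¹(Ω)`. -/
def testElem {φ : EuclideanSpace ℝ (Fin N) → ℝ} (h : IsTestFunction Ω φ) : H01 Ω :=
  ⟨WithLp.toLp 2 ((h.memLp 2).toLp φ, (h.memLp_gradient 2).toLp _),
    Submodule.le_topologicalClosure _ ⟨φ, h, (h.memLp 2).coeFn_toLp, (h.memLp_gradient 2).coeFn_toLp⟩⟩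

theorem fn_testElem {φ : EuclideanSpace ℝ (Fin N) → ℝ} (h : IsTestFunction Ω φ) :
    fn (testElem h) =ᵐ[volume.restrict Ω] φ :=
  (h.memLp 2).coeFn_toLp

theorem grad_testElem {φ : EuclideanSpace ℝ (Fin N) → ℝ} (h : IsTestFunction Ω φ) :
    grad (testElem h) =ᵐ[volume.restrict Ω] gradient φ :=
  (h.memLp_gradient 2).coeFn_toLp

theorem exists_seq_testElem (u : H01 Ω) :
    ∃ (φ : ℕ → EuclideanSpace ℝ (Fin N) → ℝ) (h : ∀ n, IsTestFunction Ω (φ n)),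
      Tendsto (fun n => testElem (h n)) atTop (𝓝 u) := by
  obtain ⟨w, hw, hlim⟩ := mem_closure_iff_seq_limit.1 u.2
  choose φ h h1 h2 using hw
  refine ⟨φ, h, tendsto_subtype_rng.2 ?_⟩
  convert hlim using 2 with n
  have e1 : (testElem (h n) : L2Pair Ω).fst = (w n).fst :=
    Lp.ext ((fn_testElem (h n)).trans (h1 n).symm)
  have e2 : (testElem (h n) : L2Pair Ω).snd = (w n).snd :=
    Lp.ext ((grad_testElem (h n)).trans (h2 n).symm)
  exact (WithLp.equiv 2 _).injective (Prod.ext e1 e2)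

/-- `u ↦ u` as a continuous linear map `H₀¹(Ω) → L²(Ω)`. -/
def fnL (Ω : Set (EuclideanSpace ℝ (Fin N))) : H01 Ω →L[ℝ] Lp ℝ 2 (volume.restrict Ω) :=
  (WithLp.fstL 2 ℝ _ _).comp (H01 Ω).subtypeL

/-- `u ↦ ∇u` as a continuous linear map `H₀¹(Ω) → L²(Ω; ℝ^N)`. -/
def gradL (Ω : Set (EuclideanSpace ℝ (Fin N))) :
    H01 Ω →L[ℝ] Lp (EuclideanSpace ℝ (Fin N)) 2 (volume.restrict Ω) :=
  (WithLp.sndL 2 ℝ _ _).comp (H01 Ω).subtypeL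

@[simp] theorem fnL_apply (u : H01 Ω) : fnL Ω u = fn u := rfl

theorem norm_sq_H01 (u : H01 Ω) : ‖u‖ ^ 2 = ‖fn u‖ ^ 2 + ‖grad u‖ ^ 2 :=
  WithLp.prod_norm_sq_eq_of_L2 (u : L2Pair Ω)

end TestElements

/-! ### Sobolev inequality with exponent 6 -/

section Sobolev

open Filter Topology

variable {N : ℕ} {Ω : Set (EuclideanSpace ℝ (Fin N))}

/-- Hölder on a set of finite measure. It lowers the gradient exponent to the one that suits the
dimension: 1 for N = 1 and 3/2 for N = 2. -/
theorem eLpNorm_fderiv_le_of_isTestFunction (hΩb : Bornology.IsBounded Ω) {p : ℝ≥0∞}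
    (hp : p ≤ 2) : ∃ C : NNReal, ∀ φ, IsTestFunction Ω φ →
      eLpNorm (fderiv ℝ φ) p volume ≤ C * eLpNorm (fderiv ℝ φ) 2 volume := by
  rcases eq_or_ne p 0 with rfl | hp0
  · exact ⟨0, fun φ _ => by simp⟩
  have hexp : (0 : ℝ) ≤ 1 / p.toReal - 1 / (2 : ℝ≥0∞).toReal := by
    have h1 : p.toReal ≤ (2 : ℝ≥0∞).toReal := ENNReal.toReal_mono (by simp) hp
    have h2 : 0 < p.toReal := ENNReal.toReal_pos hp0 (ne_top_of_le_ne_top (by simp) hp)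
    have := one_div_le_one_div_of_le h2 h1
    linarith
  have hfin : volume Ω ^ (1 / p.toReal - 1 / (2 : ℝ≥0∞).toReal) ≠ ⊤ :=
    ENNReal.rpow_ne_top_of_nonneg hexp hΩb.measure_lt_top.ne
  refine ⟨(volume Ω ^ (1 / p.toReal - 1 / (2 : ℝ≥0∞).toReal)).toNNReal, fun φ h => ?_⟩
  have := eLpNorm_le_eLpNorm_mul_rpow_measure_univ (μ := volume.restrict Ω) hp
    (h.1.continuous_fderiv (by simp)).aestronglyMeasurable
  rw [h.eLpNorm_fderiv_restrict, h.eLpNorm_fderiv_restrict, Measure.restrict_apply_univ] at this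
  rwa [ENNReal.coe_toNNReal hfin, mul_comm]

/-- The fundamental theorem of calculus gives |φ(x)| ≤ ∫ |φ'|, a sup bound that passes to L⁶ because
Ω has finite measure. -/
theorem sobolev_one_dim {Ω : Set (EuclideanSpace ℝ (Fin 1))} (hΩb : Bornology.IsBounded Ω) :
    ∃ C : NNReal, ∀ φ, IsTestFunction Ω φ →
      eLpNorm φ 6 volume ≤ C * eLpNorm (fderiv ℝ φ) 2 volume := by
  obtain ⟨C, hC⟩ := eLpNorm_fderiv_le_of_isTestFunction hΩb (p := 1) (by norm_num)
  have hfin : volume Ω ^ (6 : ℝ≥0∞).toReal⁻¹ ≠ ⊤ :=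
    ENNReal.rpow_ne_top_of_nonneg (inv_nonneg.2 ENNReal.toReal_nonneg) hΩb.measure_lt_top.ne
  refine ⟨C * (volume Ω ^ (6 : ℝ≥0∞).toReal⁻¹).toNNReal, fun φ h => ?_⟩
  have hpt : ∀ x, ‖φ x‖ₑ ≤ eLpNorm (fderiv ℝ φ) 1 volume := by
    intro x
    obtain ⟨L⟩ : Nonempty (ℝ ≃ₗᵢ[ℝ] EuclideanSpace ℝ (Fin 1)) :=
      ⟨(OrthonormalBasis.singleton (Fin 1) ℝ).repr⟩
    have h1 := HasCompactSupport.enorm_le_lintegral_Ici_deriv (f := φ ∘ L)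
      ((h.1.of_le (by simp)).comp L.contDiff)
      (h.2.1.comp_isClosedEmbedding L.toHomeomorph.isClosedEmbedding) (L.symm x)
    simp only [Function.comp_apply, LinearIsometryEquiv.apply_symm_apply] at h1
    refine h1.trans ((setLIntegral_le_lintegral _ _).trans ?_)
    rw [eLpNorm_one_eq_lintegral_enorm,
      ← L.measurePreserving.lintegral_comp_emb L.toHomeomorph.measurableEmbedding]
    refine lintegral_mono fun t => ?_
    have hd : HasDerivAt (φ ∘ L) (fderiv ℝ φ (L t) (L 1)) t := by
      have := (h.1.differentiable (by simp) (L t)).hasFDerivAt.comp_hasDerivAt t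
        (L.toContinuousLinearEquiv.toContinuousLinearMap.hasDerivAt (x := t))
      exact this
    rw [hd.deriv, enorm_eq_nnnorm, enorm_eq_nnnorm, ENNReal.coe_le_coe]
    refine ((fderiv ℝ φ (L t)).le_opNNNorm _).trans ?_
    have : ‖L (1 : ℝ)‖₊ = 1 := by simp
    rw [this, mul_one]
  have h2 := eLpNorm_le_of_ae_enorm_bound (p := 6) (μ := volume.restrict Ω)
    (Eventually.of_forall hpt)
  rw [eLpNorm_restrict_eq_of_support_subset h.support_subset, Measure.restrict_apply_univ,
    smul_eq_mul] at h2
  rw [ENNReal.coe_mul, ENNReal.coe_toNNReal hfin]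
  calc _ ≤ _ := h2
    _ ≤ (C * eLpNorm (fderiv ℝ φ) 2 volume) * volume Ω ^ (6 : ℝ≥0∞).toReal⁻¹ := by
        gcongr; exact hC φ h
    _ = _ := by ring

/-- The exponent 6 serves every dimension: it is critical for gradients in L² when N = 3 and in
L^{3/2} when N = 2. -/
theorem sobolev_testFunction (hN1 : 1 ≤ N) (hN3 : N ≤ 3) (hΩb : Bornology.IsBounded Ω) :
    ∃ C : NNReal, ∀ φ, IsTestFunction Ω φ →
      eLpNorm φ 6 volume ≤ C * eLpNorm (fderiv ℝ φ) 2 volume := by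
  interval_cases N
  · exact sobolev_one_dim hΩb
  · obtain ⟨C, hC⟩ := eLpNorm_fderiv_le_of_isTestFunction hΩb (p := (3 / 2 : NNReal)) (by
      rw [← ENNReal.coe_ofNat, ENNReal.coe_le_coe, ← NNReal.coe_le_coe]; norm_num)
    refine ⟨eLpNormLESNormFDerivOfLeConst ℝ volume Ω (3 / 2) 6 * C, fun φ h => ?_⟩
    have := eLpNorm_le_eLpNorm_fderiv_of_le (μ := (volume : Measure (EuclideanSpace ℝ (Fin 2))))
      (p := 3 / 2) (q := 6) (h.1.of_le (by simp)) h.support_subset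
      (by rw [← NNReal.coe_le_coe]; norm_num)
      (by rw [← NNReal.coe_lt_coe]; norm_num)
      (by push_cast; norm_num) hΩb
    calc _ ≤ _ := this
      _ ≤ eLpNormLESNormFDerivOfLeConst ℝ volume Ω (3 / 2) 6 *
          (C * eLpNorm (fderiv ℝ φ) 2 volume) := by gcongr; exact hC φ h
      _ = _ := by rw [ENNReal.coe_mul, mul_assoc]
  · refine ⟨eLpNormLESNormFDerivOfLeConst ℝ volume Ω 2 6, fun φ h => ?_⟩
    exact eLpNorm_le_eLpNorm_fderiv_of_le (μ := (volume : Measure (EuclideanSpace ℝ (Fin 3))))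
      (p := 2) (q := 6) (h.1.of_le (by simp)) h.support_subset (by norm_num)
      (by rw [← NNReal.coe_lt_coe]; norm_num)
      (by push_cast; norm_num) hΩb

/-- The Sobolev inequality `|u|₆ ≤ C |∇u|₂` in `H₀¹(Ω)`. -/
theorem sobolev_H01 (hN1 : 1 ≤ N) (hN3 : N ≤ 3) (hΩb : Bornology.IsBounded Ω) :
    ∃ C : NNReal, ∀ u : H01 Ω,
      eLpNorm (fn u) 6 (volume.restrict Ω) ≤ C * ‖grad u‖ₑ := by
  obtain ⟨C, hC⟩ := sobolev_testFunction hN1 hN3 hΩb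
  refine ⟨C, fun u => ?_⟩
  obtain ⟨φ, h, hlim⟩ := exists_seq_testElem u
  have hfn : Tendsto (fun n => fn (testElem (h n))) atTop (𝓝 (fn u)) :=
    ((fnL Ω).continuous.tendsto u).comp hlim
  have hgr : Tendsto (fun n => ‖grad (testElem (h n))‖ₑ) atTop (𝓝 ‖grad u‖ₑ) :=
    (((gradL Ω).continuous.tendsto u).comp hlim).enorm
  -- L² convergence gives an a.e. convergent subsequence, along which the L⁶ norm is lower
  -- semicontinuous by Fatou.
  obtain ⟨ns, hns, hae⟩ := (tendstoInMeasure_of_tendsto_Lp hfn).exists_seq_tendsto_ae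
  refine (Lp.eLpNorm_lim_le_liminf_eLpNorm (fun n => (Lp.aestronglyMeasurable _)) _ hae).trans ?_
  have hbound : ∀ n, eLpNorm (fn (testElem (h (ns n)))) 6 (volume.restrict Ω)
      ≤ C * ‖grad (testElem (h (ns n)))‖ₑ := fun n => by
    rw [eLpNorm_congr_ae (fn_testElem (h (ns n))), Lp.enorm_def,
      eLpNorm_congr_ae (grad_testElem (h (ns n))),
      eLpNorm_restrict_eq_of_support_subset (h (ns n)).support_subset,
      eLpNorm_congr_norm_ae (Eventually.of_forall (norm_gradient (φ (ns n)))),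
      (h (ns n)).eLpNorm_fderiv_restrict]
    exact hC _ (h (ns n))
  have hlim2 : Tendsto (fun n => (C : ℝ≥0∞) * ‖grad (testElem (h (ns n)))‖ₑ) atTop
      (𝓝 (C * ‖grad u‖ₑ)) :=
    ENNReal.Tendsto.const_mul (hgr.comp hns.tendsto_atTop) (Or.inr (by simp))
  exact (liminf_le_liminf (Eventually.of_forall hbound)).trans hlim2.liminf_eq.le

end Sobolev

/-! ### Rellich's theorem via the Fourier transform -/

section Rellich

open Filter Topology

variable {N : ℕ} {Ω : Set (EuclideanSpace ℝ (Fin N))}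

/-- The integral of `f ∈ L²(Ω)` against the plane wave `x ↦ g (2π x · ξ)`. -/
def waveIntegral (g : ℝ → ℝ) (f : Lp ℝ 2 (volume.restrict Ω)) (ξ : EuclideanSpace ℝ (Fin N)) : ℝ :=
  ∫ x in Ω, g (2 * Real.pi * inner ℝ x ξ) * f x

/-- The squared modulus of the Fourier transform of `f ∈ L²(Ω)`. -/
def powerSpectrum (f : Lp ℝ 2 (volume.restrict Ω)) (ξ : EuclideanSpace ℝ (Fin N)) : ℝ :=
  waveIntegral Real.cos f ξ ^ 2 + waveIntegral Real.sin f ξ ^ 2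

theorem integral_mul_eq_inner {g : EuclideanSpace ℝ (Fin N) → ℝ}
    (hg : MemLp g 2 (volume.restrict Ω)) (f : Lp ℝ 2 (volume.restrict Ω)) :
    ∫ x in Ω, g x * f x = inner ℝ (hg.toLp g) f := by
  rw [L2.inner_def]
  refine integral_congr_ae ?_
  filter_upwards [hg.coeFn_toLp] with x hx
  simp [hx, mul_comm]

theorem memLp_wave [IsFiniteMeasure (volume.restrict Ω)] {g : ℝ → ℝ} (hg : Continuous g)
    (hb : ∀ t, |g t| ≤ 1) (ξ : EuclideanSpace ℝ (Fin N)) :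
    MemLp (fun x => g (2 * Real.pi * inner ℝ x ξ)) 2 (volume.restrict Ω) :=
  MemLp.of_bound (by fun_prop) 1 (Eventually.of_forall fun x => hb _)

theorem abs_waveIntegral_le [IsFiniteMeasure (volume.restrict Ω)] {g : ℝ → ℝ} (hg : Continuous g)
    (hb : ∀ t, |g t| ≤ 1) (f : Lp ℝ 2 (volume.restrict Ω)) (ξ : EuclideanSpace ℝ (Fin N)) :
    |waveIntegral g f ξ| ≤ measureUnivNNReal (volume.restrict Ω) ^ (2 : ℝ≥0∞).toReal⁻¹ * ‖f‖ := by
  rw [waveIntegral, integral_mul_eq_inner (memLp_wave hg hb ξ)]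
  refine (abs_real_inner_le_norm _ _).trans (mul_le_mul_of_nonneg_right ?_ (norm_nonneg _))
  have := Lp.norm_le_of_ae_bound (f := (memLp_wave (Ω := Ω) hg hb ξ).toLp _) zero_le_one (by
    filter_upwards [(memLp_wave (Ω := Ω) hg hb ξ).coeFn_toLp] with x hx
    rw [hx]; exact hb _)
  simpa using this

theorem continuous_waveIntegral [IsFiniteMeasure (volume.restrict Ω)] {g : ℝ → ℝ}
    (hg : Continuous g) (hb : ∀ t, |g t| ≤ 1) (f : Lp ℝ 2 (volume.restrict Ω)) :
    Continuous (waveIntegral g f) := by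
  have hf : Integrable f (volume.restrict Ω) := (Lp.memLp f).integrable (by norm_num)
  refine continuous_of_dominated (bound := fun x => ‖f x‖) (fun ξ => ?_) (fun ξ => ?_) hf.norm ?_
  · exact (memLp_wave hg hb ξ).1.mul hf.1
  · refine Eventually.of_forall fun x => ?_
    rw [norm_mul]
    exact mul_le_of_le_one_left (norm_nonneg _) (hb _)
  · exact Eventually.of_forall fun x => by fun_prop

/-- Plane waves restricted to Ω belong to L²(Ω), so weak convergence makes the spectra converge
pointwise. They are uniformly bounded, so dominated convergence applies on sets of finite measure.
-/
theorem tendsto_integral_powerSpectrum [IsFiniteMeasure (volume.restrict Ω)]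
    {f : ℕ → Lp ℝ 2 (volume.restrict Ω)} {f₀ : Lp ℝ 2 (volume.restrict Ω)} {R : ℝ}
    (hR : ∀ n, ‖f n‖ ≤ R) (hw : ∀ v, Tendsto (fun n => inner ℝ v (f n)) atTop (𝓝 (inner ℝ v f₀)))
    {B : Set (EuclideanSpace ℝ (Fin N))} (hB : volume B < ⊤) :
    Tendsto (fun n => ∫ ξ in B, powerSpectrum (f n) ξ) atTop
      (𝓝 (∫ ξ in B, powerSpectrum f₀ ξ)) := by
  have hcos : ∀ t, |Real.cos t| ≤ 1 := Real.abs_cos_le_one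
  have hsin : ∀ t, |Real.sin t| ≤ 1 := Real.abs_sin_le_one
  set b : ℝ := measureUnivNNReal (volume.restrict Ω) ^ (2 : ℝ≥0∞).toReal⁻¹ with hbdef
  have hb0 : 0 ≤ b := Real.rpow_nonneg NNReal.zero_le_coe _
  have : IsFiniteMeasure (volume.restrict B) := ⟨by simpa using hB⟩
  have hwave : ∀ g : ℝ → ℝ, Continuous g → (∀ t, |g t| ≤ 1) → ∀ n ξ,
      waveIntegral g (f n) ξ ^ 2 ≤ (b * R) ^ 2 := fun g hg hgb n ξ => by
    rw [← sq_abs]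
    refine pow_le_pow_left₀ (abs_nonneg _) ((abs_waveIntegral_le hg hgb _ _).trans ?_) 2
    exact mul_le_mul_of_nonneg_left (hR n) hb0
  have hlim : ∀ g : ℝ → ℝ, Continuous g → (∀ t, |g t| ≤ 1) → ∀ ξ,
      Tendsto (fun n => waveIntegral g (f n) ξ) atTop (𝓝 (waveIntegral g f₀ ξ)) :=
    fun g hg hgb ξ => by
      simp only [waveIntegral, integral_mul_eq_inner (memLp_wave hg hgb ξ)]
      exact hw _
  refine tendsto_integral_of_dominated_convergence (fun _ => (b * R) ^ 2 + (b * R) ^ 2)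
    (fun n => ?_) (integrable_const _) (fun n => Eventually.of_forall fun ξ => ?_)
    (Eventually.of_forall fun ξ => ?_)
  · exact (((continuous_waveIntegral Real.continuous_cos hcos _).pow 2).add
      ((continuous_waveIntegral Real.continuous_sin hsin _).pow 2)).aestronglyMeasurable
  · rw [Real.norm_of_nonneg (by unfold powerSpectrum; positivity)]
    exact add_le_add (hwave _ Real.continuous_cos hcos n ξ) (hwave _ Real.continuous_sin hsin n ξ)
  · exact ((hlim _ Real.continuous_cos hcos ξ).pow 2).add
      ((hlim _ Real.continuous_sin hsin ξ).pow 2)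

section FourierTestFunction

open scoped FourierTransform SchwartzMap LineDeriv

/-- The complexification of a test function, as a Schwartz function. -/
def schwartzOfTest {φ : EuclideanSpace ℝ (Fin N) → ℝ} (h : IsTestFunction Ω φ) :
    𝓢(EuclideanSpace ℝ (Fin N), ℂ) :=
  (h.2.1.comp_left (g := ((↑) : ℝ → ℂ)) Complex.ofReal_zero).toSchwartzMap
    (Complex.ofRealCLM.contDiff.comp h.1)

theorem schwartzOfTest_apply {φ : EuclideanSpace ℝ (Fin N) → ℝ} (h : IsTestFunction Ω φ)
    (x : EuclideanSpace ℝ (Fin N)) : schwartzOfTest h x = φ x := rfl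

theorem norm_sq_fourier_schwartzOfTest {φ : EuclideanSpace ℝ (Fin N) → ℝ}
    (h : IsTestFunction Ω φ) (ξ : EuclideanSpace ℝ (Fin N)) :
    ‖𝓕 (schwartzOfTest h) ξ‖ ^ 2 = powerSpectrum (fn (testElem h)) ξ := by
  have hwave : ∀ g : ℝ → ℝ, waveIntegral g (fn (testElem h)) ξ
      = ∫ x, g (2 * Real.pi * inner ℝ x ξ) * φ x := fun g => by
    rw [← setIntegral_eq_integral_of_forall_compl_eq_zero (s := Ω)]
    · refine integral_congr_ae ?_
      filter_upwards [fn_testElem h] with x hx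
      rw [hx]
    · intro x hx
      rw [Function.notMem_support.1 fun hs => hx (h.support_subset hs), mul_zero]
  have hint : Integrable fun x => Complex.exp (↑(-2 * Real.pi * inner ℝ x ξ) * Complex.I) •
      schwartzOfTest h x := by
    have hc : Continuous fun x : EuclideanSpace ℝ (Fin N) =>
        Complex.exp (↑(-2 * Real.pi * inner ℝ x ξ) * Complex.I) := by fun_prop
    exact (schwartzOfTest h).integrable.bdd_smul 1 hc.aestronglyMeasurable
      (Eventually.of_forall fun x => by rw [Complex.norm_exp_ofReal_mul_I])
  have e : 𝓕 (schwartzOfTest h) ξ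
      = ∫ x, Complex.exp (↑(-2 * Real.pi * inner ℝ x ξ) * Complex.I) • schwartzOfTest h x := by
    rw [SchwartzMap.fourier_coe, Real.fourier_eq']
  have hre : (𝓕 (schwartzOfTest h) ξ).re = waveIntegral Real.cos (fn (testElem h)) ξ := by
    rw [e, hwave]
    refine (Complex.reCLM.integral_comp_comm hint).symm.trans (integral_congr_ae ?_)
    refine Eventually.of_forall fun x => ?_
    simp [schwartzOfTest_apply, Complex.exp_ofReal_mul_I_re, -Complex.ofReal_mul,
      -Complex.ofReal_neg]
  have him : (𝓕 (schwartzOfTest h) ξ).im = -waveIntegral Real.sin (fn (testElem h)) ξ := by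
    rw [e, hwave, ← integral_neg]
    refine (Complex.imCLM.integral_comp_comm hint).symm.trans (integral_congr_ae ?_)
    refine Eventually.of_forall fun x => ?_
    simp [schwartzOfTest_apply, Complex.exp_ofReal_mul_I_im, -Complex.ofReal_mul,
      -Complex.ofReal_neg]
  rw [← Complex.normSq_eq_norm_sq, Complex.normSq_apply, hre, him, powerSpectrum]
  ring

/-- Each ∂_j becomes multiplication by 2πi ξ_j; apply Plancherel to every partial derivative and sum
over j. -/
theorem integral_sq_mul_norm_fourier {φ : EuclideanSpace ℝ (Fin N) → ℝ}
    (h : IsTestFunction Ω φ) :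
    Integrable (fun ξ : EuclideanSpace ℝ (Fin N) => ‖ξ‖ ^ 2 * ‖𝓕 (schwartzOfTest h) ξ‖ ^ 2) ∧
    ∫ ξ : EuclideanSpace ℝ (Fin N), ‖ξ‖ ^ 2 * ‖𝓕 (schwartzOfTest h) ξ‖ ^ 2
      ≤ ∫ x, ‖gradient φ x‖ ^ 2 := by
  let e : Fin N → EuclideanSpace ℝ (Fin N) := fun j => EuclideanSpace.single j 1
  have hL2 : ∀ f : 𝓢(EuclideanSpace ℝ (Fin N), ℂ), Integrable fun x => ‖f x‖ ^ 2 := fun f =>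
    (f.memLp 2 volume).integrable_norm_pow (by norm_num)
  have hpt : ∀ j ξ, ‖𝓕 (∂_{e j} (schwartzOfTest h)) ξ‖ ^ 2
      = (2 * Real.pi) ^ 2 * (ξ j ^ 2 * ‖𝓕 (schwartzOfTest h) ξ‖ ^ 2) := fun j ξ => by
    have hg : (fun x : EuclideanSpace ℝ (Fin N) => inner ℝ x (e j)).HasTemperateGrowth :=
      ((innerSL ℝ).flip (e j)).hasTemperateGrowth
    rw [SchwartzMap.fourier_lineDerivOp_eq, smul_apply,
      SchwartzMap.smulLeftCLM_apply_apply hg]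
    have : inner ℝ ξ (e j) = ξ j := by simp [e, EuclideanSpace.inner_single_right]
    rw [this, norm_smul, norm_smul]
    simp only [norm_mul, Complex.norm_real, Complex.norm_I, Complex.norm_ofNat, mul_one,
      Real.norm_eq_abs, mul_pow, sq_abs]
    try ring
  have hpl : ∀ j, ∫ ξ, ‖𝓕 (∂_{e j} (schwartzOfTest h)) ξ‖ ^ 2
      = ∫ x, (gradient φ x j) ^ 2 := fun j => by
    rw [SchwartzMap.integral_norm_sq_fourier]
    refine integral_congr_ae (Eventually.of_forall fun x => ?_)
    have hd : fderiv ℝ (schwartzOfTest h) x (e j) = (fderiv ℝ φ x (e j) : ℂ) := by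
      have : HasFDerivAt (schwartzOfTest h) (Complex.ofRealCLM.comp (fderiv ℝ φ x)) x :=
        Complex.ofRealCLM.hasFDerivAt.comp x (h.1.differentiable (by simp) x).hasFDerivAt
      rw [this.fderiv]; rfl
    have hgj : gradient φ x j = fderiv ℝ φ x (e j) := by
      rw [← InnerProductSpace.toDual_symm_apply (𝕜 := ℝ) (x := e j) (y := fderiv ℝ φ x)]
      simp only [e, gradient, EuclideanSpace.inner_single_right]
      simp
    simp only [SchwartzMap.lineDerivOp_apply_eq_fderiv, hd, Complex.norm_real, Real.norm_eq_abs,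
      sq_abs, hgj]
  have hint : ∀ j, Integrable fun ξ : EuclideanSpace ℝ (Fin N) =>
      ξ j ^ 2 * ‖𝓕 (schwartzOfTest h) ξ‖ ^ 2 := fun j => by
    have := (hL2 (𝓕 (∂_{e j} (schwartzOfTest h)))).const_mul ((2 * Real.pi) ^ 2)⁻¹
    refine this.congr (Eventually.of_forall fun ξ => ?_)
    simp only [hpt]
    field_simp
  have hsum : ∀ ξ : EuclideanSpace ℝ (Fin N), ‖ξ‖ ^ 2 * ‖𝓕 (schwartzOfTest h) ξ‖ ^ 2
      = ∑ j, ξ j ^ 2 * ‖𝓕 (schwartzOfTest h) ξ‖ ^ 2 := fun ξ => by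
    rw [EuclideanSpace.norm_sq_eq, Finset.sum_mul]
    simp
  simp only [hsum]
  refine ⟨integrable_finsetSum _ fun j _ => hint j, ?_⟩
  rw [integral_finsetSum _ fun j _ => hint j]
  have hgi : ∀ j, Integrable fun x => (gradient φ x j) ^ 2 := fun j => by
    have hc : Continuous fun x => (gradient φ x j) ^ 2 :=
      (((EuclideanSpace.proj j : EuclideanSpace ℝ (Fin N) →L[ℝ] ℝ).continuous).comp
        (continuous_gradient h.1)).pow 2
    refine hc.integrable_of_hasCompactSupport ?_
    exact (hasCompactSupport_gradient h.2.1).comp_left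
      (g := fun v : EuclideanSpace ℝ (Fin N) => v j ^ 2) (by simp)
  have hrhs : ∫ x, ‖gradient φ x‖ ^ 2 = ∑ j, ∫ x, (gradient φ x j) ^ 2 := by
    rw [← integral_finsetSum _ fun j _ => hgi j]
    refine integral_congr_ae (Eventually.of_forall fun x => ?_)
    simp [EuclideanSpace.norm_sq_eq]
  rw [hrhs]
  refine Finset.sum_le_sum fun j _ => ?_
  rw [← hpl j]
  simp only [hpt]
  rw [integral_const_mul]
  have h0 : 0 ≤ ∫ ξ : EuclideanSpace ℝ (Fin N), ξ j ^ 2 * ‖𝓕 (schwartzOfTest h) ξ‖ ^ 2 :=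
    integral_nonneg fun ξ => by positivity
  -- Only an inequality is needed, so the factor (2π)² is thrown away.
  have h1 : (1 : ℝ) ≤ (2 * Real.pi) ^ 2 := by nlinarith [Real.pi_gt_three]
  exact le_mul_of_one_le_left h0 h1

end FourierTestFunction

theorem norm_sq_fn_testElem {φ : EuclideanSpace ℝ (Fin N) → ℝ} (h : IsTestFunction Ω φ) :
    ‖fn (testElem h)‖ ^ 2 = ∫ x, φ x ^ 2 := by
  rw [← real_inner_self_eq_norm_sq, L2.inner_def,
    ← setIntegral_eq_integral_of_forall_compl_eq_zero (s := Ω) (f := fun x => φ x ^ 2)]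
  · refine integral_congr_ae ?_
    filter_upwards [fn_testElem h] with x hx
    simp [hx]
  · intro x hx
    rw [Function.notMem_support.1 fun hs => hx (h.support_subset hs)]; simp

theorem norm_sq_grad_testElem {φ : EuclideanSpace ℝ (Fin N) → ℝ} (h : IsTestFunction Ω φ) :
    ‖grad (testElem h)‖ ^ 2 = ∫ x, ‖gradient φ x‖ ^ 2 := by
  rw [← real_inner_self_eq_norm_sq, L2.inner_def,
    ← setIntegral_eq_integral_of_forall_compl_eq_zero (s := Ω) (f := fun x => ‖gradient φ x‖ ^ 2)]
  · refine integral_congr_ae ?_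
    filter_upwards [grad_testElem h] with x hx
    simp [hx]
  · intro x hx
    rw [norm_gradient, Function.notMem_support.1 fun hs => hx (h.support_fderiv_subset hs)]; simp

open scoped FourierTransform in
-- Plancherel, with frequency space cut at |ξ| = R. Outside the ball 1 ≤ |ξ|²/R², which brings in
-- the gradient.
theorem norm_sq_testElem_le {φ : EuclideanSpace ℝ (Fin N) → ℝ} (h : IsTestFunction Ω φ) {R : ℝ}
    (hR : 0 < R) : ‖fn (testElem h)‖ ^ 2
      ≤ (∫ ξ in Metric.closedBall 0 R, powerSpectrum (fn (testElem h)) ξ)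
        + (R ^ 2)⁻¹ * ‖grad (testElem h)‖ ^ 2 := by
  obtain ⟨hi, hle⟩ := integral_sq_mul_norm_fourier h
  have hI : Integrable fun ξ => ‖𝓕 (schwartzOfTest h) ξ‖ ^ 2 :=
    ((𝓕 (schwartzOfTest h)).memLp 2 volume).integrable_norm_pow (by norm_num)
  have e1 : ‖fn (testElem h)‖ ^ 2 = ∫ ξ, ‖𝓕 (schwartzOfTest h) ξ‖ ^ 2 := by
    rw [SchwartzMap.integral_norm_sq_fourier, norm_sq_fn_testElem]
    simp [schwartzOfTest_apply]
  rw [e1, norm_sq_grad_testElem,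
    ← integral_add_compl (Metric.isClosed_closedBall (x := 0) (ε := R)).measurableSet hI]
  simp only [norm_sq_fourier_schwartzOfTest] at hI hi hle ⊢
  refine add_le_add le_rfl ?_
  have hnn : ∀ ξ, 0 ≤ powerSpectrum (fn (testElem h)) ξ := fun ξ => by
    unfold powerSpectrum; positivity
  calc _ ≤ ∫ ξ in (Metric.closedBall 0 R)ᶜ,
        (R ^ 2)⁻¹ * (‖ξ‖ ^ 2 * powerSpectrum (fn (testElem h)) ξ) := by
        refine setIntegral_mono_on hI.integrableOn (hi.const_mul _).integrableOn
          Metric.isClosed_closedBall.measurableSet.compl fun ξ hξ => ?_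
        have hξ' : R < ‖ξ‖ := by simpa using hξ
        rw [← mul_assoc]
        refine le_mul_of_one_le_left (hnn ξ) ?_
        rw [inv_mul_eq_div, one_le_div (by positivity)]
        exact pow_le_pow_left₀ hR.le hξ'.le 2
    _ ≤ ∫ ξ, (R ^ 2)⁻¹ * (‖ξ‖ ^ 2 * powerSpectrum (fn (testElem h)) ξ) :=
        setIntegral_le_integral (hi.const_mul _) (Eventually.of_forall fun ξ => by
          have := hnn ξ; positivity)
    _ ≤ _ := by
        rw [integral_const_mul]
        exact mul_le_mul_of_nonneg_left hle (by positivity)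

theorem norm_sq_fn_le [IsFiniteMeasure (volume.restrict Ω)] (u : H01 Ω) {R : ℝ} (hR : 0 < R) :
    ‖fn u‖ ^ 2 ≤ (∫ ξ in Metric.closedBall 0 R, powerSpectrum (fn u) ξ)
        + (R ^ 2)⁻¹ * ‖grad u‖ ^ 2 := by
  obtain ⟨φ, h, hlim⟩ := exists_seq_testElem u
  have hfn : Tendsto (fun n => fn (testElem (h n))) atTop (𝓝 (fn u)) :=
    ((fnL Ω).continuous.tendsto u).comp hlim
  have hgr : Tendsto (fun n => grad (testElem (h n))) atTop (𝓝 (grad u)) :=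
    ((gradL Ω).continuous.tendsto u).comp hlim
  obtain ⟨C, hC⟩ := hfn.norm.bddAbove_range
  have hps := tendsto_integral_powerSpectrum (f := fun n => fn (testElem (h n)))
    (fun n => hC (mem_range_self n)) (fun v => tendsto_const_nhds.inner hfn)
    (B := Metric.closedBall 0 R) measure_closedBall_lt_top
  exact le_of_tendsto_of_tendsto' (hfn.norm.pow 2) (hps.add ((hgr.norm.pow 2).const_mul _))
    fun n => norm_sq_testElem_le (h n) hR

/-- Rellich's theorem: weak convergence in `H₀¹(Ω)` implies strong convergence in `L²(Ω)`. -/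
theorem tendsto_fn_of_weak [IsFiniteMeasure (volume.restrict Ω)] {u : ℕ → H01 Ω} {w : H01 Ω}
    {C : ℝ} (hC : ∀ n, ‖u n‖ ≤ C)
    (hw : ∀ v, Tendsto (fun n => inner ℝ (u n) v) atTop (𝓝 (inner ℝ w v))) :
    Tendsto (fun n => fn (u n)) atTop (𝓝 (fn w)) := by
  set z : ℕ → H01 Ω := fun n => u n - w with hz
  have hzC : ∀ n, ‖z n‖ ≤ C + ‖w‖ := fun n =>
    (norm_sub_le _ _).trans (add_le_add (hC n) le_rfl)
  have hfz : ∀ n, ‖fn (z n)‖ ≤ C + ‖w‖ := fun n => by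
    refine le_trans ?_ (hzC n)
    refine le_of_sq_le_sq ?_ (norm_nonneg _)
    rw [norm_sq_H01]; nlinarith [sq_nonneg ‖grad (z n)‖]
  have hgz : ∀ n, ‖grad (z n)‖ ^ 2 ≤ (C + ‖w‖) ^ 2 := fun n => by
    refine le_trans ?_ (pow_le_pow_left₀ (norm_nonneg _) (hzC n) 2)
    rw [norm_sq_H01]; nlinarith [sq_nonneg ‖fn (z n)‖]
  have hweak : ∀ v : Lp ℝ 2 (volume.restrict Ω),
      Tendsto (fun n => inner ℝ v (fn (z n))) atTop (𝓝 (inner ℝ v (0 : Lp ℝ 2 _))) := fun v => by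
    have h1 : ∀ x : H01 Ω, inner ℝ v (fn x) = inner ℝ x ((fnL Ω).adjoint v) := fun x => by
      rw [ContinuousLinearMap.adjoint_inner_right, real_inner_comm]; rfl
    simp only [h1, hz, inner_sub_left, inner_zero_right]
    have := (hw ((fnL Ω).adjoint v)).sub_const (inner ℝ w ((fnL Ω).adjoint v))
    simpa using this
  have key : Tendsto (fun n => ‖fn (z n)‖ ^ 2) atTop (𝓝 0) := by
    rw [Metric.tendsto_atTop]
    intro ε hε
    -- This radius keeps the high frequencies below ε/2 uniformly in n; the summand 1 makes R
    -- positive and the inequality strict. The low frequencies then tend to 0 by weak convergence.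
    set R : ℝ := Real.sqrt (2 * ((C + ‖w‖) ^ 2 + 1) / ε) with hRdef
    have hRpos : 0 < R := Real.sqrt_pos.2 (by positivity)
    have hR2 : (R ^ 2)⁻¹ * (C + ‖w‖) ^ 2 < ε / 2 := by
      rw [hRdef, Real.sq_sqrt (by positivity), inv_div, div_mul_eq_mul_div,
        div_lt_div_iff₀ (by positivity) (by norm_num)]
      nlinarith
    have hps := tendsto_integral_powerSpectrum hfz hweak
      (B := Metric.closedBall (0 : EuclideanSpace ℝ (Fin N)) R) measure_closedBall_lt_top
    have hps0 : ∫ ξ in Metric.closedBall (0 : EuclideanSpace ℝ (Fin N)) R,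
        powerSpectrum (0 : Lp ℝ 2 (volume.restrict Ω)) ξ = 0 := by
      have : ∀ (g : ℝ → ℝ) (ξ : EuclideanSpace ℝ (Fin N)),
          waveIntegral g (0 : Lp ℝ 2 (volume.restrict Ω)) ξ = 0 := fun g ξ => by
        rw [waveIntegral]
        refine integral_eq_zero_of_ae ?_
        filter_upwards [Lp.coeFn_zero ℝ 2 (volume.restrict Ω)] with x hx
        rw [hx]; simp
      simp [powerSpectrum, this]
    rw [hps0] at hps
    obtain ⟨n₀, hn₀⟩ := eventually_atTop.1 (hps.eventually_lt_const (half_pos hε))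
    refine ⟨n₀, fun n hn => ?_⟩
    rw [Real.dist_eq, sub_zero, abs_of_nonneg (sq_nonneg _)]
    have h1 := norm_sq_fn_le (z n) hRpos
    have h2 := mul_le_mul_of_nonneg_left (hgz n) (inv_nonneg.2 (sq_nonneg R))
    have := hn₀ n hn
    linarith
  have hnorm : Tendsto (fun n => ‖fn (z n)‖) atTop (𝓝 0) := by
    have := key.sqrt
    simpa [Real.sqrt_sq (norm_nonneg _)] using this
  have hsub : ∀ n, fn (z n) = fn (u n) - fn w := fun n => map_sub (fnL Ω) _ _
  simp only [hsub] at hnorm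
  exact tendsto_iff_norm_sub_tendsto_zero.2 hnorm

end Rellich

/-! ### Compact embedding in L⁴ -/

section Embedding

open Filter Topology

variable {N : ℕ} {Ω : Set (EuclideanSpace ℝ (Fin N))}

instance fact_one_le_four : Fact ((1 : ℝ≥0∞) ≤ 4) := ⟨by norm_num⟩

/-- The compact embedding `H₀¹(Ω) → L⁴(Ω)`. -/
structure L4Embedding (Ω : Set (EuclideanSpace ℝ (Fin N))) where
  /-- the underlying continuous linear map -/
  T : H01 Ω →L[ℝ] Lp ℝ 4 (volume.restrict Ω)
  coe_T : ∀ u, T u =ᵐ[volume.restrict Ω] fn u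
  exists_bound : ∃ C : ℝ, 0 < C ∧ ∀ u, ‖T u‖ ≤ C * ‖grad u‖
  tendsto_of_weak : ∀ {u : ℕ → H01 Ω} {w : H01 Ω} {C : ℝ}, (∀ n, ‖u n‖ ≤ C) →
    (∀ v, Tendsto (fun n => inner ℝ (u n) v) atTop (𝓝 (inner ℝ w v))) →
    Tendsto (fun n => T (u n)) atTop (𝓝 (T w))

theorem norm_grad_le (u : H01 Ω) : ‖grad u‖ ≤ ‖u‖ := by
  refine le_of_sq_le_sq ?_ (norm_nonneg _)
  rw [norm_sq_H01 u]; nlinarith [sq_nonneg ‖fn u‖]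

/-- Interpolation: `|f|₄⁴ ≤ |f|₂ |f|₆³`. -/
theorem eLpNorm_four_pow_le {α : Type*} [MeasurableSpace α] {μ : Measure α} {f : α → ℝ}
    (hf : AEStronglyMeasurable f μ) :
    eLpNorm f 4 μ ^ 4 ≤ eLpNorm f 2 μ * eLpNorm f 6 μ ^ 3 := by
  have h4 : eLpNorm f 4 μ ^ 4 = ∫⁻ x, ‖f x‖ₑ ^ 4 ∂μ := by
    have := eLpNorm_nnreal_pow_eq_lintegral (f := f) (μ := μ) (p := 4) (by norm_num)
    simpa using this
  have h2 : eLpNorm f 2 μ = (∫⁻ x, ‖f x‖ₑ ^ (2 : ℝ) ∂μ) ^ (1 / (2 : ℝ)) := by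
    have := eLpNorm_nnreal_eq_lintegral (f := f) (μ := μ) (p := 2) (by norm_num)
    simpa using this
  have h6 : eLpNorm f 6 μ ^ 3 = (∫⁻ x, (‖f x‖ₑ ^ 3) ^ (2 : ℝ) ∂μ) ^ (1 / (2 : ℝ)) := by
    have := eLpNorm_nnreal_eq_lintegral (f := f) (μ := μ) (p := 6) (by norm_num)
    have e : eLpNorm f 6 μ = (∫⁻ x, ‖f x‖ₑ ^ (6 : ℝ) ∂μ) ^ (1 / (6 : ℝ)) := by simpa using this
    rw [e, ← ENNReal.rpow_natCast, ← ENNReal.rpow_mul]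
    congr 1
    · refine lintegral_congr fun x => ?_
      rw [← ENNReal.rpow_natCast, ← ENNReal.rpow_mul]; norm_num
    · norm_num
  rw [h4, h2, h6]
  -- Cauchy–Schwarz for |f|⁴ = |f| · |f|³.
  have := ENNReal.lintegral_mul_le_Lp_mul_Lq μ (p := 2) (q := 2)
    (by rw [Real.holderConjugate_iff]; norm_num) hf.enorm (hf.enorm.pow_const 3)
  refine le_trans (le_of_eq (lintegral_congr fun x => ?_)) this
  simp only [Pi.mul_apply]; ring

theorem tendsto_zero_of_pow_four {r : ℕ → ℝ} (h : Tendsto (fun n => r n ^ 4) atTop (𝓝 0))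
    (h0 : ∀ n, 0 ≤ r n) : Tendsto r atTop (𝓝 0) := by
  have h2 := h.sqrt.sqrt
  simp only [Real.sqrt_zero] at h2
  refine h2.congr fun n => ?_
  rw [show r n ^ 4 = (r n ^ 2) ^ 2 by ring, Real.sqrt_sq (by positivity), Real.sqrt_sq (h0 n)]

theorem exists_L4Embedding (hN1 : 1 ≤ N) (hN3 : N ≤ 3) (hΩb : Bornology.IsBounded Ω) :
    Nonempty (L4Embedding Ω) := by
  have : IsFiniteMeasure (volume.restrict Ω) := ⟨by simpa using hΩb.measure_lt_top⟩
  obtain ⟨C, hC⟩ := sobolev_H01 (Ω := Ω) hN1 hN3 hΩb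
  have hfin : volume Ω ^ (1 / (4 : ℝ≥0∞).toReal - 1 / (6 : ℝ≥0∞).toReal) ≠ ⊤ :=
    ENNReal.rpow_ne_top_of_nonneg (by norm_num) hΩb.measure_lt_top.ne
  set D : NNReal := C * (volume Ω ^ (1 / (4 : ℝ≥0∞).toReal - 1 / (6 : ℝ≥0∞).toReal)).toNNReal
    with hD
  have h6 : ∀ u : H01 Ω, MemLp (fn u) 6 (volume.restrict Ω) := fun u =>
    ⟨Lp.aestronglyMeasurable _, (hC u).trans_lt (ENNReal.mul_lt_top (by simp) (by simp))⟩
  have h4 : ∀ u : H01 Ω, MemLp (fn u) 4 (volume.restrict Ω) := fun u =>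
    (h6 u).mono_exponent (by norm_num)
  have hb4 : ∀ u : H01 Ω, eLpNorm (fn u) 4 (volume.restrict Ω) ≤ D * ‖grad u‖ₑ := fun u => by
    have := eLpNorm_le_eLpNorm_mul_rpow_measure_univ (μ := volume.restrict Ω)
      (p := 4) (q := 6) (by norm_num) (h6 u).1
    rw [Measure.restrict_apply_univ] at this
    rw [hD, ENNReal.coe_mul, ENNReal.coe_toNNReal hfin]
    calc _ ≤ _ := this
      _ ≤ (C * ‖grad u‖ₑ) * volume Ω ^ (1 / (4 : ℝ≥0∞).toReal - 1 / (6 : ℝ≥0∞).toReal) := by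
        gcongr; exact hC u
      _ = _ := by ring
  have hnorm : ∀ u : H01 Ω, ‖(h4 u).toLp (fn u)‖ ≤ D * ‖grad u‖ := fun u => by
    rw [Lp.norm_toLp]
    refine ENNReal.toReal_le_of_le_ofReal (by positivity) ((hb4 u).trans (le_of_eq ?_))
    rw [ENNReal.ofReal_mul NNReal.zero_le_coe, ENNReal.ofReal_coe_nnreal, ofReal_norm]
  let T₀ : H01 Ω →ₗ[ℝ] Lp ℝ 4 (volume.restrict Ω) :=
    { toFun := fun u => (h4 u).toLp (fn u)
      map_add' := fun u v => by
        rw [← MemLp.toLp_add]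
        refine (MemLp.toLp_eq_toLp_iff _ _).2 ?_
        rw [← fnL_apply, map_add]
        exact Lp.coeFn_add _ _
      map_smul' := fun c u => by
        rw [RingHom.id_apply, ← MemLp.toLp_const_smul]
        refine (MemLp.toLp_eq_toLp_iff _ _).2 ?_
        rw [← fnL_apply, map_smul]
        exact Lp.coeFn_smul _ _ }
  let T : H01 Ω →L[ℝ] Lp ℝ 4 (volume.restrict Ω) := T₀.mkContinuous D fun u =>
    (hnorm u).trans (mul_le_mul_of_nonneg_left (norm_grad_le u) NNReal.zero_le_coe)
  have hTn : ∀ u, ‖T u‖ₑ = eLpNorm (fn u) 4 (volume.restrict Ω) := fun u => by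
    rw [Lp.enorm_def]; exact eLpNorm_congr_ae (h4 u).coeFn_toLp
  -- Interpolation between L² and L⁶ carries Rellich's theorem from L² over to L⁴.
  have key : ∀ u : H01 Ω, ‖T u‖ ^ 4 ≤ ‖fn u‖ * (C * ‖u‖) ^ 3 := fun u => by
    have h := eLpNorm_four_pow_le (μ := volume.restrict Ω) (f := fn u) (Lp.aestronglyMeasurable _)
    rw [← hTn, ← Lp.enorm_def] at h
    have h' : ‖T u‖ₑ ^ 4 ≤ ‖fn u‖ₑ * (C * ‖u‖ₑ) ^ 3 := by
      refine h.trans ?_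
      have : ‖grad u‖ₑ ≤ ‖u‖ₑ := by
        rw [← ofReal_norm, ← ofReal_norm]; exact ENNReal.ofReal_le_ofReal (norm_grad_le u)
      gcongr
      exact (hC u).trans (by gcongr)
    have h'' := ENNReal.toReal_mono (ENNReal.mul_ne_top (by simp)
      (ENNReal.pow_ne_top (ENNReal.mul_ne_top (by simp) (by simp)))) h'
    simpa using h''
  refine ⟨⟨T, fun u => (h4 u).coeFn_toLp, ⟨D + 1, by positivity, fun u => ?_⟩, ?_⟩⟩
  · exact (hnorm u).trans (mul_le_mul_of_nonneg_right (by linarith) (norm_nonneg _))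
  · intro u w K hK hw
    have hL2 := tendsto_fn_of_weak hK hw
    refine tendsto_iff_norm_sub_tendsto_zero.2 ?_
    have h1 : Tendsto (fun n => ‖T (u n) - T w‖ ^ 4) atTop (𝓝 0) := by
      have h0 : Tendsto (fun n => ‖fn (u n) - fn w‖ * (C * (K + ‖w‖)) ^ 3) atTop (𝓝 0) := by
        simpa using (tendsto_iff_norm_sub_tendsto_zero.1 hL2).mul_const ((C * (K + ‖w‖)) ^ 3)
      refine squeeze_zero (fun n => by positivity) (fun n => ?_) h0
      have hk := key (u n - w)
      rw [map_sub] at hk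
      refine hk.trans ?_
      have e : fn (u n - w) = fn (u n) - fn w := map_sub (fnL Ω) _ _
      rw [e]
      have : ‖u n - w‖ ≤ K + ‖w‖ := (norm_sub_le _ _).trans (add_le_add (hK n) le_rfl)
      gcongr
    exact tendsto_zero_of_pow_four h1 fun n => norm_nonneg _

end Embedding

/-! ### Calculus of forms built from bilinear maps -/

section AbstractForms

open Filter Topology

variable {X Y A C : Type*} [NormedAddCommGroup X] [NormedSpace ℝ X] [NormedAddCommGroup Y]
  [NormedSpace ℝ Y] [NormedAddCommGroup A] [NormedSpace ℝ A] [NormedAddCommGroup C]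
  [NormedSpace ℝ C]

/-- The inner product of a real Hilbert space as a bilinear form. -/
def realInnerL (E : Type*) [NormedAddCommGroup E] [InnerProductSpace ℝ E] : E →L[ℝ] E →L[ℝ] ℝ :=
  innerSL ℝ

theorem hasDerivAt_line (u φ : X) : HasDerivAt (fun ε : ℝ => u + ε • φ) φ 0 := by
  simpa using ((hasDerivAt_id (0 : ℝ)).smul_const φ).const_add u

theorem hasDerivAt_bilin_line (B : X →L[ℝ] X →L[ℝ] ℝ) (u φ : X) :
    HasDerivAt (fun ε : ℝ => B (u + ε • φ) (u + ε • φ)) (B u φ + B φ u) 0 := by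
  have := B.hasDerivAt_of_bilinear (fun _ => hasDerivAt_line u φ) (fun _ => hasDerivAt_line u φ)
  simpa using this

theorem differentiable_bilin_self (B : X →L[ℝ] X →L[ℝ] ℝ) {f : Y → X} (hf : Differentiable ℝ f) :
    Differentiable ℝ fun y => B (f y) (f y) := by
  fun_prop

/-- The quartic terms have this shape, with B the product L⁴ × L⁴ → L² and W the pairing of L²
weighted by β. -/
theorem tendsto_sq_form (B : A →L[ℝ] A →L[ℝ] C) (W : C →L[ℝ] C →L[ℝ] ℝ) {p q : ℕ → A} {p₀ q₀ : A}
    (hp : Tendsto p atTop (𝓝 p₀)) (hq : Tendsto q atTop (𝓝 q₀)) :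
    Tendsto (fun n => W (B (p n) (p n)) (B (q n) (q n))) atTop (𝓝 (W (B p₀ p₀) (B q₀ q₀))) := by
  have hc : Continuous fun p : A × A => W (B p.1 p.1) (B p.2 p.2) := by fun_prop
  have h := Tendsto.comp (hc.tendsto (p₀, q₀)) (hp.prodMk_nhds hq)
  simpa only [Function.comp_def] using h

theorem differentiable_sq_form (B : A →L[ℝ] A →L[ℝ] C) (W : C →L[ℝ] C →L[ℝ] ℝ) (T : X →L[ℝ] A)
    {f g : Y → X} (hf : Differentiable ℝ f) (hg : Differentiable ℝ g) :
    Differentiable ℝ fun y => W (B (T (f y)) (T (f y))) (B (T (g y)) (T (g y))) := by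
  fun_prop

theorem hasDerivAt_sq_form (B : A →L[ℝ] A →L[ℝ] C) (W : C →L[ℝ] C →L[ℝ] ℝ) (T : X →L[ℝ] A)
    (hB : ∀ a b, B a b = B b a) (hW : ∀ a b, W a b = W b a) (u v φ ψ : X) :
    HasDerivAt (fun ε : ℝ => W (B (T (u + ε • φ)) (T (u + ε • φ)))
        (B (T (v + ε • ψ)) (T (v + ε • ψ))))
      (2 * W (B (T u) (T φ)) (B (T v) (T v)) + 2 * W (B (T v) (T ψ)) (B (T u) (T u))) 0 := by
  have hline : ∀ w η : X, HasDerivAt (fun ε : ℝ => T (w + ε • η)) (T η) 0 := fun w η =>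
    T.hasFDerivAt.comp_hasDerivAt 0 (hasDerivAt_line w η)
  have hsq : ∀ w η : X, HasDerivAt (fun ε : ℝ => B (T (w + ε • η)) (T (w + ε • η)))
      ((2 : ℝ) • B (T w) (T η)) 0 := fun w η => by
    have := B.hasDerivAt_of_bilinear (fun _ => hline w η) (fun _ => hline w η)
    refine this.congr_deriv ?_
    rw [zero_smul, add_zero, hB (T η), two_smul]
  refine (W.hasDerivAt_of_bilinear (fun _ => hsq u φ) (fun _ => hsq v ψ)).congr_deriv ?_
  simp only [zero_smul, add_zero, map_smul, smul_apply, smul_eq_mul]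
  rw [hW (B (T u) (T u))]
  ring

end AbstractForms

/-! ### Products and weighted pairings -/

section Forms

open Filter Topology

instance holderTriple_four_four_two : ENNReal.HolderTriple 4 4 2 where
  inv_add_inv_eq_inv := by
    rw [← two_mul, show (4 : ℝ≥0∞) = 2 * 2 by norm_num,
      ENNReal.mul_inv (by simp) (by simp), ← mul_assoc,
      ENNReal.mul_inv_cancel (by simp) (by simp), one_mul]

variable {N : ℕ} {Ω : Set (EuclideanSpace ℝ (Fin N))}

/-- The product `L⁴ × L⁴ → L²`. -/
def mulL (Ω : Set (EuclideanSpace ℝ (Fin N))) :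
    Lp ℝ 4 (volume.restrict Ω) →L[ℝ] Lp ℝ 4 (volume.restrict Ω) →L[ℝ]
      Lp ℝ 2 (volume.restrict Ω) :=
  (ContinuousLinearMap.mul ℝ ℝ).holderL (volume.restrict Ω) 4 4 2

theorem coeFn_mulL (f g : Lp ℝ 4 (volume.restrict Ω)) :
    mulL Ω f g =ᵐ[volume.restrict Ω] fun x => f x * g x :=
  (ContinuousLinearMap.mul ℝ ℝ).coeFn_holder f g

theorem norm_mulL_le (f g : Lp ℝ 4 (volume.restrict Ω)) : ‖mulL Ω f g‖ ≤ ‖f‖ * ‖g‖ := by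
  have := (ContinuousLinearMap.mul ℝ ℝ).norm_holder_apply_apply_le (r := 2) f g
  simpa [mulL] using this

theorem mulL_comm (f g : Lp ℝ 4 (volume.restrict Ω)) : mulL Ω f g = mulL Ω g f := by
  refine Lp.ext ?_
  filter_upwards [coeFn_mulL f g, coeFn_mulL g f] with x h1 h2
  rw [h1, h2, mul_comm]

variable {β : EuclideanSpace ℝ (Fin N) → ℝ}

/-- The bilinear form `(f, g) ↦ ∫_Ω β f g` on `L²(Ω)`. -/
def weighted (hβ : MemLp β ⊤ (volume.restrict Ω)) :
    Lp ℝ 2 (volume.restrict Ω) →L[ℝ] Lp ℝ 2 (volume.restrict Ω) →L[ℝ] ℝ :=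
  ((ContinuousLinearMap.mul ℝ ℝ).lpPairing (volume.restrict Ω) 2 2).comp
    ((ContinuousLinearMap.mul ℝ ℝ).holderL (volume.restrict Ω) ⊤ 2 2 (hβ.toLp β))

theorem weighted_apply (hβ : MemLp β ⊤ (volume.restrict Ω)) (f g : Lp ℝ 2 (volume.restrict Ω)) :
    weighted hβ f g = ∫ x in Ω, β x * f x * g x := by
  rw [weighted, ContinuousLinearMap.comp_apply, ContinuousLinearMap.lpPairing_eq_integral]
  refine integral_congr_ae ?_
  filter_upwards [(ContinuousLinearMap.mul ℝ ℝ).coeFn_holder (r := 2) (hβ.toLp β) f,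
    hβ.coeFn_toLp] with x h1 h2
  simp only [ContinuousLinearMap.holderL_apply_apply, h1, h2, ContinuousLinearMap.mul_apply']

theorem integrable_weighted (hβ : MemLp β ⊤ (volume.restrict Ω))
    (f g : Lp ℝ 2 (volume.restrict Ω)) :
    Integrable (fun x => β x * f x * g x) (volume.restrict Ω) := by
  have h := ((Lp.memLp f).integrable_mul (Lp.memLp g)).mul_of_top_right hβ
  refine h.congr (Eventually.of_forall fun x => ?_)
  simp only [Pi.mul_apply, mul_assoc]

theorem weighted_comm (hβ : MemLp β ⊤ (volume.restrict Ω)) (f g : Lp ℝ 2 (volume.restrict Ω)) :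
    weighted hβ f g = weighted hβ g f := by
  rw [weighted_apply, weighted_apply]
  exact integral_congr_ae (Eventually.of_forall fun x => by ring)

theorem weighted_le (hβ : MemLp β ⊤ (volume.restrict Ω)) {K : ℝ}
    (hK : 0 ≤ K) (hle : ∀ᵐ x ∂volume.restrict Ω, β x ≤ K) {f g : Lp ℝ 2 (volume.restrict Ω)}
    (hfg : ∀ᵐ x ∂volume.restrict Ω, 0 ≤ f x * g x) :
    weighted hβ f g ≤ K * (‖f‖ * ‖g‖) := by
  have h1 : weighted hβ f g ≤ ∫ x in Ω, K * (f x * g x) := by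
    rw [weighted_apply]
    refine integral_mono_ae (integrable_weighted hβ f g)
      (((Lp.memLp f).integrable_mul (Lp.memLp g)).const_mul K) ?_
    filter_upwards [hle, hfg] with x hx hx2
    rw [mul_assoc]
    exact mul_le_mul_of_nonneg_right hx hx2
  refine h1.trans ?_
  rw [integral_const_mul]
  refine mul_le_mul_of_nonneg_left ?_ hK
  have : ∫ x in Ω, f x * g x = inner ℝ f g := by
    rw [L2.inner_def]
    exact integral_congr_ae (Eventually.of_forall fun x => by simp [mul_comm])
  rw [this]
  exact real_inner_le_norm f g

end Forms

/-! ### Derivatives of the energy -/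

section Energy

open Filter Topology

variable {N : ℕ} {Ω : Set (EuclideanSpace ℝ (Fin N))}

/-- The scalar product `⟨u, v⟩_V` as a bilinear form on `H₀¹(Ω)`. -/
def innerVL {V : EuclideanSpace ℝ (Fin N) → ℝ} (hV : MemLp V ⊤ (volume.restrict Ω)) :
    H01 Ω →L[ℝ] H01 Ω →L[ℝ] ℝ :=
  (realInnerL _).bilinearComp (gradL Ω) (gradL Ω) + (weighted hV).bilinearComp (fnL Ω) (fnL Ω)

theorem innerVL_apply' {V : EuclideanSpace ℝ (Fin N) → ℝ} (hV : MemLp V ⊤ (volume.restrict Ω))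
    (u v : H01 Ω) :
    innerVL hV u v = inner ℝ (grad u) (grad v) + weighted hV (fn u) (fn v) := rfl

theorem innerVL_apply {V : EuclideanSpace ℝ (Fin N) → ℝ} (hV : MemLp V ⊤ (volume.restrict Ω))
    (u v : H01 Ω) : innerVL hV u v = innerV V u v := by
  rw [innerVL_apply', weighted_apply, L2.inner_def, innerV,
    integral_add (L2.integrable_inner _ _) (integrable_weighted hV _ _)]

theorem innerVL_comm {V : EuclideanSpace ℝ (Fin N) → ℝ} (hV : MemLp V ⊤ (volume.restrict Ω))
    (u v : H01 Ω) : innerVL hV u v = innerVL hV v u := by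
  rw [innerVL_apply', innerVL_apply', real_inner_comm, weighted_comm]

namespace L4Embedding

variable (E : L4Embedding Ω)

/-- The form `∫_Ω β u₁ u₂ u₃ u₄`. -/
def quad {β : EuclideanSpace ℝ (Fin N) → ℝ} (hβ : MemLp β ⊤ (volume.restrict Ω))
    (u₁ u₂ u₃ u₄ : H01 Ω) : ℝ :=
  weighted hβ (mulL Ω (E.T u₁) (E.T u₂)) (mulL Ω (E.T u₃) (E.T u₄))

variable {β : EuclideanSpace ℝ (Fin N) → ℝ} (hβ : MemLp β ⊤ (volume.restrict Ω))

theorem integrand_ae (β : EuclideanSpace ℝ (Fin N) → ℝ) (u₁ u₂ u₃ u₄ : H01 Ω) :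
    (fun x => β x * mulL Ω (E.T u₁) (E.T u₂) x * mulL Ω (E.T u₃) (E.T u₄) x)
      =ᵐ[volume.restrict Ω] fun x => β x * (fn u₁ x * fn u₂ x) * (fn u₃ x * fn u₄ x) := by
  filter_upwards [coeFn_mulL (E.T u₁) (E.T u₂), coeFn_mulL (E.T u₃) (E.T u₄), E.coe_T u₁,
    E.coe_T u₂, E.coe_T u₃, E.coe_T u₄] with x h1 h2 h3 h4 h5 h6
  rw [h1, h2, h3, h4, h5, h6]

include E hβ in
theorem integrable_quad (u₁ u₂ u₃ u₄ : H01 Ω) :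
    Integrable (fun x => β x * (fn u₁ x * fn u₂ x) * (fn u₃ x * fn u₄ x)) (volume.restrict Ω) :=
  (integrable_weighted hβ _ _).congr (E.integrand_ae β u₁ u₂ u₃ u₄)

theorem quad_eq_integral (u₁ u₂ u₃ u₄ : H01 Ω) :
    E.quad hβ u₁ u₂ u₃ u₄ = ∫ x in Ω, β x * (fn u₁ x * fn u₂ x) * (fn u₃ x * fn u₄ x) := by
  rw [quad, weighted_apply]
  exact integral_congr_ae (E.integrand_ae β u₁ u₂ u₃ u₄)

theorem quartic_eq (u v : H01 Ω) : quartic β u v = E.quad hβ u u v v := by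
  rw [quad_eq_integral, quartic]
  exact integral_congr_ae (Eventually.of_forall fun x => by ring)

include hβ in
theorem quartic_le {K : ℝ} (hK : 0 ≤ K) (hle : ∀ᵐ x ∂volume.restrict Ω, β x ≤ K) (u v : H01 Ω) :
    quartic β u v ≤ K * (‖E.T u‖ ^ 2 * ‖E.T v‖ ^ 2) := by
  rw [E.quartic_eq hβ, quad]
  refine (weighted_le hβ hK hle ?_).trans (mul_le_mul_of_nonneg_left ?_ hK)
  · filter_upwards [coeFn_mulL (E.T u) (E.T u), coeFn_mulL (E.T v) (E.T v)] with x h1 h2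
    rw [h1, h2]
    exact mul_nonneg (mul_self_nonneg _) (mul_self_nonneg _)
  · rw [sq, sq]
    exact mul_le_mul (norm_mulL_le _ _) (norm_mulL_le _ _) (norm_nonneg _) (by positivity)

include hβ in
theorem tendsto_quartic {u v : ℕ → H01 Ω} {u₀ v₀ : H01 Ω}
    (hu : Tendsto (fun n => E.T (u n)) atTop (𝓝 (E.T u₀)))
    (hv : Tendsto (fun n => E.T (v n)) atTop (𝓝 (E.T v₀))) :
    Tendsto (fun n => quartic β (u n) (v n)) atTop (𝓝 (quartic β u₀ v₀)) := by
  simp only [E.quartic_eq hβ, quad]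
  exact tendsto_sq_form (mulL Ω) (weighted hβ) hu hv

include E hβ in
theorem differentiable_quartic {Y : Type*} [NormedAddCommGroup Y] [NormedSpace ℝ Y]
    {f g : Y → H01 Ω} (hf : Differentiable ℝ f) (hg : Differentiable ℝ g) :
    Differentiable ℝ fun x => quartic β (f x) (g x) := by
  simp only [E.quartic_eq hβ, quad]
  exact differentiable_sq_form (mulL Ω) (weighted hβ) E.T hf hg

theorem hasDerivAt_quartic (u v φ ψ : H01 Ω) :
    HasDerivAt (fun ε : ℝ => quartic β (u + ε • φ) (v + ε • ψ))
      (2 * E.quad hβ u φ v v + 2 * E.quad hβ v ψ u u) 0 := by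
  simp only [E.quartic_eq hβ]
  exact hasDerivAt_sq_form (mulL Ω) (weighted hβ) E.T mulL_comm (weighted_comm hβ) u v φ ψ

end L4Embedding

theorem normSqV_eq {V : EuclideanSpace ℝ (Fin N) → ℝ} (hV : MemLp V ⊤ (volume.restrict Ω))
    (u : H01 Ω) : normSqV V u = innerVL hV u u := (innerVL_apply hV u u).symm

theorem hasDerivAt_normSqV {V : EuclideanSpace ℝ (Fin N) → ℝ}
    (hV : MemLp V ⊤ (volume.restrict Ω)) (u φ : H01 Ω) :
    HasDerivAt (fun ε : ℝ => normSqV V (u + ε • φ)) (2 * innerV V u φ) 0 := by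
  simp only [normSqV_eq hV, ← innerVL_apply hV]
  refine (hasDerivAt_bilin_line (innerVL hV) u φ).congr_deriv ?_
  rw [innerVL_comm hV φ]
  ring

variable {d : ℕ} {V : Fin d → EuclideanSpace ℝ (Fin N) → ℝ}
  {β : Fin d → Fin d → EuclideanSpace ℝ (Fin N) → ℝ}

theorem differentiable_energy_update (E : L4Embedding Ω)
    (hV : ∀ i, MemLp (V i) ⊤ (volume.restrict Ω))
    (hβ : ∀ i j, MemLp (β i j) ⊤ (volume.restrict Ω)) (u : Fin d → H01 Ω) (i : Fin d) :
    Differentiable ℝ fun w : H01 Ω => energy V β (Function.update u i w) := by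
  have hp : ∀ j, Differentiable ℝ fun w : H01 Ω => Function.update u i w j := fun j => by
    rcases eq_or_ne j i with rfl | hj
    · simp only [Function.update_self]; exact differentiable_id
    · simp only [Function.update_of_ne hj]; exact differentiable_const _
  have hn : ∀ j, Differentiable ℝ fun w : H01 Ω => normSqV (V j) (Function.update u i w j) :=
    fun j => by
      simp only [normSqV_eq (hV j)]
      exact differentiable_bilin_self _ (hp j)
  have hq : ∀ j k, Differentiable ℝ fun w : H01 Ω =>
      quartic (β j k) (Function.update u i w j) (Function.update u i w k) :=
    fun j k => E.differentiable_quartic (hβ j k) (hp j) (hp k)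
  exact Differentiable.sub (Differentiable.const_mul (Differentiable.fun_sum fun i _ => hn i) _)
    (Differentiable.const_mul (Differentiable.fun_sum fun i _ =>
      Differentiable.fun_sum fun j _ => hq i j) _)

/-- The derivative of the energy along a line. -/
theorem hasDerivAt_energy (E : L4Embedding Ω) (hV : ∀ i, MemLp (V i) ⊤ (volume.restrict Ω))
    (hβ : ∀ i j, MemLp (β i j) ⊤ (volume.restrict Ω))
    (hs : ∀ i j, β i j =ᵐ[volume.restrict Ω] β j i) (u φ : Fin d → H01 Ω) :
    HasDerivAt (fun ε : ℝ => energy V β (u + ε • φ))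
      (∑ i, (innerV (V i) (u i) (φ i) - ∑ j, E.quad (hβ i j) (u i) (φ i) (u j) (u j))) 0 := by
  have h1 : HasDerivAt (fun ε : ℝ => ∑ i, normSqV (V i) ((u + ε • φ) i))
      (∑ i, 2 * innerV (V i) (u i) (φ i)) 0 :=
    HasDerivAt.fun_sum fun i _ => hasDerivAt_normSqV (hV i) (u i) (φ i)
  have h2 : HasDerivAt
      (fun ε : ℝ => ∑ i, ∑ j, quartic (β i j) ((u + ε • φ) i) ((u + ε • φ) j))
      (∑ i, ∑ j, (2 * E.quad (hβ i j) (u i) (φ i) (u j) (u j)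
        + 2 * E.quad (hβ i j) (u j) (φ j) (u i) (u i))) 0 :=
    HasDerivAt.fun_sum fun i _ => HasDerivAt.fun_sum fun j _ =>
      E.hasDerivAt_quartic (hβ i j) (u i) (u j) (φ i) (φ j)
  have hsym : ∀ i j, E.quad (hβ i j) (u j) (φ j) (u i) (u i)
      = E.quad (hβ j i) (u j) (φ j) (u i) (u i) := fun i j => by
    rw [E.quad_eq_integral, E.quad_eq_integral]
    refine integral_congr_ae ?_
    filter_upwards [hs i j] with x hx
    rw [hx]
  refine ((h1.const_mul (1 / 2)).sub (h2.const_mul (1 / 4))).congr_deriv ?_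
  -- Symmetry of β makes the two halves of the derivative equal, which cancels the factor 1/4.
  have hsum : ∑ i, ∑ j, E.quad (hβ i j) (u j) (φ j) (u i) (u i)
      = ∑ i, ∑ j, E.quad (hβ i j) (u i) (φ i) (u j) (u j) := by
    rw [Finset.sum_comm]
    exact Finset.sum_congr rfl fun i _ => Finset.sum_congr rfl fun j _ => hsym j i
  simp only [Finset.sum_add_distrib, ← Finset.mul_sum, hsum, Finset.sum_sub_distrib]
  ring

theorem partialEnergy_eq (E : L4Embedding Ω) (hV : ∀ i, MemLp (V i) ⊤ (volume.restrict Ω))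
    (hβ : ∀ i j, MemLp (β i j) ⊤ (volume.restrict Ω))
    (hs : ∀ i j, β i j =ᵐ[volume.restrict Ω] β j i) (u : Fin d → H01 Ω) (i : Fin d) (φ : H01 Ω) :
    partialEnergy V β u i φ
      = innerV (V i) (u i) φ - ∑ j, E.quad (hβ i j) (u i) φ (u j) (u j) := by
  -- `fderiv` is 0 by convention where differentiability fails, so the slice must be shown
  -- differentiable before its `fderiv` can be identified with a derivative along a line.
  have hd := differentiable_energy_update E hV hβ u i (u i)
  have hline := hasDerivAt_line (u i) φ
  have h1 : HasDerivAt (fun ε : ℝ => energy V β (Function.update u i (u i + ε • φ)))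
      (partialEnergy V β u i φ) 0 := by
    have hd' : HasFDerivAt (fun w : H01 Ω => energy V β (Function.update u i w))
        (fderiv ℝ (fun w : H01 Ω => energy V β (Function.update u i w)) (u i))
        (u i + (0 : ℝ) • φ) := by simpa using hd.hasFDerivAt
    exact hd'.comp_hasDerivAt 0 hline
  have h2 := hasDerivAt_energy E hV hβ hs u (Pi.single i φ)
  have e : ∀ ε : ℝ, Function.update u i (u i + ε • φ) = u + ε • (Pi.single i φ : Fin d → H01 Ω) := fun ε => by
    funext j
    rcases eq_or_ne j i with rfl | hj
    · simp
    · simp [hj]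
  simp only [e] at h1
  rw [h1.unique h2, Finset.sum_eq_single i]
  · simp
  · intro j _ hj
    rw [Pi.single_eq_of_ne hj, ← innerVL_apply (hV j)]
    simp [L4Embedding.quad]
  · simp

end Energy

/-! ### Absolute values in H₀¹ -/

section AbsoluteValue

open Filter Topology

variable {N : ℕ} {Ω : Set (EuclideanSpace ℝ (Fin N))}

/-- A smooth approximation of `|t|` vanishing at `0`. -/
def smoothAbs (ε t : ℝ) : ℝ := Real.sqrt (t ^ 2 + ε ^ 2) - ε

theorem smoothAbs_zero {ε : ℝ} (hε : 0 < ε) : smoothAbs ε 0 = 0 := by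
  simp [smoothAbs, Real.sqrt_sq hε.le]

theorem contDiff_smoothAbs {ε : ℝ} (hε : 0 < ε) : ContDiff ℝ ∞ (smoothAbs ε) := by
  unfold smoothAbs
  refine ContDiff.sub (ContDiff.sqrt (by fun_prop) fun t => ?_) contDiff_const
  positivity

theorem hasDerivAt_smoothAbs {ε : ℝ} (hε : 0 < ε) (t : ℝ) :
    HasDerivAt (smoothAbs ε) (t / Real.sqrt (t ^ 2 + ε ^ 2)) t := by
  have h1 : HasDerivAt (fun t : ℝ => t ^ 2 + ε ^ 2) (2 * t) t := by
    simpa using (hasDerivAt_pow 2 t).add_const (ε ^ 2)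
  refine ((h1.sqrt (by positivity)).sub_const ε).congr_deriv ?_
  rw [mul_div_mul_left _ _ two_ne_zero]

theorem abs_deriv_smoothAbs_le {ε : ℝ} (hε : 0 < ε) (t : ℝ) :
    |t / Real.sqrt (t ^ 2 + ε ^ 2)| ≤ 1 := by
  have hpos : 0 < Real.sqrt (t ^ 2 + ε ^ 2) := Real.sqrt_pos.2 (by positivity)
  rw [abs_div, abs_of_pos hpos, div_le_one hpos]
  exact Real.abs_le_sqrt (by nlinarith [sq_nonneg ε])

theorem abs_smoothAbs_le {ε : ℝ} (hε : 0 < ε) (t : ℝ) : |smoothAbs ε t| ≤ |t| := by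
  have h1 : ε ≤ Real.sqrt (t ^ 2 + ε ^ 2) := Real.le_sqrt_of_sq_le (by nlinarith [sq_nonneg t])
  have h2 : Real.sqrt (t ^ 2 + ε ^ 2) ≤ |t| + ε := by
    rw [Real.sqrt_le_left (by positivity)]
    nlinarith [sq_abs t, abs_nonneg t]
  rw [smoothAbs, abs_of_nonneg (by linarith)]
  linarith

theorem tendsto_smoothAbs {ε t : ℕ → ℝ} {s : ℝ} (hε : Tendsto ε atTop (𝓝 0))
    (ht : Tendsto t atTop (𝓝 s)) : Tendsto (fun n => smoothAbs (ε n) (t n)) atTop (𝓝 |s|) := by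
  have h := (((ht.pow 2).add (hε.pow 2)).sqrt).sub hε
  simpa [smoothAbs, Real.sqrt_sq_eq_abs] using h

theorem IsTestFunction.smoothAbs {φ : EuclideanSpace ℝ (Fin N) → ℝ} (h : IsTestFunction Ω φ)
    {ε : ℝ} (hε : 0 < ε) : IsTestFunction Ω (NLSSystem.smoothAbs ε ∘ φ) :=
  ⟨(contDiff_smoothAbs hε).comp h.1, h.2.1.comp_left (smoothAbs_zero hε),
    (tsupport_comp_subset (smoothAbs_zero hε) φ).trans h.2.2⟩

theorem norm_gradient_smoothAbs_le {φ : EuclideanSpace ℝ (Fin N) → ℝ} (h : IsTestFunction Ω φ)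
    {ε : ℝ} (hε : 0 < ε) (x : EuclideanSpace ℝ (Fin N)) :
    ‖gradient (smoothAbs ε ∘ φ) x‖ ≤ ‖gradient φ x‖ := by
  have hd := (hasDerivAt_smoothAbs hε (φ x)).comp_hasFDerivAt x
    (h.1.differentiable (by simp) x).hasFDerivAt
  rw [norm_gradient, norm_gradient, hd.fderiv, norm_smul, Real.norm_eq_abs]
  exact mul_le_of_le_one_left (norm_nonneg _) (abs_deriv_smoothAbs_le hε _)

theorem tendsto_inner_grad_of_weak {u : ℕ → H01 Ω} {w : H01 Ω}
    (hw : ∀ v, Tendsto (fun n => inner ℝ (u n) v) atTop (𝓝 (inner ℝ w v)))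
    (η : Lp (EuclideanSpace ℝ (Fin N)) 2 (volume.restrict Ω)) :
    Tendsto (fun n => inner ℝ (grad (u n)) η) atTop (𝓝 (inner ℝ (grad w) η)) := by
  have h1 : ∀ x : H01 Ω, inner ℝ (grad x) η = inner ℝ x ((gradL Ω).adjoint η) := fun x => by
    rw [ContinuousLinearMap.adjoint_inner_right]; rfl
  simp only [h1]
  exact hw _

/-- `|u| ∈ H₀¹(Ω)` with `|∇|u||₂ ≤ |∇u|₂`. -/
theorem exists_abs [IsFiniteMeasure (volume.restrict Ω)] (u : H01 Ω) :
    ∃ w : H01 Ω, (∀ᵐ x ∂volume.restrict Ω, fn w x = |fn u x|) ∧ ‖grad w‖ ≤ ‖grad u‖ := by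
  obtain ⟨φ, h, hlim⟩ := exists_seq_testElem u
  have hε : ∀ n : ℕ, (0 : ℝ) < 1 / (n + 1) := fun n => Nat.one_div_pos_of_nat
  -- Smoothing |·| does not increase values or gradients, so these test functions stay bounded in
  -- H₀¹; a weak limit is the candidate for |u|.
  set v : ℕ → H01 Ω := fun n => testElem ((h n).smoothAbs (hε n)) with hv
  have hfn : Tendsto (fun n => fn (testElem (h n))) atTop (𝓝 (fn u)) :=
    ((fnL Ω).continuous.tendsto u).comp hlim
  have hgr : Tendsto (fun n => grad (testElem (h n))) atTop (𝓝 (grad u)) :=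
    ((gradL Ω).continuous.tendsto u).comp hlim
  have hvg : ∀ n, ‖grad (v n)‖ ≤ ‖grad (testElem (h n))‖ := fun n => by
    refine Lp.norm_le_norm_of_ae_le ?_
    filter_upwards [grad_testElem (h n), grad_testElem ((h n).smoothAbs (hε n))] with x h1 h2
    rw [h1, h2]
    exact norm_gradient_smoothAbs_le (h n) (hε n) x
  have hvf : ∀ n, ‖fn (v n)‖ ≤ ‖fn (testElem (h n))‖ := fun n => by
    refine Lp.norm_le_norm_of_ae_le ?_
    filter_upwards [fn_testElem (h n), fn_testElem ((h n).smoothAbs (hε n))] with x h1 h2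
    rw [h1, h2]
    exact abs_smoothAbs_le (hε n) _
  have hvn : ∀ n, ‖v n‖ ≤ ‖testElem (h n)‖ := fun n => by
    refine le_of_sq_le_sq ?_ (norm_nonneg _)
    rw [norm_sq_H01, norm_sq_H01]
    exact add_le_add (pow_le_pow_left₀ (norm_nonneg _) (hvf n) 2)
      (pow_le_pow_left₀ (norm_nonneg _) (hvg n) 2)
  obtain ⟨C, hC⟩ := hlim.norm.bddAbove_range
  obtain ⟨w, k, hk, hw⟩ := exists_subseq_tendsto_inner
    (fun n => (hvn n).trans (hC (mem_range_self n)))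
  have hwL2 := tendsto_fn_of_weak (u := fun n => v (k n))
    (fun n => (hvn (k n)).trans (hC (mem_range_self (k n)))) hw
  refine ⟨w, ?_, ?_⟩
  · obtain ⟨k₁, hk₁, hae₁⟩ := (tendstoInMeasure_of_tendsto_Lp hwL2).exists_seq_tendsto_ae
    have hfn₁ : Tendsto (fun n => fn (testElem (h (k (k₁ n))))) atTop (𝓝 (fn u)) :=
      hfn.comp (hk.comp hk₁).tendsto_atTop
    obtain ⟨k₂, hk₂, hae₂⟩ := (tendstoInMeasure_of_tendsto_Lp hfn₁).exists_seq_tendsto_ae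
    have hε' : Tendsto (fun n => (1 : ℝ) / ((k (k₁ (k₂ n)) : ℕ) + 1)) atTop (𝓝 0) :=
      tendsto_one_div_add_atTop_nhds_zero_nat.comp ((hk.comp hk₁).comp hk₂).tendsto_atTop
    have hall₁ : ∀ᵐ x ∂volume.restrict Ω, ∀ n, fn (testElem (h n)) x = φ n x :=
      ae_all_iff.2 fun n => fn_testElem (h n)
    have hall₂ : ∀ᵐ x ∂volume.restrict Ω, ∀ n, fn (v n) x = smoothAbs (1 / (n + 1)) (φ n x) :=
      ae_all_iff.2 fun n => fn_testElem ((h n).smoothAbs (hε n))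
    filter_upwards [hae₁, hae₂, hall₁, hall₂] with x h1 h2 h3 h4
    have l1 := h1.comp hk₂.tendsto_atTop
    simp only [Function.comp_def, h4] at l1
    simp only [h3] at h2
    exact tendsto_nhds_unique l1 (tendsto_smoothAbs hε' h2)
  -- Testing the weak convergence against ∇w itself yields |∇w|₂² ≤ |∇u|₂ |∇w|₂.
  · have l1 := tendsto_inner_grad_of_weak hw (grad w)
    have l2 : Tendsto (fun n => ‖grad (testElem (h (k n)))‖ * ‖grad w‖) atTop
        (𝓝 (‖grad u‖ * ‖grad w‖)) := ((hgr.comp hk.tendsto_atTop).norm).mul_const _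
    have hle := le_of_tendsto_of_tendsto' l1 l2 fun n =>
      (real_inner_le_norm _ _).trans (mul_le_mul_of_nonneg_right (hvg (k n)) (norm_nonneg _))
    rw [real_inner_self_eq_norm_mul_norm] at hle
    rcases (norm_nonneg (grad w)).eq_or_lt with h0 | h0
    · rw [← h0]; exact norm_nonneg _
    · exact le_of_mul_le_mul_right hle h0

theorem normSqV_eq_add {V : EuclideanSpace ℝ (Fin N) → ℝ} (hV : MemLp V ⊤ (volume.restrict Ω))
    (u : H01 Ω) : normSqV V u = ‖grad u‖ ^ 2 + ∫ x in Ω, V x * fn u x ^ 2 := by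
  rw [normSqV_eq hV, innerVL_apply', real_inner_self_eq_norm_sq, weighted_apply]
  congr 1
  exact integral_congr_ae (Eventually.of_forall fun x => by ring)

theorem normSqV_le_of_abs {V : EuclideanSpace ℝ (Fin N) → ℝ} (hV : MemLp V ⊤ (volume.restrict Ω))
    {u w : H01 Ω} (hf : ∀ᵐ x ∂volume.restrict Ω, fn w x = |fn u x|) (hg : ‖grad w‖ ≤ ‖grad u‖) :
    normSqV V w ≤ normSqV V u := by
  rw [normSqV_eq_add hV, normSqV_eq_add hV]
  refine add_le_add (pow_le_pow_left₀ (norm_nonneg _) hg 2) (le_of_eq (integral_congr_ae ?_))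
  filter_upwards [hf] with x hx
  rw [hx, sq_abs]

theorem quartic_congr_abs (β : EuclideanSpace ℝ (Fin N) → ℝ) {u u' w w' : H01 Ω}
    (h : ∀ᵐ x ∂volume.restrict Ω, fn w x = |fn u x|)
    (h' : ∀ᵐ x ∂volume.restrict Ω, fn w' x = |fn u' x|) :
    quartic β w w' = quartic β u u' := by
  refine integral_congr_ae ?_
  filter_upwards [h, h'] with x hx hx'
  rw [hx, hx', sq_abs, sq_abs]

end AbsoluteValue

/-! ### Weak lower semicontinuity of quadratic forms -/

section BilinearForms

open Filter Topology

theorem bilin_smul_self {X : Type*} [NormedAddCommGroup X] [NormedSpace ℝ X]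
    (B : X →L[ℝ] X →L[ℝ] ℝ) (c : ℝ) (u : X) : B (c • u) (c • u) = c ^ 2 * B u u := by
  rw [map_smul, map_smul, smul_apply, smul_eq_mul, smul_eq_mul]
  ring

/-- This is B(u - w, u - w) ≥ 0 expanded. The left side is affine in u, hence weakly continuous, and
it equals B w w at u = w. -/
theorem two_mul_bilin_sub_le {X : Type*} [NormedAddCommGroup X] [NormedSpace ℝ X]
    (B : X →L[ℝ] X →L[ℝ] ℝ) (hB : ∀ u v, B u v = B v u) (hnn : ∀ u, 0 ≤ B u u) (u w : X) :
    2 * B w u - B w w ≤ B u u := by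
  have h := hnn (u - w)
  simp only [map_sub, sub_apply] at h
  rw [hB u w] at h
  linarith

theorem tendsto_clm_of_weak {H : Type*} [NormedAddCommGroup H] [InnerProductSpace ℝ H]
    [CompleteSpace H] {u : ℕ → H} {w : H}
    (hw : ∀ v, Tendsto (fun n => inner ℝ (u n) v) atTop (𝓝 (inner ℝ w v))) (f : H →L[ℝ] ℝ) :
    Tendsto (fun n => f (u n)) atTop (𝓝 (f w)) := by
  have hf : ∀ v, f v = inner ℝ v ((InnerProductSpace.toDual ℝ H).symm f) := fun v => by
    rw [real_inner_comm, InnerProductSpace.toDual_symm_apply]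
  simp only [hf]
  exact hw _

theorem tendsto_two_mul_bilin_sub {H : Type*} [NormedAddCommGroup H] [InnerProductSpace ℝ H]
    [CompleteSpace H] {u : ℕ → H} {w : H}
    (hw : ∀ v, Tendsto (fun n => inner ℝ (u n) v) atTop (𝓝 (inner ℝ w v)))
    (B : H →L[ℝ] H →L[ℝ] ℝ) :
    Tendsto (fun n => 2 * B w (u n) - B w w) atTop (𝓝 (B w w)) := by
  have h := ((tendsto_clm_of_weak hw (B w)).const_mul 2).sub_const (B w w)
  rwa [show 2 * B w w - B w w = B w w by ring] at h

end BilinearForms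

/-! ### Coercivity and scaling -/

section Coercivity

open Filter Topology

variable {N : ℕ} {Ω : Set (EuclideanSpace ℝ (Fin N))}

theorem integral_sq_fn (u : H01 Ω) : ∫ x in Ω, fn u x ^ 2 = ‖fn u‖ ^ 2 := by
  rw [← real_inner_self_eq_norm_sq, L2.inner_def]
  exact integral_congr_ae (Eventually.of_forall fun x => by simp)

theorem integral_norm_sq_grad (u : H01 Ω) : ∫ x in Ω, ‖grad u x‖ ^ 2 = ‖grad u‖ ^ 2 := by
  rw [← real_inner_self_eq_norm_sq, L2.inner_def]
  exact integral_congr_ae (Eventually.of_forall fun x => by simp)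

theorem firstEigenvalue_mul_le (u : H01 Ω) : firstEigenvalue Ω * ‖fn u‖ ^ 2 ≤ ‖grad u‖ ^ 2 := by
  rcases eq_or_ne (fn u) 0 with h0 | h0
  · simp [h0]
  have hpos : 0 < ‖fn u‖ ^ 2 := pow_pos (norm_pos_iff.2 h0) 2
  rw [← le_div_iff₀ hpos]
  refine csInf_le ⟨0, ?_⟩ ⟨u, h0, by rw [integral_sq_fn, integral_norm_sq_grad]⟩
  rintro r ⟨u, -, rfl⟩
  exact div_nonneg (integral_nonneg fun x => by positivity) (integral_nonneg fun x => by positivity)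

/-- If l < 0, then `hl` forces λ₁ > 0, and the potential costs at most the fraction -l/λ₁ < 1 of the
gradient term. If l ≥ 0 the potential term is simply dropped, with no information on λ₁. -/
theorem exists_coercive_grad {V : EuclideanSpace ℝ (Fin N) → ℝ}
    (hV : MemLp V ⊤ (volume.restrict Ω)) {l : ℝ} (hl : -firstEigenvalue Ω < l)
    (hle : ∀ᵐ x ∂volume.restrict Ω, l ≤ V x) :
    ∃ α : ℝ, 0 < α ∧ ∀ u : H01 Ω, α * ‖grad u‖ ^ 2 ≤ normSqV V u := by
  have hlow : ∀ u : H01 Ω, ‖grad u‖ ^ 2 + l * ‖fn u‖ ^ 2 ≤ normSqV V u := fun u => by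
    rw [normSqV_eq_add hV, ← integral_sq_fn, ← integral_const_mul]
    refine add_le_add le_rfl (integral_mono_ae ?_ ?_ ?_)
    · refine Integrable.const_mul ?_ l
      refine ((Lp.memLp (fn u)).integrable_mul (Lp.memLp (fn u))).congr ?_
      exact Eventually.of_forall fun x => by simp [sq]
    · refine (integrable_weighted hV (fn u) (fn u)).congr ?_
      exact Eventually.of_forall fun x => by ring
    · filter_upwards [hle] with x hx
      exact mul_le_mul_of_nonneg_right hx (sq_nonneg _)
  rcases le_or_gt 0 l with h0 | h0
  · refine ⟨1, one_pos, fun u => le_trans ?_ (hlow u)⟩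
    have := mul_nonneg h0 (sq_nonneg ‖fn u‖)
    linarith
  · have hpos : 0 < firstEigenvalue Ω := by linarith
    refine ⟨1 + l / firstEigenvalue Ω, ?_, fun u => le_trans ?_ (hlow u)⟩
    · have : -1 < l / firstEigenvalue Ω := by rw [lt_div_iff₀ hpos]; linarith
      linarith
    · have h1 := firstEigenvalue_mul_le u
      have h2 : l / firstEigenvalue Ω * ‖grad u‖ ^ 2 ≤ l * ‖fn u‖ ^ 2 := by
        rw [div_mul_eq_mul_div, div_le_iff₀ hpos]
        nlinarith
      linarith

/-- Coercivity of `‖·‖_V` with respect to both the norms of `H₀¹(Ω)` and `L⁴(Ω)`. -/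
theorem exists_coercive [IsFiniteMeasure (volume.restrict Ω)] (E : L4Embedding Ω)
    {V : EuclideanSpace ℝ (Fin N) → ℝ} (hV : MemLp V ⊤ (volume.restrict Ω)) {l : ℝ}
    (hl : -firstEigenvalue Ω < l) (hle : ∀ᵐ x ∂volume.restrict Ω, l ≤ V x) :
    ∃ α : ℝ, 0 < α ∧ ∀ u : H01 Ω, α * ‖u‖ ^ 2 ≤ normSqV V u ∧ α * ‖E.T u‖ ^ 2 ≤ normSqV V u := by
  obtain ⟨α, hα, hc⟩ := exists_coercive_grad hV hl hle
  obtain ⟨C, hC, hT⟩ := E.exists_bound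
  set P : ℝ := ((volume.restrict Ω) univ ^ (1 / (2 : ℝ≥0∞).toReal - 1 / (4 : ℝ≥0∞).toReal)).toReal
    with hP
  have hfin : (volume.restrict Ω) univ ^ (1 / (2 : ℝ≥0∞).toReal - 1 / (4 : ℝ≥0∞).toReal) ≠ ⊤ :=
    ENNReal.rpow_ne_top_of_nonneg (by norm_num) (measure_ne_top _ _)
  -- Together with the bound of the L⁴ norm by the gradient this gives a Poincaré inequality,
  -- without appeal to λ₁ > 0.
  have hfT : ∀ u : H01 Ω, ‖fn u‖ ≤ ‖E.T u‖ * P := fun u => by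
    have h := eLpNorm_le_eLpNorm_mul_rpow_measure_univ (μ := volume.restrict Ω) (f := E.T u)
      (p := 2) (q := 4) (by norm_num) (Lp.aestronglyMeasurable _)
    have h' := ENNReal.toReal_mono (ENNReal.mul_ne_top (Lp.eLpNorm_ne_top _) hfin) h
    rw [eLpNorm_congr_ae (E.coe_T u), ENNReal.toReal_mul, ← Lp.norm_def, ← Lp.norm_def] at h'
    exact h'
  have hP0 : 0 ≤ P := ENNReal.toReal_nonneg
  have hden : 0 < 1 + C ^ 2 + C ^ 2 * P ^ 2 := by positivity
  refine ⟨α / (1 + C ^ 2 + C ^ 2 * P ^ 2), div_pos hα hden, fun u => ?_⟩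
  have hTu : ‖E.T u‖ ^ 2 ≤ C ^ 2 * ‖grad u‖ ^ 2 := by
    rw [← mul_pow]; exact pow_le_pow_left₀ (norm_nonneg _) (hT u) 2
  have hfu : ‖fn u‖ ^ 2 ≤ C ^ 2 * P ^ 2 * ‖grad u‖ ^ 2 := by
    calc ‖fn u‖ ^ 2 ≤ (‖E.T u‖ * P) ^ 2 := pow_le_pow_left₀ (norm_nonneg _) (hfT u) 2
      _ = ‖E.T u‖ ^ 2 * P ^ 2 := mul_pow _ _ _
      _ ≤ C ^ 2 * ‖grad u‖ ^ 2 * P ^ 2 := mul_le_mul_of_nonneg_right hTu (sq_nonneg _)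
      _ = _ := by ring
  have key : ∀ r : ℝ, r ≤ (1 + C ^ 2 + C ^ 2 * P ^ 2) * ‖grad u‖ ^ 2 →
      α / (1 + C ^ 2 + C ^ 2 * P ^ 2) * r ≤ normSqV V u := fun r hr => by
    refine le_trans ?_ (hc u)
    rw [div_mul_eq_mul_div, div_le_iff₀ hden]
    calc α * r ≤ α * ((1 + C ^ 2 + C ^ 2 * P ^ 2) * ‖grad u‖ ^ 2) :=
          mul_le_mul_of_nonneg_left hr hα.le
      _ = _ := by ring
  have hg := sq_nonneg ‖grad u‖
  have hc1 : 0 ≤ C ^ 2 * ‖grad u‖ ^ 2 := by positivity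
  have hc2 : 0 ≤ C ^ 2 * P ^ 2 * ‖grad u‖ ^ 2 := by positivity
  refine ⟨key _ ?_, key _ ?_⟩
  · rw [norm_sq_H01]; nlinarith
  · nlinarith

theorem normSqV_smul {V : EuclideanSpace ℝ (Fin N) → ℝ} (hV : MemLp V ⊤ (volume.restrict Ω))
    (c : ℝ) (u : H01 Ω) : normSqV V (c • u) = c ^ 2 * normSqV V u := by
  rw [normSqV_eq hV, normSqV_eq hV]
  exact bilin_smul_self (innerVL hV) c u

theorem quartic_smul (β : EuclideanSpace ℝ (Fin N) → ℝ) (c e : ℝ) (u v : H01 Ω) :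
    quartic β (c • u) (e • v) = c ^ 2 * e ^ 2 * quartic β u v := by
  rw [quartic, quartic, ← integral_const_mul]
  refine integral_congr_ae ?_
  have h : ∀ (c : ℝ) (u : H01 Ω), fn (c • u) =ᵐ[volume.restrict Ω] fun x => c * fn u x :=
    fun c u => by
      rw [← fnL_apply, map_smul]
      exact Lp.coeFn_smul c (fn u)
  filter_upwards [h c u, h e v] with x h1 h2
  rw [h1, h2]; ring

/-- Weak lower semicontinuity of `‖·‖_V²`, in the form of a convergent lower bound. -/
theorem exists_lower_bound_of_weak {V : EuclideanSpace ℝ (Fin N) → ℝ}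
    (hV : MemLp V ⊤ (volume.restrict Ω)) (hnn : ∀ u : H01 Ω, 0 ≤ normSqV V u)
    {u : ℕ → H01 Ω} {w : H01 Ω}
    (hw : ∀ v, Tendsto (fun n => inner ℝ (u n) v) atTop (𝓝 (inner ℝ w v))) :
    ∃ r : ℕ → ℝ, (∀ n, r n ≤ normSqV V (u n)) ∧ Tendsto r atTop (𝓝 (normSqV V w)) := by
  refine ⟨fun n => 2 * innerVL hV w (u n) - innerVL hV w w, fun n => ?_, ?_⟩
  · rw [normSqV_eq hV]
    exact two_mul_bilin_sub_le (innerVL hV) (innerVL_comm hV)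
      (fun v => by rw [← normSqV_eq hV]; exact hnn v) (u n) w
  · rw [normSqV_eq hV w]
    exact tendsto_two_mul_bilin_sub hw (innerVL hV)

end Coercivity

/-! ### The partition of the indices into groups -/

section Groups

variable {d m : ℕ} {a : Fin (m + 1) → ℕ}

theorem mem_group {h : Fin m} {i : Fin d} :
    i ∈ group d a h ↔ a h.castSucc ≤ (i : ℕ) ∧ (i : ℕ) < a h.succ := by
  simp [group]

theorem IsDecomposition.exists_mem_group (ha : IsDecomposition d a) (i : Fin d) :
    ∃ h, i ∈ group d a h := by
  have key : ∀ k : Fin (m + 1), (i : ℕ) < a k → ∃ h, i ∈ group d a h := fun k => by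
    induction k using Fin.induction with
    | zero => intro h; rw [ha.2.1] at h; exact absurd h (Nat.not_lt_zero _)
    | succ k ih =>
      intro h
      by_cases hk : (i : ℕ) < a k.castSucc
      · exact ih hk
      · exact ⟨k, mem_group.2 ⟨not_lt.1 hk, h⟩⟩
  exact key (Fin.last m) (by rw [ha.2.2]; exact i.2)

theorem IsDecomposition.group_unique (ha : IsDecomposition d a) {i : Fin d} {h k : Fin m}
    (hh : i ∈ group d a h) (hk : i ∈ group d a k) : h = k := by
  have key : ∀ {h k : Fin m}, i ∈ group d a h → i ∈ group d a k → ¬h < k := fun {h k} hh hk hlt => by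
    have h1 : a h.succ ≤ a k.castSucc := ha.1.monotone (by
      rw [Fin.le_def, Fin.val_succ, Fin.val_castSucc]; exact hlt)
    have h2 := (mem_group.1 hh).2
    have h3 := (mem_group.1 hk).1
    omega
  exact le_antisymm (not_lt.1 (key hk hh)) (not_lt.1 (key hh hk))

/-- The group to which an index belongs. -/
def IsDecomposition.grp (ha : IsDecomposition d a) (i : Fin d) : Fin m :=
  (ha.exists_mem_group i).choose

theorem IsDecomposition.mem_grp (ha : IsDecomposition d a) (i : Fin d) :
    i ∈ group d a (ha.grp i) := (ha.exists_mem_group i).choose_spec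

theorem IsDecomposition.grp_eq (ha : IsDecomposition d a) {i : Fin d} {h : Fin m}
    (hi : i ∈ group d a h) : ha.grp i = h := ha.group_unique (ha.mem_grp i) hi

theorem IsDecomposition.sum_group (ha : IsDecomposition d a) (f : Fin d → ℝ) :
    ∑ h, ∑ i ∈ group d a h, f i = ∑ i, f i := by
  have e : ∀ h, group d a h = Finset.univ.filter fun i => ha.grp i = h := fun h => by
    ext i
    simp only [Finset.mem_filter, Finset.mem_univ, true_and]
    exact ⟨ha.grp_eq, fun hi => hi ▸ ha.mem_grp i⟩
  simp only [e]
  exact Finset.sum_fiberwise _ _ _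

/-- The first index of a group. -/
def IsDecomposition.first (ha : IsDecomposition d a) (h : Fin m) : Fin d :=
  ⟨a h.castSucc, by
    rw [← ha.2.2]; exact ha.1 (by rw [Fin.lt_def]; exact h.2)⟩

theorem IsDecomposition.first_mem (ha : IsDecomposition d a) (h : Fin m) :
    ha.first h ∈ group d a h :=
  mem_group.2 ⟨le_rfl, ha.1 Fin.castSucc_lt_succ⟩

end Groups

/-! ### Group norms, interaction matrix and Nehari set -/

section GroupQuantities

variable {N d m : ℕ} {Ω : Set (EuclideanSpace ℝ (Fin N))} {a : Fin (m + 1) → ℕ}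
  {V : Fin d → EuclideanSpace ℝ (Fin N) → ℝ}
  {β : Fin d → Fin d → EuclideanSpace ℝ (Fin N) → ℝ}

/-- The squared norms `∑_{i ∈ I_h} ‖u_i‖_i²` of the groups. -/
def groupNorm (a : Fin (m + 1) → ℕ) (V : Fin d → EuclideanSpace ℝ (Fin N) → ℝ)
    (u : Fin d → H01 Ω) (h : Fin m) : ℝ := ∑ i ∈ group d a h, normSqV (V i) (u i)

theorem sum_groupNorm (ha : IsDecomposition d a) (u : Fin d → H01 Ω) :
    ∑ h, groupNorm a V u h = ∑ i, normSqV (V i) (u i) := ha.sum_group _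

theorem sum_matM (ha : IsDecomposition d a) (u : Fin d → H01 Ω) (h : Fin m) :
    ∑ k, matM a β u h k = ∑ i ∈ group d a h, ∑ j, quartic (β i j) (u i) (u j) := by
  simp only [matM, Matrix.of_apply]
  rw [Finset.sum_comm]
  exact Finset.sum_congr rfl fun i _ => ha.sum_group _

theorem sum_sum_matM (ha : IsDecomposition d a) (u : Fin d → H01 Ω) :
    ∑ h, ∑ k, matM a β u h k = ∑ i, ∑ j, quartic (β i j) (u i) (u j) := by
  simp only [sum_matM ha]
  exact ha.sum_group _

theorem energy_eq (ha : IsDecomposition d a) (u : Fin d → H01 Ω) :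
    4 * energy V β u = 2 * ∑ h, groupNorm a V u h - ∑ h, ∑ k, matM a β u h k := by
  rw [energy, sum_groupNorm ha, sum_sum_matM ha]
  ring

theorem matM_symm (hs : ∀ i j, β i j =ᵐ[volume.restrict Ω] β j i) (u : Fin d → H01 Ω)
    (h k : Fin m) : matM a β u h k = matM a β u k h := by
  simp only [matM, Matrix.of_apply]
  rw [Finset.sum_comm]
  refine Finset.sum_congr rfl fun j _ => Finset.sum_congr rfl fun i _ => integral_congr_ae ?_
  filter_upwards [hs i j] with x hx
  rw [hx]; ring

/-- Evaluating ∂ᵢJ(u) at uᵢ itself returns the squared norm minus the quartic terms, so the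
constraint reads y = M 1. -/
theorem mem_nehari_iff (E : L4Embedding Ω) (ha : IsDecomposition d a)
    (hV : ∀ i, MemLp (V i) ⊤ (volume.restrict Ω))
    (hβ : ∀ i j, MemLp (β i j) ⊤ (volume.restrict Ω))
    (hs : ∀ i j, β i j =ᵐ[volume.restrict Ω] β j i) (u : Fin d → H01 Ω) :
    u ∈ nehari Ω a V β ↔
      ∀ h, groupNorm a V u h ≠ 0 ∧ groupNorm a V u h = ∑ k, matM a β u h k := by
  have key : ∀ h, ∑ i ∈ group d a h, partialEnergy V β u i (u i)
      = groupNorm a V u h - ∑ k, matM a β u h k := fun h => by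
    rw [sum_matM ha, groupNorm, ← Finset.sum_sub_distrib]
    refine Finset.sum_congr rfl fun i _ => ?_
    rw [partialEnergy_eq E hV hβ hs, normSqV]
    congr 1
    exact Finset.sum_congr rfl fun j _ => (E.quartic_eq (hβ i j) _ _).symm
  simp only [nehari, mem_ofPred_eq, key, sub_eq_zero]
  rfl

/-- Multiplication of the components of the `h`-th group by `√t_h`. -/
def scale (ha : IsDecomposition d a) (t : Fin m → ℝ) (u : Fin d → H01 Ω) : Fin d → H01 Ω :=
  fun i => Real.sqrt (t (ha.grp i)) • u i

theorem groupNorm_scale (ha : IsDecomposition d a)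
    (hV : ∀ i, MemLp (V i) ⊤ (volume.restrict Ω)) {t : Fin m → ℝ} (ht : ∀ h, 0 ≤ t h)
    (u : Fin d → H01 Ω) (h : Fin m) :
    groupNorm a V (scale ha t u) h = t h * groupNorm a V u h := by
  rw [groupNorm, groupNorm, Finset.mul_sum]
  refine Finset.sum_congr rfl fun i hi => ?_
  rw [scale, normSqV_smul (hV i), ha.grp_eq hi, Real.sq_sqrt (ht h)]

theorem matM_scale (ha : IsDecomposition d a) {t : Fin m → ℝ} (ht : ∀ h, 0 ≤ t h)
    (u : Fin d → H01 Ω) (h k : Fin m) :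
    matM a β (scale ha t u) h k = t h * t k * matM a β u h k := by
  simp only [matM, Matrix.of_apply, Finset.mul_sum]
  refine Finset.sum_congr rfl fun i hi => Finset.sum_congr rfl fun j hj => ?_
  rw [scale, scale, quartic_smul, ha.grp_eq hi, ha.grp_eq hj, Real.sq_sqrt (ht h),
    Real.sq_sqrt (ht k)]

/-- After scaling, the constraint in row h is t_h y_h = t_h (M t)_h; square roots in `scale` are
what makes it linear. -/
theorem scale_mem_nehari (E : L4Embedding Ω) (ha : IsDecomposition d a)
    (hV : ∀ i, MemLp (V i) ⊤ (volume.restrict Ω))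
    (hβ : ∀ i j, MemLp (β i j) ⊤ (volume.restrict Ω))
    (hs : ∀ i j, β i j =ᵐ[volume.restrict Ω] β j i) {u : Fin d → H01 Ω} {t : Fin m → ℝ}
    (ht : ∀ h, 0 < t h) (hy : ∀ h, 0 < groupNorm a V u h)
    (hsol : (matM a β u).mulVec t = groupNorm a V u) :
    scale ha t u ∈ nehari Ω a V β := by
  refine (mem_nehari_iff E ha hV hβ hs _).2 fun h => ?_
  have ht' : ∀ h, 0 ≤ t h := fun h => (ht h).le
  rw [groupNorm_scale ha hV ht']
  refine ⟨(mul_pos (ht h) (hy h)).ne', ?_⟩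
  simp only [matM_scale ha ht']
  rw [← hsol, Matrix.mulVec, dotProduct, Finset.mul_sum]
  exact Finset.sum_congr rfl fun k _ => by ring

end GroupQuantities

/-! ### Disjoint bumps in Ω -/

section Bumps

open Filter Topology

variable {N : ℕ} {Ω : Set (EuclideanSpace ℝ (Fin N))}

/-- In dimension at least 1 a non-empty open set is infinite; take m of its points, separate them by
disjoint open sets and put a bump in each. -/
theorem exists_disjoint_bumps (hN : 1 ≤ N) (hΩo : IsOpen Ω) (hΩn : Ω.Nonempty) (m : ℕ) :
    ∃ f : Fin m → EuclideanSpace ℝ (Fin N) → ℝ, (∀ h, IsTestFunction Ω (f h)) ∧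
      (∀ h k x, h ≠ k → f h x * f k x = 0) ∧ ∀ h, ∃ x, f h x ≠ 0 := by
  have : Nonempty (Fin N) := ⟨⟨0, hN⟩⟩
  have hinf : Ω.Infinite := by
    obtain ⟨x, hx⟩ := hΩn
    exact infinite_of_mem_nhds x (hΩo.mem_nhds hx)
  have := hinf.to_subtype
  let p : Fin m ↪ Ω := (Fin.valEmbedding).trans (Infinite.natEmbedding Ω)
  obtain ⟨U, hU, hdisj⟩ := (Set.finite_range fun h => (p h : EuclideanSpace ℝ (Fin N))).t2_separation
  have hex : ∀ h, ∃ f : EuclideanSpace ℝ (Fin N) → ℝ,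
      tsupport f ⊆ U (p h) ∩ Ω ∧ HasCompactSupport f ∧ ContDiff ℝ ∞ f ∧ f (p h) = 1 := fun h => by
    obtain ⟨f, h1, h2, h3, -, h5⟩ := exists_contDiff_tsupport_subset (n := ⊤)
      (((hU (p h)).2.inter hΩo).mem_nhds ⟨(hU (p h)).1, (p h).2⟩)
    exact ⟨f, h1, h2, h3, h5⟩
  choose f h1 h2 h3 h4 using hex
  refine ⟨f, fun h => ⟨h3 h, h2 h, (h1 h).trans inter_subset_right⟩, fun h k x hhk => ?_,
    fun h => ⟨p h, by rw [h4]; exact one_ne_zero⟩⟩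
  by_contra hne
  have hx1 := (h1 h (subset_tsupport _ (left_ne_zero_of_mul hne))).1
  have hx2 := (h1 k (subset_tsupport _ (right_ne_zero_of_mul hne))).1
  have hpk : (p h : EuclideanSpace ℝ (Fin N)) ≠ p k := fun e => hhk (p.injective (Subtype.ext e))
  exact Set.disjoint_left.1 (hdisj (mem_range_self h) (mem_range_self k) hpk) hx1 hx2

theorem quartic_testElem_pos {f : EuclideanSpace ℝ (Fin N) → ℝ} (hf : IsTestFunction Ω f)
    (hne : ∃ x, f x ≠ 0) {b : EuclideanSpace ℝ (Fin N) → ℝ}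
    (hb : MemLp b ⊤ (volume.restrict Ω)) {μ : ℝ} (hμ : 0 < μ)
    (hle : ∀ᵐ x ∂volume.restrict Ω, μ ≤ b x) (E : L4Embedding Ω) :
    0 < quartic b (testElem hf) (testElem hf) := by
  have hc : Continuous fun x => f x ^ 4 := hf.1.continuous.pow 4
  have hcs : HasCompactSupport fun x => f x ^ 4 := hf.2.1.comp_left (g := fun t => t ^ 4) (by simp)
  have hI : Integrable fun x => f x ^ 4 := hc.integrable_of_hasCompactSupport hcs
  obtain ⟨x₀, hx₀⟩ := hne
  have hpos : 0 < ∫ x, f x ^ 4 := by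
    refine hc.integral_pos_of_hasCompactSupport_nonneg_nonzero hcs (fun x => ?_) (x := x₀) ?_
    · positivity
    · positivity
  have hset : ∫ x in Ω, f x ^ 4 = ∫ x, f x ^ 4 :=
    setIntegral_eq_integral_of_forall_compl_eq_zero fun x hx => by
      rw [Function.notMem_support.1 fun hs => hx (hf.support_subset hs)]; simp
  refine lt_of_lt_of_le (mul_pos hμ hpos) ?_
  rw [← hset, ← integral_const_mul]
  refine integral_mono_ae (hI.integrableOn.const_mul μ) ?_ ?_
  · refine (E.integrable_quad hb (testElem hf) (testElem hf) (testElem hf) (testElem hf)).congr ?_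
    exact Eventually.of_forall fun x => by ring
  · filter_upwards [hle, fn_testElem hf] with x hx hx2
    rw [hx2, mul_assoc, ← pow_add]
    exact mul_le_mul_of_nonneg_right hx (by positivity)

theorem quartic_testElem_eq_zero {f g : EuclideanSpace ℝ (Fin N) → ℝ} (hf : IsTestFunction Ω f)
    (hg : IsTestFunction Ω g) (h : ∀ x, f x * g x = 0) (β : EuclideanSpace ℝ (Fin N) → ℝ) :
    quartic β (testElem hf) (testElem hg) = 0 := by
  refine integral_eq_zero_of_ae ?_
  filter_upwards [fn_testElem hf, fn_testElem hg] with x h1 h2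
  rw [h1, h2, mul_assoc, ← mul_pow, h]
  simp

end Bumps

/-! ### A Nehari point unaffected by the couplings -/

section TestConfiguration

variable {N d m : ℕ} {Ω : Set (EuclideanSpace ℝ (Fin N))} {a : Fin (m + 1) → ℕ}
  {V : Fin d → EuclideanSpace ℝ (Fin N) → ℝ}
  {β : Fin d → Fin d → EuclideanSpace ℝ (Fin N) → ℝ}

/-- The vector whose only nonzero components are the `w_h`, placed at the first index of each
group. -/
def spread (ha : IsDecomposition d a) (w : Fin m → H01 Ω) : Fin d → H01 Ω :=
  fun i => if i = ha.first (ha.grp i) then w (ha.grp i) else 0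

theorem spread_first (ha : IsDecomposition d a) (w : Fin m → H01 Ω) (h : Fin m) :
    spread ha w (ha.first h) = w h := by
  rw [spread, ha.grp_eq (ha.first_mem h), if_pos rfl]

theorem spread_eq_zero (ha : IsDecomposition d a) (w : Fin m → H01 Ω) {h : Fin m} {i : Fin d}
    (hi : i ∈ group d a h) (hne : i ≠ ha.first h) : spread ha w i = 0 := by
  rw [spread, ha.grp_eq hi, if_neg hne]

theorem groupNorm_spread (ha : IsDecomposition d a)
    (hV : ∀ i, MemLp (V i) ⊤ (volume.restrict Ω)) (w : Fin m → H01 Ω) (h : Fin m) :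
    groupNorm a V (spread ha w) h = normSqV (V (ha.first h)) (w h) := by
  rw [groupNorm, Finset.sum_eq_single (ha.first h), spread_first]
  · intro i hi hne
    rw [spread_eq_zero ha w hi hne]
    simpa using normSqV_smul (hV i) 0 (0 : H01 Ω)
  · exact fun hn => absurd (ha.first_mem h) hn

theorem matM_spread (ha : IsDecomposition d a) (w : Fin m → H01 Ω) (h k : Fin m) :
    matM a β (spread ha w) h k = quartic (β (ha.first h) (ha.first k)) (w h) (w k) := by
  have z1 : ∀ (b : EuclideanSpace ℝ (Fin N) → ℝ) (v : H01 Ω), quartic b 0 v = 0 := fun b v => by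
    simpa using quartic_smul b 0 1 (0 : H01 Ω) v
  have z2 : ∀ (b : EuclideanSpace ℝ (Fin N) → ℝ) (v : H01 Ω), quartic b v 0 = 0 := fun b v => by
    simpa using quartic_smul b 1 0 v (0 : H01 Ω)
  rw [matM, Matrix.of_apply, Finset.sum_eq_single (ha.first h),
    Finset.sum_eq_single (ha.first k), spread_first, spread_first]
  · intro i hi hne
    rw [spread_eq_zero ha w hi hne, z2]
  · exact fun hn => absurd (ha.first_mem k) hn
  · intro i hi hne
    simp only [spread_eq_zero ha w hi hne, z1, Finset.sum_const_zero]
  · exact fun hn => absurd (ha.first_mem h) hn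

/-- An explicit element of the Nehari set with disjointly supported components, and its norm. -/
theorem exists_mem_nehari (E : L4Embedding Ω) (ha : IsDecomposition d a)
    (hV : ∀ i, MemLp (V i) ⊤ (volume.restrict Ω))
    (hβ : ∀ i j, MemLp (β i j) ⊤ (volume.restrict Ω))
    (hs : ∀ i j, β i j =ᵐ[volume.restrict Ω] β j i)
    {b : Fin d → EuclideanSpace ℝ (Fin N) → ℝ} (hb : ∀ i, β i i =ᵐ[volume.restrict Ω] b i)
    {w : Fin m → H01 Ω} (hoff : ∀ (b : EuclideanSpace ℝ (Fin N) → ℝ) h k, h ≠ k →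
      quartic b (w h) (w k) = 0)
    (hq : ∀ h, 0 < quartic (b (ha.first h)) (w h) (w h))
    (hn : ∀ h, 0 < normSqV (V (ha.first h)) (w h)) :
    ∃ u ∈ nehari Ω a V β, ∑ h, groupNorm a V u h
      = ∑ h, normSqV (V (ha.first h)) (w h) ^ 2 / quartic (b (ha.first h)) (w h) (w h) := by
  -- For the spread vector M is diagonal, so M t = y is solved entry by entry and off-diagonal
  -- couplings never enter the level.
  set t : Fin m → ℝ := fun h =>
    normSqV (V (ha.first h)) (w h) / quartic (b (ha.first h)) (w h) (w h) with ht
  have htpos : ∀ h, 0 < t h := fun h => div_pos (hn h) (hq h)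
  have hdiag : ∀ h, matM a β (spread ha w) h h = quartic (b (ha.first h)) (w h) (w h) := fun h => by
    rw [matM_spread]
    refine integral_congr_ae ?_
    filter_upwards [hb (ha.first h)] with x hx
    rw [hx]
  refine ⟨scale ha t (spread ha w), scale_mem_nehari E ha hV hβ hs htpos (fun h => ?_) ?_, ?_⟩
  · rw [groupNorm_spread ha hV]; exact hn h
  · funext h
    rw [Matrix.mulVec, dotProduct, Finset.sum_eq_single h, hdiag, groupNorm_spread ha hV, ht,
      mul_div_cancel₀ _ (hq h).ne']
    · intro k _ hk
      rw [matM_spread, hoff _ _ _ hk.symm, zero_mul]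
    · simp
  · refine Finset.sum_congr rfl fun h _ => ?_
    rw [groupNorm_scale ha hV (fun h => (htpos h).le), groupNorm_spread ha hV, ht]
    ring

end TestConfiguration

/-! ### Minimization on the Nehari set -/

section Minimizer

open Filter Topology

theorem exists_subseq_pi_tendsto_inner {H ι : Type*} [NormedAddCommGroup H]
    [InnerProductSpace ℝ H] [CompleteSpace H] [TopologicalSpace.SeparableSpace H] [Fintype ι]
    {u : ℕ → ι → H} {R : ℝ} (hu : ∀ n i, ‖u n i‖ ≤ R) :
    ∃ (w : ι → H) (φ : ℕ → ℕ), StrictMono φ ∧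
      ∀ i v, Tendsto (fun n => inner ℝ (u (φ n) i) v) atTop (𝓝 (inner ℝ (w i) v)) := by
  classical
  have key : ∀ s : Finset ι, ∃ (w : ι → H) (φ : ℕ → ℕ), StrictMono φ ∧
      ∀ i ∈ s, ∀ v, Tendsto (fun n => inner ℝ (u (φ n) i) v) atTop (𝓝 (inner ℝ (w i) v)) := by
    intro s
    induction s using Finset.induction_on with
    | empty => exact ⟨fun _ => 0, id, strictMono_id, by simp⟩
    | insert j s hj ih =>
      obtain ⟨w, φ, hφ, hw⟩ := ih
      obtain ⟨w', ψ, hψ, hw'⟩ := exists_subseq_tendsto_inner (u := fun n => u (φ n) j)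
        (fun n => hu (φ n) j)
      refine ⟨Function.update w j w', φ ∘ ψ, hφ.comp hψ, fun i hi v => ?_⟩
      rcases eq_or_ne i j with rfl | hne
      · rw [Function.update_self]; exact hw' v
      · rw [Function.update_of_ne hne]
        exact (hw i ((Finset.mem_insert.1 hi).resolve_left hne) v).comp hψ.tendsto_atTop
  obtain ⟨w, φ, hφ, hw⟩ := key Finset.univ
  exact ⟨w, φ, hφ, fun i => hw i (Finset.mem_univ i)⟩

variable {N d m : ℕ} {Ω : Set (EuclideanSpace ℝ (Fin N))} {a : Fin (m + 1) → ℕ}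
  {V : Fin d → EuclideanSpace ℝ (Fin N) → ℝ}
  {β : Fin d → Fin d → EuclideanSpace ℝ (Fin N) → ℝ} {E : L4Embedding Ω} {S C K Γ : ℝ}

/-- Since |x| = 2 max(x, 0) - x, once the row sums are controlled only positive off-diagonal entries
hurt. Competition may be arbitrarily strong. -/
theorem diagExcess_eq {ι : Type*} [Fintype ι] [DecidableEq ι] (M : Matrix ι ι ℝ) (h : ι) :
    diagExcess M h = ∑ k, M h k - 2 * ∑ k ∈ Finset.univ.erase h, max (M h k) 0 := by
  have e : ∀ x : ℝ, |x| = 2 * max x 0 - x := fun x => by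
    rcases le_total 0 x with hx | hx
    · rw [abs_of_nonneg hx, max_eq_left hx]; ring
    · rw [abs_of_nonpos hx, max_eq_right hx]; ring
  simp only [diagExcess, e, Finset.sum_sub_distrib, ← Finset.mul_sum]
  rw [← Finset.add_sum_erase _ _ (Finset.mem_univ h)]
  ring

/-- The data of the system in the range of couplings in which the minimization is carried out:
weak cooperation between different groups, relative to the level `Γ`. -/
structure WeakCooperation (E : L4Embedding Ω) (a : Fin (m + 1) → ℕ)
    (V : Fin d → EuclideanSpace ℝ (Fin N) → ℝ)
    (β : Fin d → Fin d → EuclideanSpace ℝ (Fin N) → ℝ) (S C K Γ : ℝ) : Prop where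
  decomp : IsDecomposition d a
  memLp_V : ∀ i, MemLp (V i) ⊤ (volume.restrict Ω)
  memLp_β : ∀ i j, MemLp (β i j) ⊤ (volume.restrict Ω)
  symm : ∀ i j, β i j =ᵐ[volume.restrict Ω] β j i
  S_pos : 0 < S
  C_pos : 0 < C
  K_pos : 0 < K
  coercive : ∀ i (w : H01 Ω), S * ‖w‖ ^ 2 ≤ normSqV (V i) w ∧ S * ‖E.T w‖ ^ 2 ≤ normSqV (V i) w
  same : ∀ h, ∀ i ∈ group d a h, ∀ j ∈ group d a h, ∀ᵐ x ∂volume.restrict Ω, β i j x ≤ C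
  different : ∀ h k, h ≠ k → ∀ i ∈ group d a h, ∀ j ∈ group d a k,
    ∀ᵐ x ∂volume.restrict Ω, β i j x ≤ K
  small : 8 * K * Γ ≤ S ^ 2

/-- Below the level `Γ`, the vectors in or inside the Nehari set. -/
structure Admissible (a : Fin (m + 1) → ℕ) (V : Fin d → EuclideanSpace ℝ (Fin N) → ℝ)
    (β : Fin d → Fin d → EuclideanSpace ℝ (Fin N) → ℝ) (Γ : ℝ) (u : Fin d → H01 Ω) : Prop where
  pos : ∀ h, 0 < groupNorm a V u h
  le : ∀ h, groupNorm a V u h ≤ ∑ k, matM a β u h k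
  sum_le : ∑ h, groupNorm a V u h ≤ Γ

/-- The squared `L⁴` norms of the groups. -/
def groupL4 (E : L4Embedding Ω) (a : Fin (m + 1) → ℕ) (u : Fin d → H01 Ω) (h : Fin m) : ℝ :=
  ∑ i ∈ group d a h, ‖E.T (u i)‖ ^ 2

theorem groupL4_nonneg (u : Fin d → H01 Ω) (h : Fin m) : 0 ≤ groupL4 E a u h :=
  Finset.sum_nonneg fun _ _ => sq_nonneg _

theorem matM_apply (u : Fin d → H01 Ω) (h k : Fin m) :
    matM a β u h k = ∑ i ∈ group d a h, ∑ j ∈ group d a k, quartic (β i j) (u i) (u j) := rfl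

theorem matM_le (hβ : ∀ i j, MemLp (β i j) ⊤ (volume.restrict Ω)) {κ : ℝ} (hκ : 0 ≤ κ)
    {h k : Fin m} (hle : ∀ i ∈ group d a h, ∀ j ∈ group d a k,
      ∀ᵐ x ∂volume.restrict Ω, β i j x ≤ κ) (u : Fin d → H01 Ω) :
    matM a β u h k ≤ κ * (groupL4 E a u h * groupL4 E a u k) := by
  rw [groupL4, groupL4, Finset.sum_mul_sum, Finset.mul_sum, matM, Matrix.of_apply]
  refine Finset.sum_le_sum fun i hi => ?_
  rw [Finset.mul_sum]
  exact Finset.sum_le_sum fun j hj => E.quartic_le (hβ i j) hκ (hle i hi j hj) _ _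

theorem groupL4_congr_abs {u w : Fin d → H01 Ω}
    (h : ∀ i, ∀ᵐ x ∂volume.restrict Ω, fn (w i) x = |fn (u i) x|) (k : Fin m) :
    groupL4 E a w k = groupL4 E a u k := by
  refine Finset.sum_congr rfl fun i _ => congrArg (· ^ 2) (le_antisymm ?_ ?_) <;>
  · refine Lp.norm_le_norm_of_ae_le ?_
    filter_upwards [h i, E.coe_T (u i), E.coe_T (w i)] with x h1 h2 h3
    rw [h2, h3, h1, Real.norm_eq_abs, Real.norm_eq_abs, abs_abs]

namespace WeakCooperation

variable (R : WeakCooperation E a V β S C K Γ)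
include R

theorem normSqV_nonneg (i : Fin d) (w : H01 Ω) : 0 ≤ normSqV (V i) w :=
  (mul_nonneg R.S_pos.le (sq_nonneg _)).trans (R.coercive i w).1

theorem groupNorm_nonneg (u : Fin d → H01 Ω) (h : Fin m) : 0 ≤ groupNorm a V u h :=
  Finset.sum_nonneg fun i _ => R.normSqV_nonneg i _

theorem groupL4_le (u : Fin d → H01 Ω) (h : Fin m) :
    S * groupL4 E a u h ≤ groupNorm a V u h := by
  rw [groupL4, Finset.mul_sum]
  exact Finset.sum_le_sum fun i _ => (R.coercive i _).2

theorem groupNorm_pos {u : Fin d → H01 Ω} {h : Fin m} (hs : 0 < groupL4 E a u h) :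
    0 < groupNorm a V u h := (mul_pos R.S_pos hs).trans_le (R.groupL4_le u h)

/-- Write s_h for `groupL4`. Then M_hk ≤ K s_h s_k and S ∑ s_k ≤ Γ, so the sum is at most K s_h Γ /
S, and `small` is exactly what turns this into S s_h / 8. -/
theorem eight_mul_sum_max_le {u : Fin d → H01 Ω} (hu : ∑ h, groupNorm a V u h ≤ Γ) (h : Fin m) :
    8 * ∑ k ∈ Finset.univ.erase h, max (matM a β u h k) 0 ≤ S * groupL4 E a u h := by
  have hs := groupL4_nonneg (E := E) (a := a) u
  have h1 : ∑ k ∈ Finset.univ.erase h, max (matM a β u h k) 0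
      ≤ K * groupL4 E a u h * ∑ k, groupL4 E a u k := by
    rw [Finset.mul_sum]
    refine (Finset.sum_le_sum fun k hk => ?_).trans
      (Finset.sum_le_sum_of_subset_of_nonneg (Finset.erase_subset h _) fun k _ _ =>
        mul_nonneg (mul_nonneg R.K_pos.le (hs h)) (hs k))
    refine max_le ?_ (mul_nonneg (mul_nonneg R.K_pos.le (hs h)) (hs k))
    rw [mul_assoc]
    exact matM_le R.memLp_β R.K_pos.le (R.different h k (Finset.ne_of_mem_erase hk).symm) u
  have h2 : S * ∑ k, groupL4 E a u k ≤ Γ := by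
    rw [Finset.mul_sum]
    exact (Finset.sum_le_sum fun k _ => R.groupL4_le u k).trans hu
  have h3 : 0 ≤ K * groupL4 E a u h := mul_nonneg R.K_pos.le (hs h)
  refine le_of_mul_le_mul_left ?_ R.S_pos
  calc S * (8 * ∑ k ∈ Finset.univ.erase h, max (matM a β u h k) 0)
      ≤ S * (8 * (K * groupL4 E a u h * ∑ k, groupL4 E a u k)) := by
        have := R.S_pos; gcongr
    _ = 8 * (K * groupL4 E a u h) * (S * ∑ k, groupL4 E a u k) := by ring
    _ ≤ 8 * (K * groupL4 E a u h) * Γ := by gcongr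
    _ = (8 * K * Γ) * groupL4 E a u h := by ring
    _ ≤ S ^ 2 * groupL4 E a u h := mul_le_mul_of_nonneg_right R.small (hs h)
    _ = S * (S * groupL4 E a u h) := by ring

theorem two_mul_sum_max_lt {u : Fin d → H01 Ω} (hu : Admissible a V β Γ u) (h : Fin m) :
    2 * ∑ k ∈ Finset.univ.erase h, max (matM a β u h k) 0 < groupNorm a V u h / 2 := by
  have := R.eight_mul_sum_max_le hu.sum_le h
  have := R.groupL4_le u h
  have := hu.pos h
  linarith

/-- The excess is the row sum, at least y_h, minus twice the positive off-diagonal part, which is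
less than y_h/2. -/
theorem half_lt_diagExcess {u : Fin d → H01 Ω} (hu : Admissible a V β Γ u) (h : Fin m) :
    groupNorm a V u h / 2 < diagExcess (matM a β u) h := by
  rw [diagExcess_eq]
  have := R.two_mul_sum_max_lt hu h
  have := hu.le h
  linarith

/-- With s = `groupL4`, S s ≤ y_h ≤ C s² + S s/8. Since s = 0 would contradict y_h > 0, one can
divide by s. This keeps every group from vanishing in the limit. -/
theorem le_groupL4 {u : Fin d → H01 Ω} (hsum : ∑ h, groupNorm a V u h ≤ Γ) {h : Fin m}
    (hpos : 0 < groupNorm a V u h) (hle : groupNorm a V u h ≤ ∑ k, matM a β u h k) :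
    S / (2 * C) ≤ groupL4 E a u h := by
  have h0 := groupL4_nonneg (E := E) (a := a) u h
  have h1 := R.eight_mul_sum_max_le hsum h
  have h2 := R.groupL4_le u h
  have h3 := matM_le (E := E) R.memLp_β R.C_pos.le (R.same h) u
  have h4 : ∑ k, matM a β u h k
      ≤ matM a β u h h + ∑ k ∈ Finset.univ.erase h, max (matM a β u h k) 0 := by
    rw [← Finset.add_sum_erase _ _ (Finset.mem_univ h)]
    exact add_le_add le_rfl (Finset.sum_le_sum fun k _ => le_max_left _ _)
  have hC := R.C_pos
  have hS := R.S_pos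
  have hs : 0 < groupL4 E a u h := by
    rcases h0.eq_or_lt with h5 | h5
    · rw [← h5] at h1 h3
      simp only [mul_zero] at h1 h3
      linarith
    · exact h5
  rw [div_le_iff₀ (by positivity)]
  refine le_of_mul_le_mul_right ?_ hs
  nlinarith

theorem mem_nehari_iff (u : Fin d → H01 Ω) : u ∈ nehari Ω a V β ↔
    ∀ h, groupNorm a V u h ≠ 0 ∧ groupNorm a V u h = ∑ k, matM a β u h k :=
  NLSSystem.mem_nehari_iff E R.decomp R.memLp_V R.memLp_β R.symm u

theorem admissible_of_mem_nehari {u : Fin d → H01 Ω} (hu : u ∈ nehari Ω a V β)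
    (hsum : ∑ h, groupNorm a V u h ≤ Γ) : Admissible a V β Γ u :=
  ⟨fun h => (R.groupNorm_nonneg u h).lt_of_ne ((R.mem_nehari_iff u).1 hu h).1.symm,
    fun h => ((R.mem_nehari_iff u).1 hu h).2.le, hsum⟩

/-- An admissible vector which does not exceed the infimum over the Nehari set belongs to it. -/
theorem mem_nehari_of_admissible {z : Fin d → H01 Ω} (hz : Admissible a V β Γ z)
    (hmin : ∀ v ∈ nehari Ω a V β, ∑ h, groupNorm a V z h ≤ ∑ h, groupNorm a V v h) :
    z ∈ nehari Ω a V β := by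
  obtain ⟨t, ht, hsol⟩ := exists_pos_mulVec_eq hz.pos (fun h => (R.half_lt_diagExcess hz h).le)
    (fun h => (R.two_mul_sum_max_lt hz h).trans (by have := hz.pos h; linarith))
  have h1 := hmin _ (scale_mem_nehari E R.decomp R.memLp_V R.memLp_β R.symm ht hz.pos hsol)
  simp only [groupNorm_scale R.decomp R.memLp_V (fun h => (ht h).le)] at h1
  have h2 := sum_mul_solution (matM_symm R.symm z) hsol
  simp only [mul_comm (t _)] at h1
  rw [h2] at h1
  have hnn : ∀ h ∈ Finset.univ, 0 ≤ t h * (∑ k, matM a β z h k - groupNorm a V z h) :=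
    fun h _ => mul_nonneg (ht h).le (sub_nonneg.2 (hz.le h))
  -- Minimality makes this sum of nonnegative terms at most 0, so each term vanishes, and t_h > 0
  -- leaves y_h = (M 1)_h.
  have h3 : ∑ h, t h * (∑ k, matM a β z h k - groupNorm a V z h) = 0 :=
    le_antisymm (by linarith) (Finset.sum_nonneg hnn)
  refine (R.mem_nehari_iff z).2 fun h => ⟨(hz.pos h).ne', ?_⟩
  have h4 := (Finset.sum_eq_zero_iff_of_nonneg hnn).1 h3 h (Finset.mem_univ h)
  exact (sub_eq_zero.1 ((mul_eq_zero.1 h4).resolve_left (ht h).ne')).symm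

theorem norm_sq_le {u : Fin d → H01 Ω} (hu : ∑ h, groupNorm a V u h ≤ Γ) (i : Fin d) :
    ‖u i‖ ^ 2 ≤ Γ / S := by
  rw [le_div_iff₀ R.S_pos, mul_comm]
  rw [sum_groupNorm R.decomp] at hu
  exact (R.coercive i (u i)).1.trans ((Finset.single_le_sum
    (f := fun i => normSqV (V i) (u i)) (fun j _ => R.normSqV_nonneg j _)
    (Finset.mem_univ i)).trans hu)

/-- Existence of a nonnegative minimizer of `∑ ‖u_i‖_i²` on the Nehari set. -/
theorem exists_minimizer [IsFiniteMeasure (volume.restrict Ω)]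
    (hne : ∃ u ∈ nehari Ω a V β, ∑ h, groupNorm a V u h < Γ) :
    ∃ z ∈ nehari Ω a V β, Admissible a V β Γ z ∧
      (∀ i, ∀ᵐ x ∂volume.restrict Ω, 0 ≤ fn (z i) x) ∧
      ∀ v ∈ nehari Ω a V β, ∑ h, groupNorm a V z h ≤ ∑ h, groupNorm a V v h := by
  obtain ⟨u₀, hu₀, hΓ⟩ := hne
  set A : Set ℝ := (fun u : Fin d → H01 Ω => ∑ h, groupNorm a V u h) '' nehari Ω a V β with hA
  have hbdd : BddBelow A := ⟨0, by
    rintro r ⟨u, -, rfl⟩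
    exact Finset.sum_nonneg fun h _ => R.groupNorm_nonneg u h⟩
  have hc : ∀ v ∈ nehari Ω a V β, sInf A ≤ ∑ h, groupNorm a V v h :=
    fun v hv => csInf_le hbdd ⟨v, hv, rfl⟩
  have hcΓ : sInf A < Γ := (hc u₀ hu₀).trans_lt hΓ
  obtain ⟨y, -, hy, hyA⟩ := exists_seq_tendsto_sInf (S := A) ⟨_, u₀, hu₀, rfl⟩ hbdd
  obtain ⟨n₀, hn₀⟩ := eventually_atTop.1 (hy.eventually (gt_mem_nhds hcΓ))
  choose u' hu' hu'y using hyA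
  -- The tail of the minimizing sequence, all of whose terms lie below the level Γ.
  set u : ℕ → Fin d → H01 Ω := fun n => u' (n + n₀) with hu
  have huN : ∀ n, u n ∈ nehari Ω a V β := fun n => hu' _
  have huΓ : ∀ n, ∑ h, groupNorm a V (u n) h ≤ Γ := fun n =>
    (hu'y (n + n₀)).le.trans (hn₀ _ (Nat.le_add_left _ _)).le
  have hlim : Tendsto (fun n => ∑ h, groupNorm a V (u n) h) atTop (𝓝 (sInf A)) :=
    ((tendsto_add_atTop_iff_nat n₀).2 hy).congr fun n => (hu'y (n + n₀)).symm
  have hbound : ∀ n i, ‖u n i‖ ≤ Real.sqrt (Γ / S) := fun n i =>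
    Real.le_sqrt_of_sq_le (R.norm_sq_le (huΓ n) i)
  obtain ⟨w, φ, hφ, hw⟩ := exists_subseq_pi_tendsto_inner hbound
  have hT : ∀ i, Tendsto (fun n => E.T (u (φ n) i)) atTop (𝓝 (E.T (w i))) := fun i =>
    E.tendsto_of_weak (fun n => hbound (φ n) i) (hw i)
  have hM : ∀ h k, Tendsto (fun n => matM a β (u (φ n)) h k) atTop (𝓝 (matM a β w h k)) :=
    fun h k => by
      simp only [matM_apply]
      exact tendsto_finsetSum _ fun i _ => tendsto_finsetSum _ fun j _ =>
        E.tendsto_quartic (R.memLp_β i j) (hT i) (hT j)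
  have hMs : ∀ h, Tendsto (fun n => ∑ k, matM a β (u (φ n)) h k) atTop
      (𝓝 (∑ k, matM a β w h k)) := fun h => tendsto_finsetSum _ fun k _ => hM h k
  have hs : ∀ h, Tendsto (fun n => groupL4 E a (u (φ n)) h) atTop (𝓝 (groupL4 E a w h)) :=
    fun h => tendsto_finsetSum _ fun i _ => (hT i).norm.pow 2
  choose r hr hrlim using fun i =>
    exists_lower_bound_of_weak (R.memLp_V i) (R.normSqV_nonneg i) (hw i)
  have hρ : ∀ h, Tendsto (fun n => ∑ i ∈ group d a h, r i n) atTop (𝓝 (groupNorm a V w h)) :=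
    fun h => tendsto_finsetSum _ fun i _ => hrlim i
  have hρle : ∀ h n, ∑ i ∈ group d a h, r i n ≤ groupNorm a V (u (φ n)) h :=
    fun h n => Finset.sum_le_sum fun i _ => hr i n
  -- Lower semicontinuity on the left and compactness on the right: of the Nehari identity only an
  -- inequality survives.
  have hwle : ∀ h, groupNorm a V w h ≤ ∑ k, matM a β w h k := fun h =>
    le_of_tendsto_of_tendsto' (hρ h) (hMs h) fun n =>
      (hρle h n).trans ((R.mem_nehari_iff _).1 (huN (φ n)) h).2.le
  have hwc : ∑ h, groupNorm a V w h ≤ sInf A :=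
    le_of_tendsto_of_tendsto' (tendsto_finsetSum _ fun h _ => hρ h)
      (hlim.comp hφ.tendsto_atTop) fun n => Finset.sum_le_sum fun h _ => hρle h n
  have hws : ∀ h, S / (2 * C) ≤ groupL4 E a w h := fun h =>
    ge_of_tendsto' (hs h) fun n =>
      have hadm := R.admissible_of_mem_nehari (huN (φ n)) (huΓ (φ n))
      R.le_groupL4 hadm.sum_le (hadm.pos h) (hadm.le h)
  -- Taking absolute values leaves M and the L⁴ norms unchanged and does not increase y, so the
  -- inequality y ≤ M 1 persists.
  choose z hz hzg using fun i => exists_abs (w i)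
  have hzY : ∀ h, groupNorm a V z h ≤ groupNorm a V w h := fun h =>
    Finset.sum_le_sum fun i _ => normSqV_le_of_abs (R.memLp_V i) (hz i) (hzg i)
  have hzM : matM a β z = matM a β w := by
    ext h k
    rw [matM_apply, matM_apply]
    exact Finset.sum_congr rfl fun i _ => Finset.sum_congr rfl fun j _ =>
      quartic_congr_abs (β i j) (hz i) (hz j)
  have hzc : ∑ h, groupNorm a V z h ≤ sInf A := (Finset.sum_le_sum fun h _ => hzY h).trans hwc
  have hzmin : ∀ v ∈ nehari Ω a V β, ∑ h, groupNorm a V z h ≤ ∑ h, groupNorm a V v h :=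
    fun v hv => hzc.trans (hc v hv)
  have hadm : Admissible a V β Γ z := by
    refine ⟨fun h => R.groupNorm_pos ?_, fun h => ?_, hzc.trans hcΓ.le⟩
    · rw [groupL4_congr_abs hz]
      exact (div_pos R.S_pos (mul_pos two_pos R.C_pos)).trans_le (hws h)
    · rw [hzM]; exact (hzY h).trans (hwle h)
  refine ⟨z, R.mem_nehari_of_admissible hadm hzmin, hadm, fun i => ?_, hzmin⟩
  filter_upwards [hz i] with x hx
  rw [hx]; exact abs_nonneg _

/-- The minimizers are critical points of the energy. -/
theorem isSolution {z : Fin d → H01 Ω} (hzN : z ∈ nehari Ω a V β) (hz : Admissible a V β Γ z)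
    (hmin : ∀ v ∈ nehari Ω a V β, ∑ h, groupNorm a V z h ≤ ∑ h, groupNorm a V v h) :
    IsSolution V β z := by
  intro i φ
  set ψ : Fin d → H01 Ω := Pi.single i φ with hψ
  have hline : ∀ j, z j + (0 : ℝ) • ψ j = z j := fun j => by rw [zero_smul, add_zero]
  have hz0 : (fun j => z j + (0 : ℝ) • ψ j) = z := funext hline
  have hY : ∀ h, HasDerivAt (fun ε : ℝ => groupNorm a V (fun j => z j + ε • ψ j) h)
      (∑ j ∈ group d a h, 2 * innerV (V j) (z j) (ψ j)) 0 := fun h =>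
    HasDerivAt.fun_sum fun j _ => hasDerivAt_normSqV (R.memLp_V j) (z j) (ψ j)
  have hM : ∀ h k, HasDerivAt (fun ε : ℝ => matM a β (fun j => z j + ε • ψ j) h k)
      (∑ j ∈ group d a h, ∑ l ∈ group d a k,
        (2 * E.quad (R.memLp_β j l) (z j) (ψ j) (z l) (z l)
          + 2 * E.quad (R.memLp_β j l) (z l) (ψ l) (z j) (z j))) 0 := fun h k => by
    simp only [matM_apply]
    exact HasDerivAt.fun_sum fun j _ => HasDerivAt.fun_sum fun l _ =>
      E.hasDerivAt_quartic (R.memLp_β j l) (z j) (z l) (ψ j) (ψ l)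
  have hzero := deriv_eq_zero_of_minimal (Y := fun ε => groupNorm a V fun j => z j + ε • ψ j)
    (M := fun ε => matM a β fun j => z j + ε • ψ j) hY (fun h k => hM h k)
    (fun ε => matM_symm R.symm _) (fun h => by
      rw [hz0]; exact ((R.mem_nehari_iff z).1 hzN h).2)
    (fun h => by rw [hz0]; exact hz.pos h) (fun h => by rw [hz0]; exact R.half_lt_diagExcess hz h)
    (fun h => by
      rw [hz0]
      exact (R.two_mul_sum_max_lt hz h).trans (by have := hz.pos h; linarith))
    (fun ε t ht hpos hsol => by
      have h1 := hmin _ (scale_mem_nehari E R.decomp R.memLp_V R.memLp_β R.symm ht hpos hsol)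
      simp only [groupNorm_scale R.decomp R.memLp_V (fun h => (ht h).le)] at h1
      rw [hz0]
      simpa only [mul_comm (t _)] using h1)
  -- The function g of `deriv_eq_zero_of_minimal` is 4J, an identity valid off the Nehari set as
  -- well.
  have hE1 : HasDerivAt (fun ε : ℝ => 4 * energy V β (fun j => z j + ε • ψ j)) 0 0 := by
    simp only [energy_eq R.decomp]
    exact (((HasDerivAt.fun_sum fun h _ => hY h).const_mul 2).fun_sub
      (HasDerivAt.fun_sum fun h _ => HasDerivAt.fun_sum fun k _ => hM h k)).congr_deriv hzero
  have hE2 := (hasDerivAt_energy E R.memLp_V R.memLp_β R.symm z ψ).const_mul 4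
  have hcrit := hE2.unique hE1
  have hsum : ∑ j, (innerV (V j) (z j) (ψ j) - ∑ l, E.quad (R.memLp_β j l) (z j) (ψ j) (z l) (z l))
      = innerV (V i) (z i) φ - ∑ l, E.quad (R.memLp_β i l) (z i) φ (z l) (z l) := by
    rw [Finset.sum_eq_single i]
    · rw [hψ, Pi.single_eq_same]
    · intro j _ hj
      have e : ψ j = 0 := Pi.single_eq_of_ne hj _
      have e1 : innerV (V j) (z j) 0 = 0 := by
        rw [← innerVL_apply (R.memLp_V j)]; exact map_zero _
      have e2 : ∀ l, E.quad (R.memLp_β j l) (z j) 0 (z l) (z l) = 0 := fun l => by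
        rw [E.quad_eq_integral]
        refine integral_eq_zero_of_ae ?_
        have h0 : fn (0 : H01 Ω) =ᵐ[volume.restrict Ω] 0 := Lp.coeFn_zero ℝ 2 _
        filter_upwards [h0] with x hx
        rw [hx]; simp
      simp only [e, e1, e2, Finset.sum_const_zero, sub_zero]
    · simp
  rw [hsum] at hcrit
  have hI : ∀ l, Integrable (fun x => β i l x * (fn (z i) x * fn φ x) * (fn (z l) x * fn (z l) x))
      (volume.restrict Ω) := fun l => E.integrable_quad (R.memLp_β i l) _ _ _ _
  have hpt : (fun x => (∑ j, β i j x * fn (z j) x ^ 2 * fn (z i) x) * fn φ x)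
      = fun x => ∑ l, β i l x * (fn (z i) x * fn φ x) * (fn (z l) x * fn (z l) x) := by
    funext x
    rw [Finset.sum_mul]
    exact Finset.sum_congr rfl fun l _ => by ring
  rw [hpt]
  refine ⟨integrable_finsetSum _ fun l _ => hI l, ?_⟩
  rw [integral_finsetSum _ fun l _ => hI l]
  simp only [E.quad_eq_integral] at hcrit
  linarith

end WeakCooperation

end Minimizer

/-! ### A priori estimates and the uniform level -/

section Estimates

open Filter Topology

/-- `ENNReal.ofReal r` is 0 for negative r, hence the maximum with 0. -/
theorem ae_abs_le_of_normLp_top_le {N : ℕ} {Ω : Set (EuclideanSpace ℝ (Fin N))}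
    {f : EuclideanSpace ℝ (Fin N) → ℝ} {r : ℝ} (h : normLp Ω ⊤ f ≤ ENNReal.ofReal r) :
    ∀ᵐ x ∂volume.restrict Ω, |f x| ≤ max r 0 := by
  rw [normLp, eLpNorm_exponent_top] at h
  filter_upwards [ae_le_eLpNormEssSup (f := f) (μ := volume.restrict Ω)] with x hx
  have h1 := hx.trans h
  rw [← ofReal_norm, ENNReal.ofReal_le_ofReal_iff'] at h1
  exact le_max_iff.2 h1

theorem exists_ae_abs_le_of_memLp_top {N : ℕ} {Ω : Set (EuclideanSpace ℝ (Fin N))}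
    {f : EuclideanSpace ℝ (Fin N) → ℝ} (h : MemLp f ⊤ (volume.restrict Ω)) :
    ∃ B : ℝ, 0 ≤ B ∧ ∀ᵐ x ∂volume.restrict Ω, |f x| ≤ B :=
  ⟨_, le_max_right _ _, ae_abs_le_of_normLp_top_le (r := (normLp Ω ⊤ f).toReal)
    (ENNReal.ofReal_toReal h.2.ne).ge⟩

variable {N d m : ℕ} {Ω : Set (EuclideanSpace ℝ (Fin N))} {a : Fin (m + 1) → ℕ}
  {V : Fin d → EuclideanSpace ℝ (Fin N) → ℝ}
  {β : Fin d → Fin d → EuclideanSpace ℝ (Fin N) → ℝ} {E : L4Embedding Ω} {S C K Γ : ℝ}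

theorem normLp_four_toReal (E : L4Embedding Ω) (u : H01 Ω) :
    (normLp Ω 4 (fn u)).toReal = ‖E.T u‖ := by
  rw [Lp.norm_def, eLpNorm_congr_ae (E.coe_T u), normLp]

theorem norm_T_eq_zero (E : L4Embedding Ω) {u : H01 Ω} (h : fn u = 0) : ‖E.T u‖ = 0 := by
  rw [← normLp_four_toReal, normLp, h, eLpNorm_congr_ae (Lp.coeFn_zero ℝ 2 _), eLpNorm_zero]
  rfl

/-- The competitive part of the interaction of two components. -/
theorem integral_negPart_le (E : L4Embedding Ω) {b : EuclideanSpace ℝ (Fin N) → ℝ}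
    (hb : MemLp b ⊤ (volume.restrict Ω)) {κ : ℝ} (hκ : 0 ≤ κ)
    (hle : ∀ᵐ x ∂volume.restrict Ω, b x ≤ κ) (u v : H01 Ω) :
    ∫ x in Ω, max (-(b x)) 0 * (fn u x * fn v x) ^ 2
      ≤ κ * (‖E.T u‖ ^ 2 * ‖E.T v‖ ^ 2) - quartic b u v := by
  have hb' : MemLp (fun x => max (b x) 0) ⊤ (volume.restrict Ω) := hb.pos_part
  have e : ∫ x in Ω, max (-(b x)) 0 * (fn u x * fn v x) ^ 2
      = quartic (fun x => max (b x) 0) u v - quartic b u v := by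
    rw [E.quartic_eq hb', E.quartic_eq hb, E.quad_eq_integral, E.quad_eq_integral,
      ← integral_sub (E.integrable_quad hb' u u v v) (E.integrable_quad hb u u v v)]
    refine integral_congr_ae (Eventually.of_forall fun x => ?_)
    -- The negative part is the positive part minus b; only the positive part has to be estimated.
    have : max (-(b x)) 0 = max (b x) 0 - b x := by
      rcases le_total 0 (b x) with h | h
      · rw [max_eq_left h, max_eq_right (neg_nonpos.2 h)]; ring
      · rw [max_eq_right h, max_eq_left (neg_nonneg.2 h)]; ring
    simp only [this]
    ring
  rw [e]
  refine sub_le_sub_right (E.quartic_le hb' hκ ?_ u v) _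
  filter_upwards [hle] with x hx
  exact max_le hx hκ

namespace WeakCooperation

variable (R : WeakCooperation E a V β S C K Γ)
include R

theorem mem_coneE {z : Fin d → H01 Ω} (hz : Admissible a V β Γ z) : z ∈ coneE Ω a β := by
  intro h
  have h1 := R.half_lt_diagExcess hz h
  have h2 := hz.pos h
  have h3 := le_abs_self (matM a β z h h)
  rw [diagExcess] at h1
  linarith

/-- Comparing energies on the Nehari set thus reduces to comparing total norms. -/
theorem four_mul_energy {u : Fin d → H01 Ω} (hu : u ∈ nehari Ω a V β) :
    4 * energy V β u = ∑ h, groupNorm a V u h := by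
  rw [energy_eq R.decomp, ← Finset.sum_congr rfl fun h _ => ((R.mem_nehari_iff u).1 hu h).2]
  ring

/-- Each group has a component with non-zero L⁴ norm, and distinct groups are disjoint. -/
theorem le_ncard {z : Fin d → H01 Ω} (hz : ∀ h, 0 < groupL4 E a z h) :
    m ≤ Set.ncard {i : Fin d | fn (z i) ≠ 0} := by
  have hex : ∀ h, ∃ i ∈ group d a h, fn (z i) ≠ 0 := fun h => by
    by_contra! hcon
    refine (hz h).ne' (Finset.sum_eq_zero fun i hi => ?_)
    rw [norm_T_eq_zero E (hcon i hi)]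
    exact zero_pow two_ne_zero
  choose f hf hfz using hex
  have hinj : Function.Injective f := fun h k hhk =>
    R.decomp.group_unique (hf h) (hhk ▸ hf k)
  calc m = (f '' univ).ncard := by
        rw [Set.ncard_image_of_injective _ hinj, Set.ncard_univ, Nat.card_eq_fintype_card,
          Fintype.card_fin]
    _ ≤ _ := Set.ncard_le_ncard (by rintro _ ⟨h, -, rfl⟩; exact hfz h) (Set.toFinite _)

theorem sum_norm_T_sq_le {z : Fin d → H01 Ω} (hz : ∑ h, groupNorm a V z h ≤ Γ) :
    ∑ i, ‖E.T (z i)‖ ^ 2 ≤ Γ / S := by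
  rw [le_div_iff₀ R.S_pos, mul_comm, Finset.mul_sum]
  rw [sum_groupNorm R.decomp] at hz
  exact (Finset.sum_le_sum fun i _ => (R.coercive i _).2).trans hz

theorem le_add_ae (i j : Fin d) : ∀ᵐ x ∂volume.restrict Ω, β i j x ≤ C + K := by
  have hC := R.C_pos
  have hK := R.K_pos
  by_cases h : R.decomp.grp i = R.decomp.grp j
  · filter_upwards [R.same _ i (R.decomp.mem_grp i) j (h ▸ R.decomp.mem_grp j)] with x hx
    linarith
  · filter_upwards [R.different _ _ h i (R.decomp.mem_grp i) j (R.decomp.mem_grp j)] with x hx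
    linarith

/-- The total quartic interaction is at least ∑ y_h > 0 or an empty sum, so the negative parts
cannot exceed the positive ones, which C + K and the L⁴ bound control. -/
theorem sum_integral_negPart_le {z : Fin d → H01 Ω} (hz : Admissible a V β Γ z) :
    ∑ i, ∑ j, ∫ x in Ω, max (-(β i j x)) 0 * (fn (z i) x * fn (z j) x) ^ 2
      ≤ (C + K) * (Γ / S) ^ 2 := by
  have hCK : 0 ≤ C + K := (add_pos R.C_pos R.K_pos).le
  have h1 : ∑ i, ∑ j, ∫ x in Ω, max (-(β i j x)) 0 * (fn (z i) x * fn (z j) x) ^ 2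
      ≤ (C + K) * (∑ i, ‖E.T (z i)‖ ^ 2) ^ 2 - ∑ i, ∑ j, quartic (β i j) (z i) (z j) := by
    rw [sq (∑ i, ‖E.T (z i)‖ ^ 2), Finset.sum_mul_sum, Finset.mul_sum, ← Finset.sum_sub_distrib]
    refine Finset.sum_le_sum fun i _ => ?_
    rw [Finset.mul_sum, ← Finset.sum_sub_distrib]
    exact Finset.sum_le_sum fun j _ =>
      integral_negPart_le E (R.memLp_β i j) hCK (R.le_add_ae i j) (z i) (z j)
  have h2 : 0 ≤ ∑ i, ∑ j, quartic (β i j) (z i) (z j) := by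
    rw [← sum_sum_matM R.decomp]
    exact Finset.sum_nonneg fun h _ => (hz.pos h).le.trans (hz.le h)
  have h3 : (C + K) * (∑ i, ‖E.T (z i)‖ ^ 2) ^ 2 ≤ (C + K) * (Γ / S) ^ 2 :=
    mul_le_mul_of_nonneg_left (pow_le_pow_left₀ (Finset.sum_nonneg fun i _ => sq_nonneg _)
      (R.sum_norm_T_sq_le hz.sum_le) 2) hCK
  linarith

end WeakCooperation

/-- A level, depending only on the potentials and on the diagonal couplings, which is attained on
every Nehari set. -/
theorem exists_level [IsFiniteMeasure (volume.restrict Ω)] (hN : 1 ≤ N) (hΩo : IsOpen Ω)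
    (hΩn : Ω.Nonempty) (E : L4Embedding Ω) (ha : IsDecomposition d a)
    (hV : ∀ i, MemLp (V i) ⊤ (volume.restrict Ω)) {S : ℝ} (hS : 0 < S)
    (hc : ∀ i (w : H01 Ω), S * ‖E.T w‖ ^ 2 ≤ normSqV (V i) w)
    {b : Fin d → EuclideanSpace ℝ (Fin N) → ℝ} (hb : ∀ i, MemLp (b i) ⊤ (volume.restrict Ω))
    (hμ : ∀ i, ∃ μ : ℝ, 0 < μ ∧ ∀ᵐ x ∂volume.restrict Ω, μ ≤ b i x) :
    ∃ Γ : ℝ, 0 < Γ ∧ ∀ β : Fin d → Fin d → EuclideanSpace ℝ (Fin N) → ℝ,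
      (∀ i j, MemLp (β i j) ⊤ (volume.restrict Ω)) →
      (∀ i j, β i j =ᵐ[volume.restrict Ω] β j i) → (∀ i, β i i =ᵐ[volume.restrict Ω] b i) →
      ∃ u ∈ nehari Ω a V β, ∑ h, groupNorm a V u h < Γ := by
  obtain ⟨f, hf, hdisj, hne⟩ := exists_disjoint_bumps hN hΩo hΩn m
  choose μ hμ0 hμb using hμ
  have hq : ∀ i h, 0 < quartic (b i) (testElem (hf h)) (testElem (hf h)) := fun i h =>
    quartic_testElem_pos (hf h) (hne h) (hb i) (hμ0 i) (hμb i) E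
  -- If the L⁴ norm of a bump were 0, its quartic integral would be at most 0, against `hq`.
  have hn : ∀ i h, 0 < normSqV (V i) (testElem (hf h)) := fun i h => by
    refine (mul_pos hS (pow_pos ((norm_nonneg _).lt_of_ne' fun h0 => ?_) 2)).trans_le
      (hc i (testElem (hf h)))
    obtain ⟨B, hB0, hB⟩ := exists_ae_abs_le_of_memLp_top (hb i)
    have h1 := E.quartic_le (hb i) hB0 (hB.mono fun x hx => (le_abs_self _).trans hx)
      (testElem (hf h)) (testElem (hf h))
    rw [h0] at h1
    have h2 := hq i h
    simp only [ne_eq, OfNat.ofNat_ne_zero, not_false_eq_true, zero_pow, mul_zero] at h1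
    linarith
  refine ⟨∑ h, normSqV (V (ha.first h)) (testElem (hf h)) ^ 2
    / quartic (b (ha.first h)) (testElem (hf h)) (testElem (hf h)) + 1,
    add_pos_of_nonneg_of_pos (Finset.sum_nonneg fun h _ =>
      div_nonneg (sq_nonneg _) (hq _ h).le) one_pos, fun β hβ hs hd => ?_⟩
  obtain ⟨u, hu, hsum⟩ := exists_mem_nehari E ha hV hβ hs hd (w := fun h => testElem (hf h))
    (fun b h k hhk => quartic_testElem_eq_zero (hf h) (hf k) (fun x => hdisj h k x hhk) b)
    (fun h => hq _ h) (fun h => hn _ h)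
  exact ⟨u, hu, hsum.trans_lt (lt_add_one _)⟩

end Estimates

end NLSSystem

end

/-! ### Choice of the constants and conclusion -/

theorem theorem1p4 {N : ℕ} (hN1 : 1 ≤ N) (hN3 : N ≤ 3)
    (Ω : Set (EuclideanSpace ℝ (Fin N))) (hΩo : IsOpen Ω) (hΩc : IsConnected Ω)
    (hΩb : Bornology.IsBounded Ω)
    {d m : ℕ} (hd : 2 ≤ d) (hm : m ≤ d)
    (a : Fin (m + 1) → ℕ) (ha : NLSSystem.IsDecomposition d a)
    -- the data on which the constants may depend: the potentials, the diagonal couplings and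
    -- an upper bound for the couplings inside the groups
    (V : Fin d → EuclideanSpace ℝ (Fin N) → ℝ)
    (b : Fin d → EuclideanSpace ℝ (Fin N) → ℝ) (Λ : ℝ) :
    ∃ K γup γlow M : ℝ, 0 < K ∧ 0 < γup ∧ 0 < γlow ∧ 0 < M ∧
      ∀ β : Fin d → Fin d → EuclideanSpace ℝ (Fin N) → ℝ,
        NLSSystem.StandingAssumptions Ω V β →
        (∀ i, β i i =ᵐ[volume.restrict Ω] b i) →
        (∀ p ∈ NLSSystem.K1 d a, ∀ᵐ x ∂volume.restrict Ω, 0 ≤ β p.1 p.2 x) →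
        (∀ p ∈ NLSSystem.K1 d a, NLSSystem.normLp Ω ∞ (β p.1 p.2) ≤ ENNReal.ofReal Λ) →
        (∀ p ∈ NLSSystem.K2 d a,
          NLSSystem.normLp Ω ∞ (fun x => max (β p.1 p.2 x) 0) ≤ ENNReal.ofReal K) →
        ∃ u : Fin d → NLSSystem.H01 Ω,
          -- `u` is a nonnegative minimizer of `J` on the constraint
          (∀ i, ∀ᵐ x ∂volume.restrict Ω, 0 ≤ NLSSystem.fn (u i) x) ∧
          u ∈ NLSSystem.nehari Ω a V β ∩ NLSSystem.coneE Ω a β ∧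
          (∀ v ∈ NLSSystem.nehari Ω a V β ∩ NLSSystem.coneE Ω a β,
            NLSSystem.energy V β u ≤ NLSSystem.energy V β v) ∧
          -- `u` solves the system and has at least `m` non-zero components
          NLSSystem.IsSolution V β u ∧
          m ≤ Set.ncard {i : Fin d | NLSSystem.fn (u i) ≠ 0} ∧
          -- the estimates
          ∑ i, NLSSystem.normSqV (V i) (u i) ≤ γup ∧
          (∀ h : Fin m,
            γlow ≤ ∑ i ∈ NLSSystem.group d a h,
              (NLSSystem.normLp Ω 4 (NLSSystem.fn (u i))).toReal ^ 2) ∧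
          (∑ i, ∑ j, ∫ x in Ω, max (-(β i j x)) 0 *
            (NLSSystem.fn (u i) x * NLSSystem.fn (u j) x) ^ 2) ≤ M := by
  open NLSSystem in
  -- The properties of V and b are known only through an admissible β. If there is none, any
  -- constants do; otherwise one β₀ supplies these properties and the constants remain independent
  -- of β.
  by_cases hex : ∃ β₀ : Fin d → Fin d → EuclideanSpace ℝ (Fin N) → ℝ,
      StandingAssumptions Ω V β₀ ∧ ∀ i, β₀ i i =ᵐ[volume.restrict Ω] b i
  swap
  · exact ⟨1, 1, 1, 1, one_pos, one_pos, one_pos, one_pos, fun β h1 h2 =>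
      absurd ⟨β, h1, h2⟩ hex⟩
  obtain ⟨β₀, hβ₀, hb₀⟩ := hex
  have : IsFiniteMeasure (volume.restrict Ω) := ⟨by simpa using hΩb.measure_lt_top⟩
  have : Nonempty (Fin d) := ⟨⟨0, by omega⟩⟩
  obtain ⟨E⟩ := exists_L4Embedding hN1 hN3 hΩb
  have hb : ∀ i, MemLp (b i) ⊤ (volume.restrict Ω) := fun i =>
    (hβ₀.memLp_β i i).ae_eq (hb₀ i)
  have hμ : ∀ i, ∃ μ : ℝ, 0 < μ ∧ ∀ᵐ x ∂volume.restrict Ω, μ ≤ b i x := fun i => by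
    obtain ⟨μ, hμ, hle⟩ := hβ₀.β_diag i
    refine ⟨μ, hμ, ?_⟩
    filter_upwards [hle, hb₀ i] with x hx hx'
    rwa [← hx']
  choose l hl hle using hβ₀.V_lower
  choose α hα hαc using fun i => exists_coercive E (hβ₀.memLp_V i) (hl i) (hle i)
  obtain ⟨i₀, hi₀⟩ := Finite.exists_min α
  have hcoer : ∀ i (w : H01 Ω), α i₀ * ‖w‖ ^ 2 ≤ normSqV (V i) w ∧
      α i₀ * ‖E.T w‖ ^ 2 ≤ normSqV (V i) w := fun i w =>
    ⟨(mul_le_mul_of_nonneg_right (hi₀ i) (sq_nonneg _)).trans (hαc i w).1,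
      (mul_le_mul_of_nonneg_right (hi₀ i) (sq_nonneg _)).trans (hαc i w).2⟩
  have hS := hα i₀
  obtain ⟨Γ, hΓ, hlevel⟩ := exists_level hN1 hΩo hΩc.nonempty E ha hβ₀.memLp_V hS
    (fun i w => (hcoer i w).2) hb hμ
  choose B hB0 hB using fun i => exists_ae_abs_le_of_memLp_top (hb i)
  -- A common upper bound for the diagonal couplings and those inside the groups; the summand 1
  -- makes it positive.
  set C : ℝ := max Λ 0 + ∑ i, B i + 1 with hC
  -- Equality in the smallness condition 8 K Γ ≤ S².
  set K : ℝ := α i₀ ^ 2 / (8 * Γ) with hK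
  have hBsum : 0 ≤ ∑ i, B i := Finset.sum_nonneg fun i _ => hB0 i
  have hΛ : 0 ≤ max Λ 0 := le_max_right _ _
  have hCpos : 0 < C := by positivity
  have hKpos : 0 < K := by positivity
  refine ⟨K, Γ, α i₀ / (2 * C), (C + K) * (Γ / α i₀) ^ 2, hKpos, hΓ, by positivity,
    by positivity, fun β hβ hdiag _ hK1 hK2 => ?_⟩
  have R : WeakCooperation E a V β (α i₀) C K Γ :=
    { decomp := ha
      memLp_V := hβ.memLp_V
      memLp_β := hβ.memLp_β
      symm := hβ.symm
      S_pos := hS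
      C_pos := hCpos
      K_pos := hKpos
      coercive := hcoer
      same := fun h i hi j hj => by
        rcases eq_or_ne i j with rfl | hij
        · have h1 : B i ≤ ∑ i, B i :=
            Finset.single_le_sum (fun j _ => hB0 j) (Finset.mem_univ i)
          filter_upwards [hdiag i, hB i] with x hx hx'
          rw [hx]
          have := le_abs_self (b i x)
          linarith
        · filter_upwards [ae_abs_le_of_normLp_top_le (hK1 (i, j) ⟨hij, h, hi, hj⟩)] with x hx
          have := le_abs_self (β i j x)
          linarith
      different := fun h k hhk i hi j hj => by
        filter_upwards [ae_abs_le_of_normLp_top_le (hK2 (i, j) ⟨h, k, hhk, hi, hj⟩)] with x hx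
        rw [max_eq_left hKpos.le] at hx
        exact (le_max_left _ _).trans ((le_abs_self _).trans hx)
      small := by rw [hK]; field_simp; exact le_rfl }
  obtain ⟨z, hzN, hz, hnn, hmin⟩ := R.exists_minimizer (hlevel β hβ.memLp_β hβ.symm hdiag)
  have hlow : ∀ h, α i₀ / (2 * C) ≤ groupL4 E a z h := fun h =>
    R.le_groupL4 hz.sum_le (hz.pos h) (hz.le h)
  refine ⟨z, hnn, ⟨hzN, R.mem_coneE hz⟩, fun v hv => ?_, R.isSolution hzN hz hmin,
    R.le_ncard fun h => (by positivity : 0 < α i₀ / (2 * C)).trans_le (hlow h), ?_, fun h => ?_,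
    R.sum_integral_negPart_le hz⟩
  · have h1 := R.four_mul_energy hzN
    have h2 := R.four_mul_energy hv.1
    have h3 := hmin v hv.1
    linarith
  · rw [← sum_groupNorm ha]; exact hz.sum_le
  · simp only [normLp_four_toReal E]
    exact hlow h
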